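/- **Setting.** Let $0\le c<1<d\le 2$, $\Omega=(c,d)$, $\Omega_1=(c,1)$, $\Omega_2=(1,d)$, and let $a:[c,d]\to\mathbb R$ satisfy: (i) $a(1)=0$, $a>0$ on $[c,d]\setminus\{1\}$, and there are $x_1^*\in[c,1)$, $x_2^*\in(1,d]$ such that $a$ is decreasing on $(x_1^*,1)$, increasing on $(1,x_2^*)$, and $$\sup_{[x_1^*,1)}\frac{(1-x)|a'(x)|}{a(x)}=\lim_{x\nearrow1}\frac{(1-x)|a'(x)|}{a(x)}>0,\qquad \sup_{(1,x_2^*]}\frac{(x-1)|a'(x)|}{a(x)}=\lim_{x\searrow1}\frac{(x-1)|a'(x)|}{a(x)}>0$$ (all four quantities finite); (ii) $a\in C([c,d])\cap C^1([c,d]\setminus\{1\})$; (iii) $(\sqrt a)_x\notin L^\infty(\Omega)$ and $1/(\sqrt a)_x\in L^\infty(\Omega)$. Put $\|u\|_a^2=\int_\Omega(u^2+a u_x^2)\,dx$. Let $H^1_{a,0}$ be the closure of $C_c^\infty(\Omega)$ in $\|\cdot\|_a$. Let $W^1_a$ be the space of $u\in L^2(\Omega)$ with $\int_\Omega a u_x^2\,dx<\infty$,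 where $u_x$ is the distributional derivative in $\Omega$ and is also required to lie in $L^1(\Omega)$ if $1/a\in L^1(\Omega)$, and is the distributional derivative in $\Omega\setminus\{1\}$ if $1/a\notin L^1(\Omega)$. Let $W^1_{a,0}=\{u\in W^1_a: u(c)=u(d)=0\}$ and $W^2_a=\{u\in W^1_a: au_x\in W^{1,2}(\Omega)\}$. Fix a linear space $V=V^1_{a,0}$ with $H^1_{a,0}\subseteq V\subseteq W^1_{a,0}$, normed by $\|u\|_V=(\int_\Omega a u_x^2\,dx)^{1/2}$, and let $V^{-1}_a$ be its dual with pivot space $L^2(\Omega)$. Consider the controlled transmission problem $$y_{tt}-(a y_x)_x=0\ \text{ in }(0,T)\times\Omega_i,\ i=1,2,\qquad y(t,c)=f_c(t),\quad y(t,d)=f_d(t),\qquad y(0)=y_0,\quad y_t(0)=y_1,$$ with the following transmission conditions at $x=1$. If $1/a\in L^1(\Omega)$: $y$ and $ay_x$ have equal finite one-sided limits at $1$. If $1/a\notin L^1(\Omega)$: the one-sided limits of $ay_x$ at $1$ vanish, and those of $a\varphi_x y$ vanish for every $\varphi\in W^2_a$. Let $\mathcal A(u,v)=(v,(au_x)_x)$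 in $V\times L^2(\Omega)$, with domain the set of $(u,v)\in V\times V$ such that $au_x\in W^{1,2}(\Omega)$ and $u$ satisfies the transmission conditions. The mild solution of the backward homogeneous problem on $[0,\tau]$ with final data $(w_0,w_1)\in V\times L^2(\Omega)$ is the pair $(w,w_t)\in C([0,\tau];V\times L^2(\Omega))$ with value $(w_0,w_1)$ at $\tau$ such that, for all $t\in[0,\tau]$, $\int_t^\tau(w,w_t)\,ds\in D(\mathcal A)$ and $\mathcal A\int_t^\tau(w,w_t)\,ds=(w_0,w_1)-(w,w_t)(t)$. Its boundary derivatives $w_x(\cdot,c),w_x(\cdot,d)\in L^2(0,\tau)$ are the $L^2(0,\tau)$-limits of those of classical solutions ($C^1$ in time with values in $V\times L^2(\Omega)$) whose final data converge to $(w_0,w_1)$. A function $y\in C([0,T];L^2(\Omega))\cap C^1([0,T];V^{-1}_a)$ is a *solution by transposition* on $[0,T]$ if, for every $\tau\in(0,T]$ and all $(w_0,w_1)\in V\times L^2(\Omega)$, with $w$ this mild solution, $$\langle y_t(\tau),w_0\rangle-\int_\Omega y(\tau)w_1\,dx=\langle y_1,w(0)\rangle-\int_\Omega y_0w_t(0)\,dx-a(d)\int_0^\tau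 f_d(t)\,w_x(t,d)\,dt+a(c)\int_0^\tau f_c(t)\,w_x(t,c)\,dt .$$ **Theorem.** Let $T>0$. For all $f_c,f_d\in L^2(0,T)$ and $(y_0,y_1)\in L^2(\Omega)\times V^{-1}_a$ the controlled transmission problem has a unique solution by transposition on $[0,T]$, and $(y,y_t)\in C([0,T];L^2(\Omega)\times V^{-1}_a)$. The map $(y_0,y_1,f_c,f_d)\mapsto(y,y_t)$ is linear, and there is a constant $C(T)>0$, independent of the data, with $$\|y\|_{L^\infty(0,T;L^2(\Omega))}+\|y_t\|_{L^\infty(0,T;V^{-1}_a)}\le C(T)\left[\|y_0\|_{L^2(\Omega)}+\|y_1\|_{V^{-1}_a}+\|f_c\|_{L^2(0,T)}+\|f_d\|_{L^2(0,T)}\right].$$ -/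

import Mathlib

open MeasureTheory Set Filter Topology
open scoped ContDiff

noncomputable section

namespace DegWave

/-- `L²(Ω)` for `Ω = (c, d)`. -/
abbrev L2 (c d : ℝ) : Type := Lp ℝ 2 (volume.restrict (Ioo c d))

/-- Pairs `(u, p)` of elements of `L²(Ω)`. A function `u` of finite norm
`‖u‖_a = (∫ u² + a u_x²)^(1/2)` is represented by the pair `(u, √a u_x)`, which `u` determines;
the norm topology of the product is then the topology of `‖·‖_a`. -/
abbrev Pairs (c d : ℝ) : Type := L2 c d × L2 c d

/-- Properties (i), (ii), (iii) of a weight `a` on `[c, d]` that degenerates at `1`. -/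
structure IsWeight (c d : ℝ) (a : ℝ → ℝ) : Prop where
  zero_at_one : a 1 = 0
  pos : ∀ x ∈ Icc c d, x ≠ 1 → 0 < a x
  left : ∃ x₁ ∈ Ico c 1, ∃ μ₁ : ℝ, 0 < μ₁ ∧ AntitoneOn a (Ioo x₁ 1) ∧
    IsLUB ((fun x => (1 - x) * |derivWithin a (Icc c d) x| / a x) '' Ico x₁ 1) μ₁ ∧
    Tendsto (fun x => (1 - x) * |derivWithin a (Icc c d) x| / a x) (𝓝[<] 1) (𝓝 μ₁)
  right : ∃ x₂ ∈ Ioc 1 d, ∃ μ₂ : ℝ, 0 < μ₂ ∧ MonotoneOn a (Ioo 1 x₂) ∧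
    IsLUB ((fun x => (x - 1) * |derivWithin a (Icc c d) x| / a x) '' Ioc 1 x₂) μ₂ ∧
    Tendsto (fun x => (x - 1) * |derivWithin a (Icc c d) x| / a x) (𝓝[>] 1) (𝓝 μ₂)
  continuousOn : ContinuousOn a (Icc c d)
  contDiffOn : ContDiffOn ℝ 1 a (Icc c d \ {1})
  /-- `(√a)_x` is not essentially bounded. -/
  sqrt_deriv_unbounded :
    ¬ ∃ K : ℝ, ∀ᵐ x ∂(volume.restrict (Ioo c d)), |deriv (fun s => √(a s)) x| ≤ K
  /-- `1 / (√a)_x` is essentially bounded. -/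
  sqrt_deriv_inv_bounded :
    ∃ k : ℝ, 0 < k ∧ ∀ᵐ x ∂(volume.restrict (Ioo c d)), k ≤ |deriv (fun s => √(a s)) x|

/-- Weak degeneration: `1/a ∈ L¹(Ω)`. Strong degeneration is the negation. -/
def WeakDegeneration (c d : ℝ) (a : ℝ → ℝ) : Prop :=
  IntegrableOn (fun x => 1 / a x) (Ioo c d)

/-- `g` is the distributional derivative of `u` in the open set `O`. -/
def HasWeakDerivOn (O : Set ℝ) (u g : ℝ → ℝ) : Prop :=
  LocallyIntegrableOn u O ∧ LocallyIntegrableOn g O ∧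
    ∀ φ : ℝ → ℝ, ContDiff ℝ ∞ φ → HasCompactSupport φ → tsupport φ ⊆ O →
      ∫ x in O, u x * deriv φ x = - ∫ x in O, g x * φ x

/-- The filter of points of full measure in `Ω` that approach along `l`. A limit along it is the
limit of the continuous representative, whenever there is one. -/
def essFilter (c d : ℝ) (l : Filter ℝ) : Filter ℝ := l ⊓ ae (volume.restrict (Ioo c d))

/-- The derivative `u_x = p / √a` of a function that is represented by `e = (u, p)`. -/
def slope {c d : ℝ} (a : ℝ → ℝ) (e : Pairs c d) : ℝ → ℝ := fun x => e.2 x / √(a x)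

/-- The flux `a u_x = √a p` of a function that is represented by `e = (u, p)`. -/
def flux {c d : ℝ} (a : ℝ → ℝ) (e : Pairs c d) : ℝ → ℝ := fun x => √(a x) * e.2 x

/-- The pairs `(φ, √a φ_x)` with `φ ∈ C_c^∞(Ω)`. -/
def testPairs (c d : ℝ) (a : ℝ → ℝ) : Set (Pairs c d) :=
  {e | ∃ φ : ℝ → ℝ, ContDiff ℝ ∞ φ ∧ HasCompactSupport φ ∧ tsupport φ ⊆ Ioo c d ∧
    e.1 =ᵐ[volume.restrict (Ioo c d)] φ ∧
    e.2 =ᵐ[volume.restrict (Ioo c d)] fun x => √(a x) * deriv φ x}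

/-- `H¹_{a,0}(Ω)`, the closure of `C_c^∞(Ω)` in the norm `‖·‖_a`. -/
def H10 (c d : ℝ) (a : ℝ → ℝ) : Set (Pairs c d) := closure (testPairs c d a)

/-- `W¹_a(Ω)`: `u ∈ L²(Ω)` with `u_x ∈ L²(Ω, a dx)`. Under weak degeneration `u_x` is the
distributional derivative in `Ω`, and integrable; under strong degeneration it is the
distributional derivative in `Ω \ {1}` (a jump or singularity at `1` is allowed). -/
def W1 (c d : ℝ) (a : ℝ → ℝ) : Set (Pairs c d) :=
  {e | (WeakDegeneration c d a →
          HasWeakDerivOn (Ioo c d) e.1 (slope a e) ∧ IntegrableOn (slope a e) (Ioo c d)) ∧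
       (¬ WeakDegeneration c d a → HasWeakDerivOn (Ioo c d \ {1}) e.1 (slope a e))}

/-- `W¹_{a,0}(Ω)`: the elements of `W¹_a(Ω)` that vanish at `c` and `d`. -/
def W10 (c d : ℝ) (a : ℝ → ℝ) : Set (Pairs c d) :=
  {e | e ∈ W1 c d a ∧ Tendsto e.1 (essFilter c d (𝓝[>] c)) (𝓝 0) ∧
    Tendsto e.1 (essFilter c d (𝓝[<] d)) (𝓝 0)}

/-- `W²_a(Ω)`: the elements of `W¹_a(Ω)` with `a u_x ∈ W^{1,2}(Ω)`. -/
def W2 (c d : ℝ) (a : ℝ → ℝ) : Set (Pairs c d) :=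
  {e | e ∈ W1 c d a ∧ ∃ f : L2 c d, HasWeakDerivOn (Ioo c d) (flux a e) f}

/-- A linear space `V¹_{a,0}(Ω)` between `H¹_{a,0}(Ω)` and `W¹_{a,0}(Ω)`. -/
def IsIntermediate (c d : ℝ) (a : ℝ → ℝ) (V : Submodule ℝ (Pairs c d)) : Prop :=
  H10 c d a ⊆ V ∧ (V : Set (Pairs c d)) ⊆ W10 c d a

/-- The transmission conditions at `1`. -/
def Transmission (c d : ℝ) (a : ℝ → ℝ) (e : Pairs c d) : Prop :=
  (WeakDegeneration c d a →
    (∃ l : ℝ, Tendsto e.1 (essFilter c d (𝓝[<] 1)) (𝓝 l) ∧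
      Tendsto e.1 (essFilter c d (𝓝[>] 1)) (𝓝 l)) ∧
    (∃ l : ℝ, Tendsto (flux a e) (essFilter c d (𝓝[<] 1)) (𝓝 l) ∧
      Tendsto (flux a e) (essFilter c d (𝓝[>] 1)) (𝓝 l))) ∧
  (¬ WeakDegeneration c d a →
    (∀ φ ∈ W2 c d a,
      Tendsto (fun x => flux a φ x * e.1 x) (essFilter c d (𝓝[<] 1)) (𝓝 0) ∧
      Tendsto (fun x => flux a φ x * e.1 x) (essFilter c d (𝓝[>] 1)) (𝓝 0)) ∧
    (Tendsto (flux a e) (essFilter c d (𝓝[<] 1)) (𝓝 0) ∧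
      Tendsto (flux a e) (essFilter c d (𝓝[>] 1)) (𝓝 0)))

/-- The space `V¹_{a,0}(Ω)` with its energy norm `‖u‖ = (∫ a u_x²)^(1/2) = ‖p‖_{L²}`. -/
def Energy {c d : ℝ} (V : Submodule ℝ (Pairs c d)) : Type := V

namespace Energy

variable {c d : ℝ} {V : Submodule ℝ (Pairs c d)}

instance : AddCommGroup (Energy V) := inferInstanceAs (AddCommGroup V)

instance : Module ℝ (Energy V) := inferInstanceAs (Module ℝ V)

/-- The pair `(u, √a u_x)`. -/
def pair : Energy V →ₗ[ℝ] Pairs c d := V.subtype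

/-- `√a u_x`. -/
def weightedSlope : Energy V →ₗ[ℝ] L2 c d := LinearMap.snd ℝ (L2 c d) (L2 c d) ∘ₗ pair

instance : SeminormedAddCommGroup (Energy V) :=
  SeminormedAddCommGroup.induced (Energy V) (L2 c d) (weightedSlope (V := V))

instance : NormedSpace ℝ (Energy V) :=
  NormedSpace.induced ℝ (Energy V) (L2 c d) (weightedSlope (V := V))

end Energy

/-- `V^{-1}_a(Ω)`, the dual of `V¹_{a,0}(Ω)`, with the dual norm. -/
abbrev EnergyDual {c d : ℝ} (V : Submodule ℝ (Pairs c d)) : Type := StrongDual ℝ (Energy V)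

/-- `(u, v) ∈ D(𝒜)` and `𝒜 (u, v) = (v, (a u_x)_x) = (u', v')`, as elements of
`V¹_{a,0}(Ω) × L²(Ω)`. In particular `v ∈ V¹_{a,0}(Ω)` and `a u_x ∈ W^{1,2}(Ω)`. -/
structure Gen {c d : ℝ} (a : ℝ → ℝ) (V : Submodule ℝ (Pairs c d))
    (u : Energy V) (v : L2 c d) (u' : Energy V) (v' : L2 c d) : Prop where
  fst : u'.pair.1 = v
  snd : HasWeakDerivOn (Ioo c d) (flux a u.pair) v'
  transmission : Transmission c d a u.pair

/-- `(w, z)`, with `z = w_t`, is a mild solution on `[0, τ]` of `d/dt (w, z) = 𝒜 (w, z)`: it is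
continuous with values in `V¹_{a,0}(Ω) × L²(Ω)`, and for all `t` the integral of `(w, z)` over
`[t, τ]` belongs to `D(𝒜)` and is mapped by `𝒜` to `(w, z)(τ) - (w, z)(t)`. -/
structure IsMild {c d : ℝ} (a : ℝ → ℝ) (V : Submodule ℝ (Pairs c d)) (τ : ℝ)
    (w : ℝ → Energy V) (z : ℝ → L2 c d) : Prop where
  continuousOn_fst : ContinuousOn (fun t => (w t).pair) (Icc 0 τ)
  continuousOn_snd : ContinuousOn z (Icc 0 τ)
  eqn : ∀ t ∈ Icc 0 τ, ∃ J : Energy V, J.pair = (∫ s in t..τ, (w s).pair) ∧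
    Gen a V J (∫ s in t..τ, z s) (w τ - w t) (z τ - z t)

/-- `(w, z)` is a classical solution on `[0, τ]` of `d/dt (w, z) = 𝒜 (w, z)`. -/
def IsClassical {c d : ℝ} (a : ℝ → ℝ) (V : Submodule ℝ (Pairs c d)) (τ : ℝ)
    (w : ℝ → Energy V) (z : ℝ → L2 c d) : Prop :=
  ∃ (w' : ℝ → Energy V) (z' : ℝ → L2 c d),
    ContinuousOn (fun t => (w' t).pair) (Icc 0 τ) ∧ ContinuousOn z' (Icc 0 τ) ∧
    ∀ t ∈ Icc 0 τ,
      HasDerivWithinAt (fun s => (w s).pair) (w' t).pair (Icc 0 τ) t ∧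
      HasDerivWithinAt z (z' t) (Icc 0 τ) t ∧
      Gen a V (w t) (z t) (w' t) (z' t)

/-- `gc = w_x(·, c)` and `gd = w_x(·, d)` in `L²(0, τ)` for a mild solution `(w, z)`: they are the
`L²(0, τ)`-limits of these derivatives for classical solutions whose data at time `τ` converge
to those of `(w, z)`. -/
def HasNormalTraces {c d : ℝ} (a : ℝ → ℝ) (V : Submodule ℝ (Pairs c d)) (τ : ℝ)
    (w : ℝ → Energy V) (z : ℝ → L2 c d) (gc gd : ℝ → ℝ) : Prop :=
  MemLp gc 2 (volume.restrict (Ioo 0 τ)) ∧ MemLp gd 2 (volume.restrict (Ioo 0 τ)) ∧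
  ∃ (W : ℕ → ℝ → Energy V) (Z : ℕ → ℝ → L2 c d) (Gc Gd : ℕ → ℝ → ℝ),
    (∀ n, IsClassical a V τ (W n) (Z n)) ∧
    (∀ n, ∀ t ∈ Icc 0 τ,
      Tendsto (slope a (W n t).pair) (essFilter c d (𝓝[>] c)) (𝓝 (Gc n t)) ∧
      Tendsto (slope a (W n t).pair) (essFilter c d (𝓝[<] d)) (𝓝 (Gd n t))) ∧
    Tendsto (fun n => (W n τ).pair) atTop (𝓝 (w τ).pair) ∧
    Tendsto (fun n => Z n τ) atTop (𝓝 (z τ)) ∧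
    Tendsto (fun n => eLpNorm (Gc n - gc) 2 (volume.restrict (Ioo 0 τ))) atTop (𝓝 0) ∧
    Tendsto (fun n => eLpNorm (Gd n - gd) 2 (volume.restrict (Ioo 0 τ))) atTop (𝓝 0)

/-- The space `L²(Ω) × V^{-1}_a(Ω) × L²(0,T) × L²(0,T)` of the data `(y₀, y₁, f_c, f_d)`. -/
abbrev Data {c d : ℝ} (V : Submodule ℝ (Pairs c d)) (T : ℝ) : Type :=
  L2 c d × EnergyDual V × Lp ℝ 2 (volume.restrict (Ioo 0 T)) ×
    Lp ℝ 2 (volume.restrict (Ioo 0 T))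

/-- The space `C([0,T]; L²(Ω)) × C([0,T]; V^{-1}_a(Ω))` of the pairs `(y, y_t)`. -/
abbrev Trajectories {c d : ℝ} (V : Submodule ℝ (Pairs c d)) (T : ℝ) : Type :=
  C(Icc (0 : ℝ) T, L2 c d) × C(Icc (0 : ℝ) T, EnergyDual V)

/-- `y` is the solution by transposition on `[0, T]` with data `(y₀, y₁, f_c, f_d)`, and
`η = y_t`. -/
structure IsTranspositionSolution {c d : ℝ} (a : ℝ → ℝ) (V : Submodule ℝ (Pairs c d)) (T : ℝ)
    (D : Data V T) (Y : Trajectories V T) : Prop where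
  /-- `y`, as a map into `V^{-1}_a(Ω)` through the pivot space `L²(Ω)`, has derivative `η`. -/
  deriv : ∃ y : ℝ → EnergyDual V, ∀ t : Icc (0 : ℝ) T,
    (∀ v : Energy V, y t v = inner ℝ (Y.1 t) v.pair.1) ∧
    HasDerivWithinAt y (Y.2 t) (Icc 0 T) t
  /-- The transposition identity at every time `τ ∈ (0, T]`, where `w` is the mild solution of
  the homogeneous problem with `w(τ) = w₀` and `w_t(τ) = w₁`, and `z = w_t`. -/
  identity : ∀ τ : Icc (0 : ℝ) T, 0 < (τ : ℝ) → ∀ (w₀ : Energy V) (w₁ : L2 c d),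
    ∃ (w : ℝ → Energy V) (z : ℝ → L2 c d) (gc gd : ℝ → ℝ),
      IsMild a V τ w z ∧ w τ = w₀ ∧ z τ = w₁ ∧ HasNormalTraces a V τ w z gc gd ∧
      Y.2 τ w₀ - inner ℝ (Y.1 τ) w₁ =
        D.2.1 (w 0) - inner ℝ D.1 (z 0)
          - a d * (∫ t in Ioo 0 (τ : ℝ), D.2.2.2 t * gd t)
          + a c * (∫ t in Ioo 0 (τ : ℝ), D.2.2.1 t * gc t)

end DegWave

end

/-! Write p = √a u_x. Hypothesis (iii) and the mean value theorem give √a ≥ k|x - 1|, hence Hardy's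
inequality ‖u‖ ≤ (2/k)‖p‖ on the closure of the test functions. The choice of V is then immaterial:
every admissible V equals H¹_{a,0} (`IsIntermediate.coe_eq_H10`). Indeed, if r ∈ L² is orthogonal to
all √a φ_x, then √a r is a constant K. Under weak degeneration ⟨r, p⟩ = K ∫ u_x = 0, since u
vanishes at c and d; under strong degeneration K ≠ 0 would make 1/a = r²/K² integrable. So every
slope p of W¹_{a,0} is a limit of test slopes, and p determines u.

Thus V is a Hilbert space, isometric to its space of slopes. With j : p ↦ u, the generator has the
bounded skew inverse B(u', v') = (-j* v', j u') (`IsIntermediate.gen_iff`). The transmission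
conditions impose nothing further: they hold for every u ∈ V with (a u_x)_x ∈ L²
(`IsIntermediate.transmission`). The evolution is expressed through B alone, so that no unbounded
operator is needed: an injective bounded skew B is the inverse of the generator of an orthogonal
group U (`IsSkew.exists_group`), and mild solutions are exactly its trajectories.

The boundary values of a u_x along trajectories are square integrable in time with a bound by the
energy (hidden regularity). The multiplier is (x - 1) a u_x. Since it is centred at the degenerate
point, the boundary terms (d - 1)(a u_x)²(d) and (1 - c)(a u_x)²(c) have the same good sign; the
other terms are an exact time derivative and quantities bounded by the energy, because (x - 1)a' is
bounded. Hence the observed boundary fluxes extend to bounded maps Ψ_c, Ψ_d from states to L²(0,T).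

The solution comes from duality. Let ξ represent (y₁, -y₀) and let Φ(τ) be the adjoint of Ψ composed
with time reversal. Then Z(τ) = U(τ)ξ - Φ_d(τ)f_d + Φ_c(τ)f_c represents the right-hand side of the
transposition identity, and its components are y_t and -y. Continuity and the estimate follow
because U is isometric and strongly continuous and translations are continuous in L². That y_t is
the derivative of y follows from the integrated equation, tested with states that are not seen at
the boundary. Mild solutions and their traces are unique, so the identity fixes Z(τ) for τ > 0, and
continuity fixes Z(0). -/

namespace DegWave

/-! ### Orthogonal groups whose generator has a bounded skew inverse -/

section SkewGroup

open scoped InnerProductSpace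

variable {X : Type*} [NormedAddCommGroup X] [InnerProductSpace ℝ X]

/-- A bounded operator with `⟪B x, y⟫ = -⟪x, B y⟫`. -/
def IsSkew (B : X →L[ℝ] X) : Prop := ∀ x y, ⟪B x, y⟫_ℝ = -⟪x, B y⟫_ℝ

theorem IsSkew.inner_self {B : X →L[ℝ] X} (hB : IsSkew B) (x : X) : ⟪B x, x⟫_ℝ = 0 := by
  have h := hB x x
  rw [real_inner_comm] at h
  rw [real_inner_comm]
  linarith

theorem IsSkew.sub {A B : X →L[ℝ] X} (hA : IsSkew A) (hB : IsSkew B) : IsSkew (A - B) := by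
  intro x y
  simp only [sub_apply, inner_sub_left, inner_sub_right, hA x y, hB x y]
  ring

theorem isSkew_of_inner_self {B : X →L[ℝ] X} (hB : ∀ x, ⟪B x, x⟫_ℝ = 0) : IsSkew B := by
  intro x y
  have h := hB (x + y)
  simp only [map_add, inner_add_left, inner_add_right, hB] at h
  rw [real_inner_comm (B y) x]
  linarith

theorem exp_apply_comm {A C : X →L[ℝ] X} (h : Commute A C) (t : ℝ) (x : X) :
    NormedSpace.exp (t • A) (C x) = C (NormedSpace.exp (t • A) x) := by
  have : Commute (NormedSpace.exp (t • A)) C := (h.smul_left t).exp_left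
  exact congrArg (fun F : X →L[ℝ] X => F x) this.eq

variable [CompleteSpace X]

/-- If x is orthogonal to the range, then ‖Bx‖² = -⟪x, B(Bx)⟫ = 0, and injectivity gives x = 0. -/
theorem IsSkew.denseRange {B : X →L[ℝ] X} (hB : IsSkew B) (hi : Function.Injective B) :
    DenseRange B := by
  have h : (LinearMap.range (B : X →ₗ[ℝ] X)).topologicalClosure = ⊤ := by
    rw [Submodule.topologicalClosure_eq_top_iff, Submodule.eq_bot_iff]
    intro x hx
    apply hi
    rw [map_zero, ← inner_self_eq_zero (𝕜 := ℝ), hB, real_inner_comm]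
    have := (Submodule.mem_orthogonal _ _).1 hx (B (B x)) ⟨B x, rfl⟩
    linarith
  have h2 := Submodule.dense_iff_topologicalClosure_eq_top.2 h
  exact h2

/-- `ε - B²` is invertible for skew `B`, and `ε > 0`. -/
theorem IsSkew.exists_resolvent {B : X →L[ℝ] X} (hB : IsSkew B) {ε : ℝ} (hε : 0 < ε) :
    ∃ G : X →L[ℝ] X, (∀ x, ε • G x - B (B (G x)) = x) ∧ ∀ x, G (ε • x - B (B x)) = x := by
  let S : X →L[ℝ] X := ε • ContinuousLinearMap.id ℝ X - B ∘L B
  let b : X →L[ℝ] X →L[ℝ] ℝ := (innerSL ℝ) ∘L S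
  have hb : ∀ x y, b x y = ⟪S x, y⟫_ℝ := fun x y => rfl
  -- Skewness gives ⟪(ε - B²)u, u⟫ = ε‖u‖² + ‖Bu‖², so Lax-Milgram applies.
  have hc : IsCoercive b := by
    refine ⟨ε, hε, fun u => ?_⟩
    rw [hb]
    simp only [S, sub_apply, smul_apply,
      ContinuousLinearMap.id_apply, ContinuousLinearMap.comp_apply, inner_sub_left,
      real_inner_smul_left]
    rw [hB (B u) u, real_inner_self_eq_norm_sq, real_inner_self_eq_norm_sq]
    nlinarith [sq_nonneg ‖B u‖]
  let e := hc.continuousLinearEquivOfBilin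
  have he : ∀ x, e x = S x := fun x => ext_inner_right ℝ fun y => by
    rw [hc.continuousLinearEquivOfBilin_apply, hb]
  refine ⟨e.symm, fun x => ?_, fun x => ?_⟩
  · have := he (e.symm x)
    rw [e.apply_symm_apply] at this
    exact this.symm
  · have := he x
    change e.symm (S x) = x
    rw [← this, e.symm_apply_apply]

theorem hasDerivAt_exp_apply (A : X →L[ℝ] X) (x : X) (t : ℝ) :
    HasDerivAt (fun s : ℝ => NormedSpace.exp (s • A) x) (NormedSpace.exp (t • A) (A x)) t := by
  have h := hasDerivAt_exp_smul_const (𝕂 := ℝ) A t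
  exact ((ContinuousLinearMap.apply ℝ X x).hasFDerivAt.comp_hasDerivAt t h)

theorem IsSkew.inner_exp {A : X →L[ℝ] X} (hA : IsSkew A) (t : ℝ) (x y : X) :
    ⟪NormedSpace.exp (t • A) x, NormedSpace.exp (t • A) y⟫_ℝ = ⟪x, y⟫_ℝ := by
  have hd : ∀ s : ℝ, HasDerivAt (fun s : ℝ => ⟪NormedSpace.exp (s • A) x,
      NormedSpace.exp (s • A) y⟫_ℝ) 0 s := by
    intro s
    have h := (hasDerivAt_exp_apply A x s).inner ℝ (hasDerivAt_exp_apply A y s)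
    refine h.congr_deriv ?_
    rw [exp_apply_comm (Commute.refl A), exp_apply_comm (Commute.refl A), hA]
    ring
  have h := is_const_of_deriv_eq_zero (fun s => (hd s).differentiableAt)
    (fun s => (hd s).deriv) t 0
  simpa using h

theorem IsSkew.norm_exp {A : X →L[ℝ] X} (hA : IsSkew A) (t : ℝ) (x : X) :
    ‖NormedSpace.exp (t • A) x‖ = ‖x‖ := by
  have h := hA.inner_exp t x x
  rw [real_inner_self_eq_norm_sq, real_inner_self_eq_norm_sq] at h
  exact (sq_eq_sq₀ (norm_nonneg _) (norm_nonneg _)).1 h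

theorem exp_neg_apply (A : X →L[ℝ] X) (t : ℝ) (x : X) :
    NormedSpace.exp (t • A) (NormedSpace.exp ((-t) • A) x) = x := by
  have h : NormedSpace.exp (t • A + (-t) • A) = NormedSpace.exp (t • A) *
      NormedSpace.exp ((-t) • A) :=
    let : NormedAlgebra ℚ (X →L[ℝ] X) := NormedAlgebra.restrictScalars ℚ ℝ _
    NormedSpace.exp_add_of_commute (((Commute.refl A).smul_left t).smul_right (-t))
  have h2 := congrArg (fun F : X →L[ℝ] X => F x) h
  simp only [neg_smul, add_neg_cancel, NormedSpace.exp_zero] at h2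
  rw [neg_smul]
  exact h2.symm

theorem IsSkew.inner_exp_left {A : X →L[ℝ] X} (hA : IsSkew A) (t : ℝ) (x y : X) :
    ⟪NormedSpace.exp (t • A) x, y⟫_ℝ = ⟪x, NormedSpace.exp ((-t) • A) y⟫_ℝ := by
  rw [← hA.inner_exp t x, exp_neg_apply]

theorem IsSkew.norm_exp_sub_exp_le {A : X →L[ℝ] X} (hA : IsSkew A) (s t : ℝ) (x : X) :
    ‖NormedSpace.exp (t • A) x - NormedSpace.exp (s • A) x‖ ≤ ‖A x‖ * |t - s| := by
  have h := (convex_univ (𝕜 := ℝ) (E := ℝ)).norm_image_sub_le_of_norm_hasDerivWithin_le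
    (f := fun s : ℝ => NormedSpace.exp (s • A) x) (C := ‖A x‖)
    (fun r _ => (hasDerivAt_exp_apply A x r).hasDerivWithinAt)
    (fun r _ => (hA.norm_exp r _).le) (mem_univ s) (mem_univ t)
  simpa using h

/-- As A and C commute, exp(tA) - exp(tC) = exp(tC)(exp(t(A - C)) - 1), where the first factor is an
isometry and A - C is again skew. -/
theorem IsSkew.norm_exp_sub_le {A C : X →L[ℝ] X} (hA : IsSkew A) (hC : IsSkew C)
    (h : Commute A C) (t : ℝ) (x : X) :
    ‖NormedSpace.exp (t • A) x - NormedSpace.exp (t • C) x‖ ≤ ‖A x - C x‖ * |t| := by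
  have h1 : NormedSpace.exp (t • C + t • (A - C)) = NormedSpace.exp (t • C) *
      NormedSpace.exp (t • (A - C)) := by
    let : NormedAlgebra ℚ (X →L[ℝ] X) := NormedAlgebra.restrictScalars ℚ ℝ _
    apply NormedSpace.exp_add_of_commute
    exact ((h.symm.sub_right (Commute.refl C)).smul_left t).smul_right t
  have h2 : t • C + t • (A - C) = t • A := by rw [← smul_add]; congr 1; abel
  rw [h2] at h1
  have h3 : NormedSpace.exp (t • A) x - NormedSpace.exp (t • C) x =
      NormedSpace.exp (t • C) (NormedSpace.exp (t • (A - C)) x - x) := by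
    rw [h1, map_sub]; rfl
  rw [h3, hC.norm_exp]
  have := (hA.sub hC).norm_exp_sub_exp_le 0 t x
  simpa using this

/-- A Yosida-type approximation of the generator B⁻¹: with G = (ε - B²)⁻¹ the operator is A = -BG.
On vectors B³z its error against B⁻¹(B³z) = B²z is exactly -εGB²z, and GB² is a contraction.
Everything that commutes with B commutes with A, so the approximations for different ε commute with
each other. -/
theorem IsSkew.exists_approx {B : X →L[ℝ] X} (hB : IsSkew B) {ε : ℝ} (hε : 0 < ε) :
    ∃ A : X →L[ℝ] X, IsSkew A ∧ (∀ C : X →L[ℝ] X, Commute C B → Commute C A) ∧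
      ∀ z, ‖A (B (B (B z))) - B (B z)‖ ≤ ε * ‖z‖ := by
  obtain ⟨G, hG1, hG2⟩ := hB.exists_resolvent hε
  have hcomm : ∀ C : X →L[ℝ] X, Commute C B → ∀ x, C (G x) = G (C x) := by
    intro C hC x
    have hC' : ∀ y, C (B y) = B (C y) := fun y => congrArg (fun F : X →L[ℝ] X => F y) hC.eq
    have h1 : C x = ε • C (G x) - B (B (C (G x))) := by
      conv_lhs => rw [← hG1 x]
      rw [map_sub, map_smul, hC', hC']
    rw [h1, hG2]
  have hGB : ∀ x, B (G x) = G (B x) := hcomm B (Commute.refl B)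
  have hGB2 : ∀ x, ‖G (B (B x))‖ ≤ ‖x‖ := by
    intro x
    rw [← hGB, ← hGB]
    set w := G x with hw
    have hx : x = ε • w - B (B w) := (hG1 x).symm
    -- The cross term -2ε⟪w, B²w⟫ equals 2ε‖Bw‖² by skewness, so it helps the bound for ‖B²w‖.
    have h1 : ‖x‖ ^ 2 = ε ^ 2 * ‖w‖ ^ 2 + 2 * ε * ‖B w‖ ^ 2 + ‖B (B w)‖ ^ 2 := by
      rw [hx, norm_sub_sq_real, real_inner_smul_left, norm_smul, mul_pow, Real.norm_eq_abs, sq_abs]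
      have h2 := hB w (B w)
      rw [real_inner_self_eq_norm_sq] at h2
      rw [show ⟪w, B (B w)⟫_ℝ = -‖B w‖ ^ 2 by linarith]
      ring
    have h3 : ‖B (B w)‖ ^ 2 ≤ ‖x‖ ^ 2 := by
      rw [h1]
      nlinarith [sq_nonneg (ε * ‖w‖), mul_nonneg hε.le (sq_nonneg ‖B w‖)]
    exact (sq_le_sq₀ (norm_nonneg _) (norm_nonneg _)).1 h3
  refine ⟨-(B ∘L G), isSkew_of_inner_self fun x => ?_, fun C hC => ?_, fun z => ?_⟩
  · simp only [neg_apply, ContinuousLinearMap.comp_apply, inner_neg_left, neg_eq_zero]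
    conv_lhs => rw [← hG1 x]
    rw [hG2, inner_sub_right, real_inner_smul_right, hB.inner_self, real_inner_comm,
      hB.inner_self]
    simp
  · have hC' : ∀ y, C (B y) = B (C y) := fun y => congrArg (fun F : X →L[ℝ] X => F y) hC.eq
    refine ContinuousLinearMap.ext fun x => ?_
    change C (-(B (G x))) = -(B (G (C x)))
    rw [map_neg, hC', hcomm C hC]
  · have h1 : (-(B ∘L G)) (B (B (B z))) - B (B z) = -(ε • G (B (B z))) := by
      have h2 := hG2 (B (B z))
      rw [map_sub, map_smul] at h2
      change -(B (G (B (B (B z))))) - B (B z) = _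
      rw [hGB, ← sub_eq_zero]
      rw [← sub_eq_zero] at h2
      rw [← h2]
      abel
    rw [h1, norm_neg, norm_smul, Real.norm_eq_abs, abs_of_pos hε]
    exact mul_le_mul_of_nonneg_left (hGB2 z) hε.le

/-- `U` is the orthogonal group with generator `B⁻¹`. -/
structure IsOrthogonalGroup (B : X →L[ℝ] X) (U : ℝ → X →L[ℝ] X) : Prop where
  norm_map : ∀ t x, ‖U t x‖ = ‖x‖
  inner_left : ∀ t x y, ⟪U t x, y⟫_ℝ = ⟪x, U (-t) y⟫_ℝ
  comm : ∀ t x, U t (B x) = B (U t x)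
  continuous : ∀ x, Continuous fun t => U t x
  zero : ∀ x, U 0 x = x
  integral : ∀ t x, U t (B x) - B x = ∫ s in (0 : ℝ)..t, U s x

/-- U(t) is the strong limit of exp(tA_n) for the approximations with ε = 1/(n + 1). Convergence is
quantitative on the dense range of B³, and isometry extends it to all vectors. -/
theorem IsSkew.exists_group {B : X →L[ℝ] X} (hB : IsSkew B) (hi : Function.Injective B) :
    ∃ U : ℝ → X →L[ℝ] X, IsOrthogonalGroup B U := by
  have hε : ∀ n : ℕ, 0 < 1 / ((n : ℝ) + 1) := fun n => Nat.one_div_pos_of_nat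
  choose A hA hAC hAB using fun n : ℕ => hB.exists_approx (hε n)
  have hBA : ∀ n, Commute B (A n) := fun n => hAC n B (Commute.refl B)
  have hAA : ∀ m n, Commute (A m) (A n) := fun m n => hAC n (A m) (hBA m).symm
  have hdB : DenseRange B := hB.denseRange hi
  have hdB3 : DenseRange fun z => B (B (B z)) :=
    hdB.comp (hdB.comp hdB B.continuous) B.continuous
  have hlim : Tendsto (fun n : ℕ => 1 / ((n : ℝ) + 1)) atTop (𝓝 0) :=
    tendsto_one_div_add_atTop_nhds_zero_nat
  have hAlim : ∀ z, Tendsto (fun n => A n (B (B (B z)))) atTop (𝓝 (B (B z))) := by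
    intro z
    rw [tendsto_iff_norm_sub_tendsto_zero]
    refine squeeze_zero (fun _ => norm_nonneg _) (fun n => hAB n z) ?_
    simpa using hlim.mul_const ‖z‖
  have hcauchy : ∀ (t : ℝ) (x : X), CauchySeq fun n => NormedSpace.exp (t • A n) x := by
    intro t x
    rw [Metric.cauchySeq_iff]
    intro η hη
    obtain ⟨z, hz⟩ := hdB3.exists_dist_lt x (show 0 < η / 4 by positivity)
    rw [dist_eq_norm] at hz
    have hc := (hAlim z).cauchySeq
    rw [Metric.cauchySeq_iff] at hc
    obtain ⟨N, hN⟩ := hc (η / (4 * (|t| + 1))) (by positivity)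
    refine ⟨N, fun m hm n hn => ?_⟩
    have h1 := (hA m).norm_exp_sub_le (hA n) (hAA m n) t (B (B (B z)))
    have h2 := (hN m hm n hn).le
    rw [dist_eq_norm] at h2 ⊢
    have h3 : ‖A m (B (B (B z))) - A n (B (B (B z)))‖ * |t| ≤ η / 4 := by
      calc _ ≤ η / (4 * (|t| + 1)) * (|t| + 1) := by gcongr; linarith
        _ = η / 4 := by field_simp
    have h4 : NormedSpace.exp (t • A m) x - NormedSpace.exp (t • A n) x =
        NormedSpace.exp (t • A m) (x - B (B (B z))) +
        (NormedSpace.exp (t • A m) (B (B (B z))) - NormedSpace.exp (t • A n) (B (B (B z)))) -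
        NormedSpace.exp (t • A n) (x - B (B (B z))) := by
      simp only [map_sub]; abel
    rw [h4]
    calc _ ≤ ‖x - B (B (B z))‖ + η / 4 + ‖x - B (B (B z))‖ := by
          refine (norm_sub_le _ _).trans (add_le_add ((norm_add_le _ _).trans (add_le_add ?_ ?_)) ?_)
          · exact ((hA m).norm_exp _ _).le
          · exact h1.trans h3
          · exact ((hA n).norm_exp _ _).le
      _ < η := by linarith
  choose V hV using fun t x => cauchySeq_tendsto_of_complete (hcauchy t x)
  have hVn : ∀ t x, ‖V t x‖ = ‖x‖ := by
    intro t x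
    refine tendsto_nhds_unique (hV t x).norm ?_
    simp only [(hA _).norm_exp]
    exact tendsto_const_nhds
  let U : ℝ → X →L[ℝ] X := fun t => LinearMap.mkContinuous
    { toFun := V t
      map_add' := fun x y => tendsto_nhds_unique (hV t (x + y)) (by
        simpa only [map_add] using (hV t x).add (hV t y))
      map_smul' := fun r x => tendsto_nhds_unique (hV t (r • x)) (by
        simpa only [map_smul, RingHom.id_apply] using (hV t x).const_smul r) } 1
    (fun x => by rw [one_mul]; exact (hVn t x).le)
  have hU : ∀ t x, Tendsto (fun n => NormedSpace.exp (t • A n) x) atTop (𝓝 (U t x)) := hV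
  have hUn : ∀ t x, ‖U t x‖ = ‖x‖ := hVn
  have hUlip : ∀ s t z, ‖U t (B (B (B z))) - U s (B (B (B z)))‖ ≤ ‖B (B z)‖ * |t - s| := by
    intro s t z
    exact le_of_tendsto_of_tendsto ((hU t _).sub (hU s _)).norm
      ((hAlim z).norm.mul_const _) (Eventually.of_forall fun n => (hA n).norm_exp_sub_exp_le s t _)
  have hUc : ∀ x, Continuous fun t => U t x := by
    intro x
    rw [Metric.continuous_iff]
    intro t η hη
    obtain ⟨z, hz⟩ := hdB3.exists_dist_lt x (show 0 < η / 4 by positivity)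
    rw [dist_eq_norm] at hz
    refine ⟨η / (4 * (‖B (B z)‖ + 1)), by positivity, fun s hs => ?_⟩
    rw [Real.dist_eq] at hs
    rw [dist_eq_norm]
    have h4 : U s x - U t x = U s (x - B (B (B z))) + (U s (B (B (B z))) - U t (B (B (B z)))) -
        U t (x - B (B (B z))) := by
      simp only [map_sub]; abel
    rw [h4]
    have h3 : ‖B (B z)‖ * |s - t| ≤ η / 4 := by
      calc _ ≤ (‖B (B z)‖ + 1) * (η / (4 * (‖B (B z)‖ + 1))) := by gcongr; linarith
        _ = η / 4 := by field_simp
    calc _ ≤ ‖x - B (B (B z))‖ + η / 4 + ‖x - B (B (B z))‖ := by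
          refine (norm_sub_le _ _).trans (add_le_add ((norm_add_le _ _).trans (add_le_add ?_ ?_)) ?_)
          · exact (hUn _ _).le
          · exact (hUlip t s z).trans h3
          · exact (hUn _ _).le
      _ < η := by linarith
  refine ⟨U, hUn, fun t x y => ?_, fun t x => ?_, hUc, fun x => ?_, fun t x => ?_⟩
  · refine tendsto_nhds_unique ((hU t x).inner tendsto_const_nhds) ?_
    simp only [(hA _).inner_exp_left]
    exact tendsto_const_nhds.inner (hU (-t) y)
  · refine tendsto_nhds_unique (hU t (B x)) ?_
    simp only [exp_apply_comm (hBA _).symm]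
    exact (B.continuous.tendsto _).comp (hU t x)
  · refine tendsto_nhds_unique (hU 0 x) ?_
    simp
  · have hcont : Continuous fun x => ∫ s in (0 : ℝ)..t, U s x := by
      have : LipschitzWith (Real.nnabs t) fun x => ∫ s in (0 : ℝ)..t, U s x := by
        refine LipschitzWith.of_dist_le_mul fun x y => ?_
        rw [dist_eq_norm, dist_eq_norm, ← intervalIntegral.integral_sub
          ((hUc x).intervalIntegrable _ _) ((hUc y).intervalIntegrable _ _)]
        have := intervalIntegral.norm_integral_le_of_norm_le_const (a := 0) (b := t)
          (f := fun s => U s x - U s y) (C := ‖x - y‖)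
          (fun s _ => by rw [← map_sub, hUn])
        rw [sub_zero, mul_comm] at this
        simpa using this
      exact this.continuous
    -- Both sides are continuous in x, so x = B²z suffices. Then Bx = B³z, and A_n B³z → B²z allows
    -- passage to the limit in the integral formula for exp(sA_n).
    have hd2 : DenseRange fun z => B (B z) := hdB.comp hdB B.continuous
    refine hd2.induction_on (p := fun x => U t (B x) - B x = ∫ s in (0 : ℝ)..t, U s x) x
      (isClosed_eq (by fun_prop) hcont) fun z => ?_
    refine tendsto_nhds_unique ((hU t (B (B (B z)))).sub_const (B (B (B z)))) ?_
    have h1 : ∀ n, NormedSpace.exp (t • A n) (B (B (B z))) - B (B (B z)) =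
        ∫ s in (0 : ℝ)..t, NormedSpace.exp (s • A n) (A n (B (B (B z)))) := by
      intro n
      have hc : Continuous fun s : ℝ => NormedSpace.exp (s • A n) (A n (B (B (B z)))) :=
        continuous_iff_continuousAt.2 fun s =>
          (hasDerivAt_exp_apply (A n) (A n (B (B (B z)))) s).continuousAt
      rw [intervalIntegral.integral_eq_sub_of_hasDerivAt
        (fun s _ => hasDerivAt_exp_apply (A n) (B (B (B z))) s) (hc.intervalIntegrable _ _)]
      simp
    simp only [h1]
    obtain ⟨K, hK⟩ := (hAlim z).norm.bddAbove_range
    refine intervalIntegral.tendsto_integral_filter_of_dominated_convergence (fun _ => K)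
      (Eventually.of_forall fun n => ?_) (Eventually.of_forall fun n => ?_)
      intervalIntegrable_const (Eventually.of_forall fun s _ => ?_)
    · have hc : Continuous fun s : ℝ => NormedSpace.exp (s • A n) (A n (B (B (B z)))) :=
        continuous_iff_continuousAt.2 fun s =>
          (hasDerivAt_exp_apply (A n) (A n (B (B (B z)))) s).continuousAt
      exact hc.aestronglyMeasurable
    · refine Eventually.of_forall fun s _ => ?_
      rw [(hA n).norm_exp]
      exact hK ⟨n, rfl⟩
    · have h2 : Tendsto (fun n => NormedSpace.exp (s • A n) (A n (B (B (B z))) - B (B z)) +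
          NormedSpace.exp (s • A n) (B (B z))) atTop (𝓝 (0 + U s (B (B z)))) := by
        refine Tendsto.add ?_ (hU s _)
        rw [tendsto_zero_iff_norm_tendsto_zero]
        simp only [(hA _).norm_exp]
        exact tendsto_iff_norm_sub_tendsto_zero.1 (hAlim z)
      simpa using h2

end SkewGroup

/-! ### Time reversal and convolution in L²(0, T) -/

section TimeReflection

theorem measurePreserving_reflect (τ : ℝ) :
    MeasurePreserving (fun t : ℝ => τ - t) (volume.restrict (Ioo 0 τ))
      (volume.restrict (Ioo 0 τ)) := by
  have h := (Measure.measurePreserving_sub_left volume τ).restrict_preimage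
    (s := Ioo 0 τ) measurableSet_Ioo
  have h2 : (fun t : ℝ => τ - t) ⁻¹' Ioo 0 τ = Ioo 0 τ := by
    ext t; simp only [mem_preimage, mem_Ioo]; constructor <;> rintro ⟨h1, h2⟩ <;> constructor <;>
      linarith
  rwa [h2] at h

theorem memLp_indicator {s : Set ℝ} (hs : MeasurableSet s) (f : Lp ℝ 2 (volume.restrict s)) :
    MemLp (s.indicator (f : ℝ → ℝ)) 2 (volume : Measure ℝ) :=
  (memLp_indicator_iff_restrict hs).2 (Lp.memLp f)

/-- Extension of a function in `L²(s)` by zero. -/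
noncomputable def zeroExtend {s : Set ℝ} (hs : MeasurableSet s) :
    Lp ℝ 2 (volume.restrict s) →ₗᵢ[ℝ] Lp ℝ 2 (volume : Measure ℝ) where
  toFun f := MemLp.toLp (s.indicator f) (memLp_indicator hs f)
  map_add' f g := by
    rw [← MemLp.toLp_add]
    refine MemLp.toLp_congr _ _ ?_
    rw [← indicator_add']
    exact (ae_eq_restrict_iff_indicator_ae_eq hs).1 (Lp.coeFn_add f g)
  map_smul' r f := by
    rw [RingHom.id_apply, ← MemLp.toLp_const_smul]
    refine MemLp.toLp_congr _ _ ?_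
    rw [show r • s.indicator f = s.indicator (r • (f : ℝ → ℝ)) from
      (indicator_const_smul s r (f : ℝ → ℝ)).symm]
    exact (ae_eq_restrict_iff_indicator_ae_eq hs).1 (Lp.coeFn_smul r f)
  norm_map' f := by
    refine (Lp.norm_toLp _ (memLp_indicator hs f)).trans ?_
    rw [eLpNorm_indicator_eq_eLpNorm_restrict hs]
    rfl

theorem zeroExtend_apply {s : Set ℝ} (hs : MeasurableSet s) (f : Lp ℝ 2 (volume.restrict s)) :
    zeroExtend hs f = MemLp.toLp (s.indicator f) (memLp_indicator hs f) := rfl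

theorem zeroExtend_ae_eq {s : Set ℝ} (hs : MeasurableSet s) (f : Lp ℝ 2 (volume.restrict s)) :
    zeroExtend hs f =ᵐ[volume] s.indicator f := by
  rw [zeroExtend_apply]
  exact MemLp.coeFn_toLp (memLp_indicator hs f)

/-- The function `s ↦ f (τ - s)` on `(0, T)`, where `f` is extended by zero. -/
noncomputable def reflect (T τ : ℝ) :
    Lp ℝ 2 (volume.restrict (Ioo 0 T)) →L[ℝ] Lp ℝ 2 (volume.restrict (Ioo 0 T)) :=
  (LpToLpRestrictCLM ℝ ℝ ℝ volume 2 (Ioo 0 T)) ∘L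
    ((Lp.compMeasurePreservingₗᵢ ℝ (fun s : ℝ => τ - s)
      (Measure.measurePreserving_sub_left volume τ)).toContinuousLinearMap ∘L
      (zeroExtend (measurableSet_Ioo (a := (0 : ℝ)) (b := T))).toContinuousLinearMap)

theorem reflect_ae_eq (T τ : ℝ) (f : Lp ℝ 2 (volume.restrict (Ioo 0 T))) :
    reflect T τ f =ᵐ[volume.restrict (Ioo 0 T)] fun s => (Ioo 0 T).indicator f (τ - s) := by
  have hm := Measure.measurePreserving_sub_left (volume : Measure ℝ) τ
  refine (LpToLpRestrictCLM_coeFn ℝ _ _).trans (ae_restrict_of_ae ?_)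
  refine (Lp.coeFn_compMeasurePreserving _ hm).trans ?_
  exact hm.quasiMeasurePreserving.ae_eq_comp (zeroExtend_ae_eq measurableSet_Ioo f)

theorem norm_reflect_le (T τ : ℝ) (f : Lp ℝ 2 (volume.restrict (Ioo 0 T))) :
    ‖reflect T τ f‖ ≤ ‖f‖ := by
  refine (norm_Lp_toLp_restrict_le (Ioo 0 T) _).trans ?_
  simp

/-- Continuity of translations in L²(ℝ), applied to the extension by zero. It is the source of the
continuity in time of the controlled part of the solution. -/
theorem continuous_reflect (T : ℝ) (f : Lp ℝ 2 (volume.restrict (Ioo 0 T))) :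
    Continuous fun τ => reflect T τ f := by
  refine (LpToLpRestrictCLM ℝ ℝ ℝ volume 2 (Ioo 0 T)).continuous.comp ?_
  let g : C(ℝ, C(ℝ, ℝ)) := (ContinuousMap.mk (fun p : ℝ × ℝ => p.1 - p.2) (by fun_prop)).curry
  exact (continuous_const (y := zeroExtend measurableSet_Ioo f)).compMeasurePreservingLp
    g.continuous (fun τ => Measure.measurePreserving_sub_left volume τ) (by norm_num)

/-- The extension by zero makes f(τ - s) vanish for s ≥ τ, which truncates the integral to (0, τ);
then s is replaced by τ - t. -/
theorem inner_reflect {T τ : ℝ} (hτ : τ ∈ Icc 0 T) (f g : Lp ℝ 2 (volume.restrict (Ioo 0 T))) :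
    inner ℝ (reflect T τ f) g = ∫ t in Ioo 0 τ, f t * g (τ - t) := by
  have h1 : inner ℝ (reflect T τ f) g =
      ∫ s in Ioo 0 T, (Ioo 0 τ).indicator (fun s => f (τ - s) * g s) s := by
    rw [L2.inner_def]
    refine integral_congr_ae ?_
    have h0 : ∀ᵐ s ∂(volume.restrict (Ioo 0 T)), s ≠ τ :=
      ae_restrict_of_ae (Measure.ae_ne volume τ)
    filter_upwards [reflect_ae_eq T τ f, h0, ae_restrict_mem measurableSet_Ioo] with s hs hs0 hsT
    rw [hs]
    by_cases h : s ∈ Ioo 0 τ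
    · rw [indicator_of_mem h, indicator_of_mem (show τ - s ∈ Ioo 0 T from
        ⟨by linarith [h.2], by linarith [h.1, hτ.2]⟩)]
      simp [mul_comm]
    · rw [indicator_of_notMem h, indicator_of_notMem]
      · simp
      · intro h2
        exact h ⟨hsT.1, by linarith [h2.1]⟩
  rw [h1, setIntegral_indicator measurableSet_Ioo,
    inter_eq_right.2 (Ioo_subset_Ioo_right hτ.2)]
  have h2 := (measurePreserving_reflect τ).integral_comp
    (Homeomorph.subLeft τ).measurableEmbedding (fun s => f (τ - s) * g s)
  rw [← h2]
  simp

theorem integral_convolution_eq {τ : ℝ} (hτ : 0 ≤ τ) {f k : ℝ → ℝ}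
    (hf : IntegrableOn f (Ioo 0 τ)) (hk : Continuous k) :
    ∫ s in (0 : ℝ)..τ, ∫ r in Ioo 0 s, f r * k (s - r) =
      ∫ r in Ioo 0 τ, f r * ∫ s in (0 : ℝ)..(τ - r), k s := by
  set μ : Measure ℝ := volume.restrict (Ioo 0 τ) with hμ
  obtain ⟨K, hK⟩ := (isCompact_Icc (a := -τ) (b := τ)).exists_bound_of_continuousOn hk.continuousOn
  -- The kernel is cut off to the triangle r < s, so that Fubini applies on the full square (0, τ)².
  let q : ℝ × ℝ → ℝ := fun p => {p : ℝ × ℝ | p.2 < p.1}.indicator (fun p => k (p.1 - p.2)) p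
  have hq : Measurable q := by
    refine Measurable.indicator (by fun_prop) (measurableSet_lt measurable_snd measurable_fst)
  have hint : Integrable (fun p : ℝ × ℝ => f p.2 * q p) (μ.prod μ) := by
    have h1 : Integrable (fun p : ℝ × ℝ => f p.2) (μ.prod μ) := hf.comp_snd μ
    refine h1.mul_bdd (c := K) hq.aestronglyMeasurable ?_
    have h2 : ∀ᵐ p ∂(μ.prod μ), p ∈ Ioo 0 τ ×ˢ Ioo 0 τ := by
      rw [hμ, Measure.prod_restrict]
      exact ae_restrict_mem (measurableSet_Ioo.prod measurableSet_Ioo)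
    filter_upwards [h2] with p hp
    have h3 : ‖k (p.1 - p.2)‖ ≤ K :=
      hK _ ⟨by linarith [hp.1.1, hp.2.2], by linarith [hp.1.2, hp.2.1]⟩
    by_cases h : p ∈ {p : ℝ × ℝ | p.2 < p.1}
    · simpa [q, indicator_of_mem h] using h3
    · simpa [q, indicator_of_notMem h] using (norm_nonneg _).trans h3
  have hswap := integral_integral_swap (f := fun s r => f r * q (s, r)) hint
  rw [intervalIntegral.integral_of_le hτ, integral_Ioc_eq_integral_Ioo]
  have hL : ∀ s ∈ Ioo 0 τ, ∫ r in Ioo 0 s, f r * k (s - r) = ∫ r, f r * q (s, r) ∂μ := by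
    intro s hs
    have : ∀ r, f r * q (s, r) = (Iio s).indicator (fun r => f r * k (s - r)) r := by
      intro r
      by_cases h : r < s
      · rw [indicator_of_mem (show r ∈ Iio s from h)]
        simp [q, h]
      · rw [indicator_of_notMem (show r ∉ Iio s from h)]
        simp [q, h]
    simp only [this]
    rw [setIntegral_indicator measurableSet_Iio]
    congr 2
    ext r; simp only [mem_Ioo, mem_inter_iff, mem_Iio]
    exact ⟨fun h => ⟨⟨h.1, h.2.trans hs.2⟩, h.2⟩, fun h => ⟨h.1.1, h.2⟩⟩
  rw [setIntegral_congr_fun measurableSet_Ioo hL, hswap]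
  refine setIntegral_congr_fun measurableSet_Ioo fun r hr => ?_
  rw [integral_const_mul]
  congr 1
  have : ∀ s, q (s, r) = (Ioi r).indicator (fun s => k (s - r)) s := by
    intro s
    by_cases h : r < s
    · rw [indicator_of_mem (show s ∈ Ioi r from h)]
      simp [q, h]
    · rw [indicator_of_notMem (show s ∉ Ioi r from h)]
      simp [q, h]
  simp only [this]
  rw [setIntegral_indicator measurableSet_Ioi]
  have h2 : Ioo 0 τ ∩ Ioi r = Ioo r τ := by
    ext s; simp only [mem_Ioo, mem_inter_iff, mem_Ioi]
    exact ⟨fun h => ⟨h.2, h.1.2⟩, fun h => ⟨⟨hr.1.trans h.1, h.2⟩, h.1⟩⟩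
  rw [h2, ← integral_Ioc_eq_integral_Ioo, ← intervalIntegral.integral_of_le hr.2.le,
    intervalIntegral.integral_comp_sub_right (fun s => k s) r, sub_self]

end TimeReflection

/-! ### Mild trajectories, observations and the dual control maps -/

section Observation

open scoped InnerProductSpace

variable {X : Type*} [NormedAddCommGroup X] [InnerProductSpace ℝ X]
  {B : X →L[ℝ] X} {U : ℝ → X →L[ℝ] X}

theorem IsOrthogonalGroup.mild (hU : IsOrthogonalGroup B U) (τ t : ℝ) (x : X) :
    B (x - U (t - τ) x) = ∫ s in t..τ, U (s - τ) x := by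
  rw [intervalIntegral.integral_comp_sub_right (fun s => U s x) τ, sub_self,
    intervalIntegral.integral_symm, ← hU.integral, map_sub, hU.comm, neg_sub]

theorem IsOrthogonalGroup.continuous_sub (hU : IsOrthogonalGroup B U) (τ : ℝ) (x : X) :
    Continuous fun t => U (t - τ) x :=
  (hU.continuous x).comp (continuous_sub_right τ)

theorem IsOrthogonalGroup.apply_neg (hU : IsOrthogonalGroup B U) (t : ℝ) (x : X) :
    U (-t) (B x) = B x - ∫ s in (0 : ℝ)..t, U (-s) x := by
  have h := hU.integral (-t) x
  have h2 := intervalIntegral.integral_comp_neg (fun s => U s x) (a := 0) (b := t)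
  rw [neg_zero, intervalIntegral.integral_symm 0 (-t), ← h] at h2
  rw [h2]; abel

theorem IsOrthogonalGroup.continuous_neg (hU : IsOrthogonalGroup B U) (x : X) :
    Continuous fun t => U (-t) x :=
  (hU.continuous x).comp continuous_id.neg

/-- The observation `b` is admissible: `s ↦ b (B⁻¹ e^{-sA} x)` is bounded by `x` in `L²(0, T)`. -/
def IsAdmissible (B : X →L[ℝ] X) (U : ℝ → X →L[ℝ] X) (b : X →L[ℝ] ℝ) (T : ℝ) : Prop :=
  ∃ C, ∀ y, ∫ s in Ioo 0 T, (b (U (-s) y)) ^ 2 ≤ C * ‖B y‖ ^ 2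

/-- The observation makes sense only for smooth states By, where it is b(U(-s)y). Admissibility
bounds it by ‖By‖, so it extends from the dense range of B to all states. -/
theorem IsOrthogonalGroup.exists_observation (hU : IsOrthogonalGroup B U) (hd : DenseRange B)
    {b : X →L[ℝ] ℝ} {T : ℝ} (hb : IsAdmissible B U b T) :
    ∃ Ψ : X →L[ℝ] Lp ℝ 2 (volume.restrict (Ioo 0 T)),
      ∀ y, Ψ (B y) =ᵐ[volume.restrict (Ioo 0 T)] fun s => b (U (-s) y) := by
  have hc : ∀ y, Continuous fun s => b (U (-s) y) := fun y =>
    b.continuous.comp (hU.continuous_neg y)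
  have hm : ∀ y, MemLp (fun s => b (U (-s) y)) 2 (volume.restrict (Ioo 0 T)) := fun y =>
    MemLp.of_bound (hc y).aestronglyMeasurable (‖b‖ * ‖y‖) (Eventually.of_forall fun s =>
      (b.le_opNorm _).trans_eq (by rw [hU.norm_map]))
  obtain ⟨C, hC⟩ := hb
  let Ψ₀ : X →ₗ[ℝ] Lp ℝ 2 (volume.restrict (Ioo 0 T)) :=
    { toFun := fun y => (hm y).toLp
      map_add' := fun x y => by
        rw [← MemLp.toLp_add]
        exact MemLp.toLp_congr _ _ (Eventually.of_forall fun s => by simp)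
      map_smul' := fun r x => by
        rw [RingHom.id_apply, ← MemLp.toLp_const_smul]
        exact MemLp.toLp_congr _ _ (Eventually.of_forall fun s => by simp) }
  have hn : ∀ y, ‖Ψ₀ y‖ ≤ √C * ‖(B : X →ₗ[ℝ] X) y‖ := by
    intro y
    have h1 : ‖Ψ₀ y‖ ^ 2 ≤ C * ‖B y‖ ^ 2 := by
      rw [← real_inner_self_eq_norm_sq, L2.inner_def]
      refine le_trans (le_of_eq (integral_congr_ae ?_)) (hC y)
      filter_upwards [MemLp.coeFn_toLp (hm y)] with s hs
      change inner ℝ (MemLp.toLp _ (hm y) s) (MemLp.toLp _ (hm y) s) = _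
      rw [hs]
      simp [sq]
    calc ‖Ψ₀ y‖ = √(‖Ψ₀ y‖ ^ 2) := (Real.sqrt_sq (norm_nonneg _)).symm
      _ ≤ √(C * ‖B y‖ ^ 2) := Real.sqrt_le_sqrt h1
      _ = √C * ‖B y‖ := by
        rw [Real.sqrt_mul' _ (sq_nonneg _), Real.sqrt_sq (norm_nonneg _)]
  refine ⟨Ψ₀.extendOfNorm (B : X →ₗ[ℝ] X), fun y => ?_⟩
  have h := LinearMap.extendOfNorm_eq (f := Ψ₀) (e := (B : X →ₗ[ℝ] X)) hd ⟨_, hn⟩ y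
  have h2 : Ψ₀.extendOfNorm (B : X →ₗ[ℝ] X) (B y) = (hm y).toLp := h
  rw [h2]
  exact MemLp.coeFn_toLp (hm y)

variable [CompleteSpace X]

/-- Let J(t) be the integral of x over [t, τ]. The equation reads J = -Bx, while J' = -x, so the
derivative 2⟪J', J⟫ of ‖J‖² vanishes by skewness. Since J(τ) = 0, also Bx = 0. -/
theorem eq_zero_of_mild (hB : IsSkew B) (hi : Function.Injective B) {τ : ℝ} {x : ℝ → X}
    (hx : ContinuousOn x (Icc 0 τ)) (h0 : x τ = 0)
    (h : ∀ t ∈ Icc 0 τ, B (x τ - x t) = ∫ s in t..τ, x s) :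
    ∀ t ∈ Icc 0 τ, x t = 0 := by
  intro t ht
  have hτ : 0 ≤ τ := ht.1.trans ht.2
  have hJ : ∀ s ∈ Icc 0 τ, HasDerivWithinAt (fun s => ∫ r in s..τ, x r) (-x s) (Icc 0 τ) s := by
    intro s hs
    have : Fact (s ∈ Icc 0 τ) := ⟨hs⟩
    refine intervalIntegral.integral_hasDerivWithinAt_left ?_ ?_ (hx s hs)
    · refine (hx.mono ?_).intervalIntegrable
      rw [uIcc_of_le hs.2]
      exact Icc_subset_Icc_left hs.1
    · exact ⟨Icc 0 τ, self_mem_nhdsWithin, hx.aestronglyMeasurable measurableSet_Icc⟩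
  have hN : ∀ s ∈ Icc 0 τ, HasDerivWithinAt (fun s => ⟪∫ r in s..τ, x r, ∫ r in s..τ, x r⟫_ℝ) 0
      (Icc 0 τ) s := by
    intro s hs
    refine ((hJ s hs).inner ℝ (hJ s hs)).congr_deriv ?_
    rw [← h s hs, h0, zero_sub, map_neg, inner_neg_neg, inner_neg_neg, hB.inner_self,
      real_inner_comm, hB.inner_self, add_zero]
  have hc := (convex_Icc (0 : ℝ) τ).norm_image_sub_le_of_norm_hasDerivWithin_le
    (C := 0) hN (fun s _ => by simp) ht (right_mem_Icc.2 hτ)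
  rw [zero_mul, norm_le_zero_iff, intervalIntegral.integral_same, inner_zero_left, zero_sub,
    neg_eq_zero, inner_self_eq_zero, ← h t ht, h0, zero_sub, map_neg, neg_eq_zero] at hc
  exact hi (hc.trans (map_zero B).symm)

theorem IsOrthogonalGroup.eq_of_mild (hU : IsOrthogonalGroup B U) (hB : IsSkew B)
    (hi : Function.Injective B) {τ : ℝ} {x : ℝ → X} (hx : ContinuousOn x (Icc 0 τ))
    (h : ∀ t ∈ Icc 0 τ, B (x τ - x t) = ∫ s in t..τ, x s) :
    ∀ t ∈ Icc 0 τ, x t = U (t - τ) (x τ) := by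
  intro t ht
  have hc := hU.continuous_sub τ (x τ)
  have h0 : x τ - U (τ - τ) (x τ) = 0 := by rw [sub_self, hU.zero, sub_self]
  refine sub_eq_zero.1 (eq_zero_of_mild hB hi (x := fun t => x t - U (t - τ) (x τ))
    (hx.sub hc.continuousOn) h0 (fun s hs => ?_) t ht)
  rw [h0, intervalIntegral.integral_sub, ← h s hs, ← hU.mild, ← map_sub]
  · congr 1; abel
  · refine (hx.mono ?_).intervalIntegrable
    rw [uIcc_of_le hs.2]
    exact Icc_subset_Icc_left hs.1
  · exact hc.intervalIntegrable _ _

/-- The state at time `τ` that is reached from zero with the control `f`, where the control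
operator is the dual of the observation `Ψ`. -/
noncomputable def controlled {T : ℝ} (Ψ : X →L[ℝ] Lp ℝ 2 (volume.restrict (Ioo 0 T))) (τ : ℝ) :
    Lp ℝ 2 (volume.restrict (Ioo 0 T)) →L[ℝ] X :=
  ContinuousLinearMap.adjoint Ψ ∘L reflect T τ

theorem inner_controlled {T τ : ℝ} (hτ : τ ∈ Icc 0 T)
    (Ψ : X →L[ℝ] Lp ℝ 2 (volume.restrict (Ioo 0 T))) (f : Lp ℝ 2 (volume.restrict (Ioo 0 T)))
    (x : X) : ⟪controlled Ψ τ f, x⟫_ℝ = ∫ t in Ioo 0 τ, f t * Ψ x (τ - t) := by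
  rw [controlled, ContinuousLinearMap.comp_apply, ContinuousLinearMap.adjoint_inner_left,
    inner_reflect hτ]

theorem continuous_controlled {T : ℝ} (Ψ : X →L[ℝ] Lp ℝ 2 (volume.restrict (Ioo 0 T)))
    (f : Lp ℝ 2 (volume.restrict (Ioo 0 T))) : Continuous fun τ => controlled Ψ τ f :=
  (ContinuousLinearMap.adjoint Ψ).continuous.comp (continuous_reflect T f)

theorem norm_controlled_le {T : ℝ} (Ψ : X →L[ℝ] Lp ℝ 2 (volume.restrict (Ioo 0 T)))
    (τ : ℝ) (f : Lp ℝ 2 (volume.restrict (Ioo 0 T))) : ‖controlled Ψ τ f‖ ≤ ‖Ψ‖ * ‖f‖ := by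
  refine ((ContinuousLinearMap.adjoint Ψ).le_opNorm _).trans ?_
  rw [LinearIsometryEquiv.norm_map]
  exact mul_le_mul_of_nonneg_left (norm_reflect_le T τ f) (norm_nonneg _)

theorem ae_comp_reflect {T τ : ℝ} (hτ : τ ∈ Icc 0 T) {p : ℝ → Prop}
    (h : ∀ᵐ s ∂(volume.restrict (Ioo 0 T)), p s) :
    ∀ᵐ t ∂(volume.restrict (Ioo 0 τ)), p (τ - t) :=
  (measurePreserving_reflect τ).quasiMeasurePreserving.ae
    (ae_mono (Measure.restrict_mono (Ioo_subset_Ioo_right hτ.2) le_rfl) h)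

/-- The controlled equation in integrated form, tested with By: the control enters through b y times
the integral of f. For y = Bz, inserting U(-s)Bz = Bz - ∫₀ˢ U(-r)z into the observation leaves a
double integral, which Fubini identifies; density of the range of B gives all y. -/
theorem IsOrthogonalGroup.inner_controlled_apply (hU : IsOrthogonalGroup B U) (hd : DenseRange B)
    {b : X →L[ℝ] ℝ} {T : ℝ} {Ψ : X →L[ℝ] Lp ℝ 2 (volume.restrict (Ioo 0 T))}
    (hΨ : ∀ y, Ψ (B y) =ᵐ[volume.restrict (Ioo 0 T)] fun s => b (U (-s) y))
    (f : Lp ℝ 2 (volume.restrict (Ioo 0 T))) {τ : ℝ} (hτ : τ ∈ Icc 0 T) (y : X) :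
    ⟪controlled Ψ τ f, B y⟫_ℝ =
      b y * (∫ r in Ioo 0 τ, f r) - ∫ s in (0 : ℝ)..τ, ⟪controlled Ψ s f, y⟫_ℝ := by
  have hcΦ := continuous_controlled Ψ f
  have hfi : IntegrableOn f (Ioo 0 τ) := by
    have : IntegrableOn f (Ioo 0 T) := (Lp.memLp f).integrable (by norm_num)
    exact this.mono_set (Ioo_subset_Ioo_right hτ.2)
  have hint : ∀ z, ∫ s in (0 : ℝ)..τ, ⟪controlled Ψ s f, z⟫_ℝ =
      ⟪∫ s in (0 : ℝ)..τ, controlled Ψ s f, z⟫_ℝ := by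
    intro z
    have := ((innerSL ℝ z).intervalIntegral_comp_comm (hcΦ.intervalIntegrable (μ := volume) 0 τ))
    simp only [innerSL_apply_apply] at this
    rw [real_inner_comm, ← this]
    simp only [real_inner_comm]
  rw [hint]
  refine hd.induction_on (p := fun y => ⟪controlled Ψ τ f, B y⟫_ℝ =
      b y * (∫ r in Ioo 0 τ, f r) - ⟪∫ s in (0 : ℝ)..τ, controlled Ψ s f, y⟫_ℝ) y
    (isClosed_eq (by fun_prop) (by fun_prop)) fun z => ?_
  rw [← hint]
  let k : ℝ → ℝ := fun s => b (U (-s) z)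
  have hk : Continuous k := b.continuous.comp (hU.continuous_neg z)
  have h1 : ∀ s, b (U (-s) (B z)) = b (B z) - ∫ r in (0 : ℝ)..s, k r := by
    intro s
    rw [hU.apply_neg, map_sub, b.intervalIntegral_comp_comm
      ((hU.continuous_neg z).intervalIntegrable _ _)]
  have h2 : ∫ s in (0 : ℝ)..τ, ⟪controlled Ψ s f, B z⟫_ℝ =
      ∫ s in (0 : ℝ)..τ, ∫ r in Ioo 0 s, f r * k (s - r) := by
    refine intervalIntegral.integral_congr fun s hs => ?_
    rw [uIcc_of_le hτ.1] at hs
    have hs' : s ∈ Icc 0 T := ⟨hs.1, hs.2.trans hτ.2⟩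
    rw [inner_controlled hs']
    refine integral_congr_ae ?_
    filter_upwards [ae_comp_reflect hs' (hΨ z)] with r hr
    rw [hr]
  rw [h2, integral_convolution_eq hτ.1 hfi hk, inner_controlled hτ, ← integral_const_mul,
    ← integral_sub]
  · refine integral_congr_ae ?_
    filter_upwards [ae_comp_reflect hτ (hΨ (B z))] with r hr
    rw [hr, h1]
    ring
  · exact hfi.const_mul _
  · have hcont : Continuous fun r => ∫ s in (0 : ℝ)..(τ - r), k s :=
      (intervalIntegral.continuous_primitive (fun a b => hk.intervalIntegrable a b) 0).comp
        (continuous_sub_left τ)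
    obtain ⟨K, hK⟩ := (isCompact_Icc (a := 0) (b := τ)).exists_bound_of_continuousOn
      hcont.continuousOn
    refine Integrable.mul_bdd (c := K) hfi hcont.aestronglyMeasurable ?_
    filter_upwards [ae_restrict_mem measurableSet_Ioo] with r hr
    exact hK r ⟨hr.1.le, hr.2.le⟩

end Observation

/-! ### Distributional derivatives and primitives -/

section WeakDerivative

theorem exists_Icc_of_tsupport_subset {α β : ℝ} {φ : ℝ → ℝ} (hαβ : α < β)
    (hc : HasCompactSupport φ) (hs : tsupport φ ⊆ Ioo α β) :
    ∃ p q, α < p ∧ p ≤ q ∧ q < β ∧ tsupport φ ⊆ Icc p q := by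
  rcases (tsupport φ).eq_empty_or_nonempty with h | h
  · refine ⟨(α + β) / 2, (α + β) / 2, by linarith, le_rfl, by linarith, ?_⟩
    rw [h]; exact empty_subset _
  · have hc' : IsCompact (tsupport φ) := hc
    obtain ⟨p, hp⟩ := hc'.exists_isLeast h
    obtain ⟨q, hq⟩ := hc'.exists_isGreatest h
    exact ⟨p, q, (hs hp.1).1, hp.2 hq.1, (hs hq.1).2, fun x hx => ⟨hp.2 hx, hq.2 hx⟩⟩

theorem tsupport_deriv_subset' (φ : ℝ → ℝ) : tsupport (deriv φ) ⊆ tsupport φ :=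
  closure_minimal (support_deriv_subset) (isClosed_tsupport φ)

theorem eq_zero_of_tsupport_subset {φ : ℝ → ℝ} {s : Set ℝ} (h : tsupport φ ⊆ s) {x : ℝ}
    (hx : x ∉ s) : φ x = 0 :=
  image_eq_zero_of_notMem_tsupport fun h2 => hx (h h2)

theorem integrable_mul_of_tsupport_subset {h φ : ℝ → ℝ} {O : Set ℝ}
    (hh : LocallyIntegrableOn h O) (hφ : Continuous φ) (hc : HasCompactSupport φ)
    (hs : tsupport φ ⊆ O) : Integrable (fun x => h x * φ x) := by
  have h1 : IntegrableOn h (tsupport φ) := hh.integrableOn_compact_subset hs hc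
  have h2 : IntegrableOn (fun x => h x * φ x) (tsupport φ) :=
    h1.mul_continuousOn hφ.continuousOn hc
  refine (integrableOn_iff_integrable_of_support_subset ?_).1 h2
  intro x hx
  by_contra h3
  exact hx (by simp [image_eq_zero_of_notMem_tsupport h3])

theorem setIntegral_mul_eq_integral {h φ : ℝ → ℝ} {O : Set ℝ} (hs : tsupport φ ⊆ O) :
    ∫ x in O, h x * φ x = ∫ x, h x * φ x :=
  setIntegral_eq_integral_of_forall_compl_eq_zero fun x hx => by
    rw [eq_zero_of_tsupport_subset hs hx, mul_zero]

/-- The lemma of du Bois-Reymond. -/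
theorem ae_eq_const_of_integral_mul_deriv_eq_zero {α β : ℝ} (hαβ : α < β) {h : ℝ → ℝ}
    (hh : LocallyIntegrableOn h (Ioo α β))
    (h0 : ∀ φ : ℝ → ℝ, ContDiff ℝ ∞ φ → HasCompactSupport φ → tsupport φ ⊆ Ioo α β →
      ∫ x in Ioo α β, h x * deriv φ x = 0) :
    ∃ K : ℝ, h =ᵐ[volume.restrict (Ioo α β)] fun _ => K := by
  let ψ : ContDiffBump ((α + β) / 2) :=
    ⟨(β - α) / 8, (β - α) / 4, by linarith, by linarith⟩
  have hψs : tsupport ψ ⊆ Ioo α β := by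
    rw [ψ.tsupport_eq, Real.closedBall_eq_Icc]
    intro x hx
    have h1 : ψ.rOut = (β - α) / 4 := rfl
    rw [h1] at hx
    exact ⟨by linarith [hx.1], by linarith [hx.2]⟩
  have hψi : Integrable ψ := ψ.continuous.integrable_of_hasCompactSupport ψ.hasCompactSupport
  have hψ0 : 0 < ∫ x, ψ x := ψ.integral_pos
  refine ⟨(∫ x, h x * ψ x) / ∫ x, ψ x, ?_⟩
  set K := (∫ x, h x * ψ x) / ∫ x, ψ x with hK
  have hloc : LocallyIntegrableOn (fun x => h x - K) (Ioo α β) :=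
    hh.sub (locallyIntegrableOn_const K)
  have key := isOpen_Ioo.ae_eq_zero_of_integral_contDiff_smul_eq_zero hloc
    (fun g hg hgc hgs => ?_)
  · rw [EventuallyEq, ae_restrict_iff' measurableSet_Ioo]
    filter_upwards [key] with x hx hx2
    exact sub_eq_zero.1 (hx hx2)
  have hgi : Integrable g := hg.continuous.integrable_of_hasCompactSupport hgc
  -- Subtracting rψ from g leaves a function θ of mean zero, whose primitive is again compactly
  -- supported in the interval and therefore an admissible test function.
  set r := (∫ x, g x) / ∫ x, ψ x with hr
  let θ : ℝ → ℝ := fun x => g x - r * ψ x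
  have hθ : ContDiff ℝ ∞ θ := hg.sub (contDiff_const.mul ψ.contDiff)
  have hθs : tsupport θ ⊆ tsupport g ∪ tsupport ψ := by
    refine closure_minimal (fun x hx => ?_) ((isClosed_tsupport _).union (isClosed_tsupport _))
    by_contra h3
    rw [mem_union, not_or] at h3
    exact hx (by simp [θ, image_eq_zero_of_notMem_tsupport h3.1,
      image_eq_zero_of_notMem_tsupport h3.2])
  have hθc : HasCompactSupport θ :=
    (hgc.isCompact.union ψ.hasCompactSupport.isCompact).of_isClosed_subset
      (isClosed_tsupport _) hθs
  have hθO : tsupport θ ⊆ Ioo α β := hθs.trans (union_subset hgs hψs)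
  have hθi : Integrable θ := hgi.sub (hψi.const_mul r)
  have hθ0 : ∫ x, θ x = 0 := by
    rw [integral_sub hgi (hψi.const_mul r), integral_const_mul, hr, div_mul_cancel₀ _ hψ0.ne',
      sub_self]
  obtain ⟨p, q, hp, hpq, hq, hpqs⟩ := exists_Icc_of_tsupport_subset hαβ hθc hθO
  let φ : ℝ → ℝ := fun x => ∫ t in α..x, θ t
  have hd : ∀ x, HasDerivAt φ (θ x) x := fun x =>
    intervalIntegral.integral_hasDerivAt_right (hθ.continuous.intervalIntegrable _ _)
      (hθ.continuous.stronglyMeasurableAtFilter _ _) hθ.continuous.continuousAt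
  have hderiv : deriv φ = θ := funext fun x => (hd x).deriv
  have hφ : ContDiff ℝ ∞ φ := by
    rw [contDiff_infty_iff_deriv, hderiv]
    exact ⟨fun x => (hd x).differentiableAt, hθ⟩
  have hφ0 : ∀ x, x ∉ Icc p q → φ x = 0 := by
    intro x hx
    have hz : ∀ y, y ∉ Icc p q → θ y = 0 := fun y hy => eq_zero_of_tsupport_subset hpqs hy
    rcases lt_or_ge x p with h1 | h1
    · refine (intervalIntegral.integral_congr (g := fun _ => 0) fun y hy => ?_).trans (by simp)
      have : y < p := lt_of_le_of_lt hy.2 (max_lt hp h1)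
      exact hz y fun h => absurd h.1 (not_le.2 this)
    · have h2 : q < x := by
        by_contra h3
        exact hx ⟨h1, not_lt.1 h3⟩
      have h3 : φ x = ∫ y in Ioc α x, θ y :=
        intervalIntegral.integral_of_le (by linarith)
      rw [h3, setIntegral_eq_integral_of_forall_compl_eq_zero, hθ0]
      intro y hy
      refine hz y fun h => hy ⟨by linarith [h.1], by linarith [h.2]⟩
  have hφs : tsupport φ ⊆ Icc p q :=
    closure_minimal (fun x hx => by by_contra h3; exact hx (hφ0 x h3)) isClosed_Icc
  have hφO : tsupport φ ⊆ Ioo α β := hφs.trans fun x hx => ⟨by linarith [hx.1], by linarith [hx.2]⟩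
  have h1 := h0 φ hφ (HasCompactSupport.intro isCompact_Icc hφ0) hφO
  rw [hderiv, setIntegral_mul_eq_integral hθO] at h1
  have hig := integrable_mul_of_tsupport_subset hh hg.continuous hgc hgs
  have hiψ := integrable_mul_of_tsupport_subset hh ψ.continuous ψ.hasCompactSupport hψs
  have h2 : (fun x => h x * θ x) = fun x => h x * g x - r * (h x * ψ x) := by
    funext x; simp only [θ]; ring
  rw [h2, integral_sub hig (hiψ.const_mul r), integral_const_mul] at h1
  have h3 : (fun x => g x • (h x - K)) = fun x => h x * g x - K * g x := by
    funext x; rw [smul_eq_mul]; ring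
  rw [h3, integral_sub hig (hgi.const_mul K), integral_const_mul]
  have h4 : r * ∫ x, h x * ψ x = K * ∫ x, g x := by
    rw [hr, hK]; ring
  linarith

theorem HasWeakDerivOn.mono {O O' : Set ℝ} {u g : ℝ → ℝ} (h : HasWeakDerivOn O u g)
    (hO : O' ⊆ O) : HasWeakDerivOn O' u g := by
  refine ⟨h.1.mono_set hO, h.2.1.mono_set hO, fun φ hφ hc hs => ?_⟩
  have h1 := h.2.2 φ hφ hc (hs.trans hO)
  have hs' := (tsupport_deriv_subset' φ).trans hs
  rwa [setIntegral_mul_eq_integral (hs'.trans hO), setIntegral_mul_eq_integral (hs.trans hO),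
    ← setIntegral_mul_eq_integral hs', ← setIntegral_mul_eq_integral hs] at h1

theorem intervalIntegrable_of_integrableOn_Ioo {α β : ℝ} (hαβ : α ≤ β) {g : ℝ → ℝ}
    (hg : IntegrableOn g (Ioo α β)) : IntervalIntegrable g volume α β :=
  (intervalIntegrable_iff_integrableOn_Ioo_of_le hαβ).2 hg

theorem absolutelyContinuous_primitive {α β : ℝ} (hαβ : α ≤ β) {g : ℝ → ℝ}
    (hg : IntegrableOn g (Ioo α β)) (K : ℝ) :
    AbsolutelyContinuousOnInterval (fun x => K + ∫ t in α..x, g t) α β :=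
  (contDiffOn_const (c := K)).absolutelyContinuousOnInterval.add
    ((intervalIntegrable_of_integrableOn_Ioo hαβ hg).absolutelyContinuousOnInterval_intervalIntegral
      left_mem_uIcc)

theorem ae_deriv_primitive {α β : ℝ} (hαβ : α ≤ β) {g : ℝ → ℝ}
    (hg : IntegrableOn g (Ioo α β)) (K : ℝ) :
    ∀ᵐ x, x ∈ uIcc α β → HasDerivAt (fun x => K + ∫ t in α..x, g t) (g x) x := by
  filter_upwards [(intervalIntegrable_of_integrableOn_Ioo hαβ hg).ae_hasDerivAt_integral]
    with x hx hx2
  exact (hx hx2 α left_mem_uIcc).const_add K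

/-- Integration by parts of a primitive against an absolutely continuous function. -/
theorem integral_primitive_mul_deriv {α β : ℝ} (hαβ : α ≤ β) {g φ : ℝ → ℝ}
    (hg : IntegrableOn g (Ioo α β)) (K : ℝ) (hφ : AbsolutelyContinuousOnInterval φ α β) :
    ∫ x in Ioo α β, (K + ∫ t in α..x, g t) * deriv φ x =
      (K + ∫ t in α..β, g t) * φ β - K * φ α - ∫ x in Ioo α β, g x * φ x := by
  have h := (absolutelyContinuous_primitive hαβ hg K).integral_mul_deriv_eq_deriv_mul hφ
  rw [intervalIntegral.integral_same, add_zero] at h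
  have h2 : ∫ x in α..β, deriv (fun x => K + ∫ t in α..x, g t) x * φ x =
      ∫ x in α..β, g x * φ x := by
    refine intervalIntegral.integral_congr_ae ?_
    filter_upwards [ae_deriv_primitive hαβ hg K] with x hx hx2
    rw [(hx (uIoc_subset_uIcc hx2)).deriv]
  rw [h2] at h
  have e : ∀ f : ℝ → ℝ, ∫ x in Ioo α β, f x = ∫ x in α..β, f x := fun f => by
    rw [intervalIntegral.integral_of_le hαβ, integral_Ioc_eq_integral_Ioo]
  rw [e fun x => (K + ∫ t in α..x, g t) * deriv φ x, e fun x => g x * φ x, h]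

theorem continuousOn_primitive_Icc {α β : ℝ} (hαβ : α ≤ β) {g : ℝ → ℝ}
    (hg : IntegrableOn g (Ioo α β)) (K : ℝ) :
    ContinuousOn (fun x => K + ∫ t in α..x, g t) (Icc α β) := by
  have := (absolutelyContinuous_primitive hαβ hg K).continuousOn
  rwa [uIcc_of_le hαβ] at this

/-- Integration by parts shows that u minus the primitive of g has zero distributional derivative,
so it is constant. All boundary values are read off from this continuous representative. -/
theorem HasWeakDerivOn.exists_primitive {α β : ℝ} (hαβ : α < β) {u g : ℝ → ℝ}
    (h : HasWeakDerivOn (Ioo α β) u g) (hg : IntegrableOn g (Ioo α β)) :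
    ∃ K : ℝ, u =ᵐ[volume.restrict (Ioo α β)] fun x => K + ∫ t in α..x, g t := by
  have hc := continuousOn_primitive_Icc hαβ.le hg 0
  have hl : LocallyIntegrableOn (fun x => 0 + ∫ t in α..x, g t) (Ioo α β) :=
    (hc.mono Ioo_subset_Icc_self).locallyIntegrableOn measurableSet_Ioo
  have key : ∀ φ : ℝ → ℝ, ContDiff ℝ ∞ φ → HasCompactSupport φ → tsupport φ ⊆ Ioo α β →
      ∫ x in Ioo α β, (u - fun x => 0 + ∫ t in α..x, g t) x * deriv φ x = 0 := by
    intro φ hφ hcφ hs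
    have hs' := (tsupport_deriv_subset' φ).trans hs
    have hφ1 : ContDiff ℝ 1 φ := hφ.of_le (by norm_num)
    have hcφ' : Continuous (deriv φ) := hφ1.continuous_deriv le_rfl
    have h1 := h.2.2 φ hφ hcφ hs
    have h2 := integral_primitive_mul_deriv hαβ.le hg 0 hφ1.contDiffOn.absolutelyContinuousOnInterval
    rw [eq_zero_of_tsupport_subset hs right_notMem_Ioo,
      eq_zero_of_tsupport_subset hs left_notMem_Ioo] at h2
    have h3 : ∀ x, (u - fun x => 0 + ∫ t in α..x, g t) x * deriv φ x =
        u x * deriv φ x - (0 + ∫ t in α..x, g t) * deriv φ x := fun x => by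
      simp only [Pi.sub_apply]; ring
    simp only [h3]
    rw [integral_sub, h1, h2]
    · ring
    · exact (integrable_mul_of_tsupport_subset h.1 hcφ' hcφ.deriv hs').integrableOn
    · exact (integrable_mul_of_tsupport_subset hl hcφ' hcφ.deriv hs').integrableOn
  obtain ⟨K, hK⟩ := ae_eq_const_of_integral_mul_deriv_eq_zero hαβ (h.1.sub hl) key
  refine ⟨K, ?_⟩
  filter_upwards [hK] with x hx
  simp only [Pi.sub_apply] at hx
  linarith

end WeakDerivative

/-! ### Pointwise bounds for the weight -/

section Weight

variable {c d : ℝ} {a : ℝ → ℝ}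

theorem IsWeight.nonneg (ha : IsWeight c d a) {x : ℝ} (hx : x ∈ Icc c d) : 0 ≤ a x := by
  rcases eq_or_ne x 1 with rfl | h
  · exact ha.zero_at_one.ge
  · exact (ha.pos x hx h).le

theorem IsWeight.exists_le (ha : IsWeight c d a) : ∃ M, 0 < M ∧ ∀ x ∈ Icc c d, a x ≤ M := by
  obtain ⟨M, hM⟩ := isCompact_Icc.exists_bound_of_continuousOn ha.continuousOn
  exact ⟨|M| + 1, by positivity, fun x hx => by
    linarith [le_abs_self (a x), (Real.norm_eq_abs (a x)) ▸ hM x hx, le_abs_self M]⟩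

theorem IsWeight.continuousOn_sqrt (ha : IsWeight c d a) :
    ContinuousOn (fun x => √(a x)) (Icc c d) := ha.continuousOn.sqrt

theorem IsWeight.aestronglyMeasurable_sqrt (ha : IsWeight c d a) :
    AEStronglyMeasurable (fun x => √(a x)) (volume.restrict (Ioo c d)) :=
  (ha.continuousOn_sqrt.mono Ioo_subset_Icc_self).aestronglyMeasurable measurableSet_Ioo

theorem IsWeight.aestronglyMeasurable (ha : IsWeight c d a) :
    AEStronglyMeasurable a (volume.restrict (Ioo c d)) :=
  (ha.continuousOn.mono Ioo_subset_Icc_self).aestronglyMeasurable measurableSet_Ioo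

theorem IsWeight.contDiffAt (ha : IsWeight c d a) {x : ℝ} (hx : x ∈ Ioo c d) (h1 : x ≠ 1) :
    ContDiffAt ℝ 1 a x := by
  refine ha.contDiffOn.contDiffAt ?_
  exact inter_mem (Icc_mem_nhds hx.1 hx.2) (isOpen_ne.mem_nhds h1)

theorem ae_ne_one : ∀ᵐ x ∂(volume.restrict (Ioo c d)), x ≠ 1 :=
  ae_restrict_of_ae (Measure.ae_ne volume 1)

theorem IsWeight.ae_pos (ha : IsWeight c d a) : ∀ᵐ x ∂(volume.restrict (Ioo c d)), 0 < a x := by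
  filter_upwards [ae_ne_one, ae_restrict_mem measurableSet_Ioo] with x h1 hx
  exact ha.pos x (Ioo_subset_Icc_self hx) h1

/-- The mean value theorem between x and 1, where √a vanishes, with the lower bound for |(√a)_x|
from (iii). This is the comparison that reduces weighted estimates to Hardy's inequality. -/
theorem IsWeight.exists_le_sqrt (ha : IsWeight c d a) (hc : c < 1) (hd : 1 < d) :
    ∃ k, 0 < k ∧ ∀ x ∈ Icc c d, k * |x - 1| ≤ √(a x) := by
  obtain ⟨k, hk, hae⟩ := ha.sqrt_deriv_inv_bounded
  have hO : IsOpen (Ioo c d \ {1}) := isOpen_Ioo.sdiff isClosed_singleton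
  have hcd : ContDiffOn ℝ 1 (fun s => √(a s)) (Ioo c d \ {1}) := by
    refine ContDiffOn.sqrt (ha.contDiffOn.mono fun x hx => ⟨Ioo_subset_Icc_self hx.1, hx.2⟩) ?_
    exact fun x hx => (ha.pos x (Ioo_subset_Icc_self hx.1) hx.2).ne'
  -- Off 1 the derivative of √a is continuous, so the set where the bound fails is open; being null,
  -- it is empty.
  have hall : ∀ x ∈ Ioo c d \ {1}, k ≤ |deriv (fun s => √(a s)) x| := by
    by_contra! h
    obtain ⟨x, hx, hxk⟩ := h
    have hcont : ContinuousOn (fun x => |deriv (fun s => √(a s)) x|) (Ioo c d \ {1}) :=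
      (hcd.continuousOn_deriv_of_isOpen hO le_rfl).abs
    have hopen := hcont.isOpen_inter_preimage hO (isOpen_Iio (a := k))
    have h0 : volume ((Ioo c d \ {1}) ∩ (fun x => |deriv (fun s => √(a s)) x|) ⁻¹' Iio k) = 0 := by
      rw [ae_restrict_iff' measurableSet_Ioo, ae_iff] at hae
      refine measure_mono_null (fun y hy => ?_) hae
      simp only [mem_ofPred_eq, not_forall]
      exact ⟨hy.1.1, not_le.2 hy.2⟩
    rw [hopen.measure_eq_zero_iff volume] at h0
    have hm : x ∈ (Ioo c d \ {1}) ∩ (fun x => |deriv (fun s => √(a s)) x|) ⁻¹' Iio k := ⟨hx, hxk⟩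
    rw [h0] at hm
    exact hm
  have hdiff : ∀ x ∈ Ioo c d \ {1}, DifferentiableAt ℝ (fun s => √(a s)) x := fun x hx =>
    ((hcd.contDiffAt (hO.mem_nhds hx)).differentiableAt one_ne_zero)
  refine ⟨k, hk, fun x hx => ?_⟩
  have h1 : √(a 1) = 0 := by rw [ha.zero_at_one, Real.sqrt_zero]
  rcases lt_trichotomy x 1 with h | h | h
  · obtain ⟨ξ, hξ, hξ2⟩ := exists_deriv_eq_slope (fun s => √(a s)) h
      (ha.continuousOn_sqrt.mono (Icc_subset_Icc hx.1 hd.le))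
      (fun y hy => (hdiff y ⟨⟨lt_of_le_of_lt hx.1 hy.1, hy.2.trans hd⟩,
        hy.2.ne⟩).differentiableWithinAt)
    have h2 := hall ξ ⟨⟨lt_of_le_of_lt hx.1 hξ.1, hξ.2.trans hd⟩, hξ.2.ne⟩
    rw [hξ2, h1, zero_sub, abs_div, abs_neg, abs_of_nonneg (Real.sqrt_nonneg _),
      le_div_iff₀ (abs_pos.2 (by linarith)), abs_sub_comm] at h2
    exact h2
  · simp [h]
  · obtain ⟨ξ, hξ, hξ2⟩ := exists_deriv_eq_slope (fun s => √(a s)) h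
      (ha.continuousOn_sqrt.mono (Icc_subset_Icc hc.le hx.2))
      (fun y hy => (hdiff y ⟨⟨hc.trans hy.1, lt_of_lt_of_le hy.2 hx.2⟩,
        hy.1.ne'⟩).differentiableWithinAt)
    have h2 := hall ξ ⟨⟨hc.trans hξ.1, lt_of_lt_of_le hξ.2 hx.2⟩, hξ.1.ne'⟩
    rw [hξ2, h1, sub_zero, abs_div, abs_of_nonneg (Real.sqrt_nonneg _),
      le_div_iff₀ (abs_pos.2 (by linarith))] at h2
    exact h2

theorem ContDiffOn.exists_abs_deriv_le {f : ℝ → ℝ} {p q : ℝ} (hf : ContDiffOn ℝ 1 f (Icc p q)) :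
    ∃ K, ∀ x ∈ Ioo p q, |deriv f x| ≤ K := by
  rcases lt_or_ge p q with h | h
  · obtain ⟨K, hK⟩ := isCompact_Icc.exists_bound_of_continuousOn
      (hf.continuousOn_derivWithin (uniqueDiffOn_Icc h) le_rfl)
    refine ⟨K, fun x hx => ?_⟩
    rw [← derivWithin_of_mem_nhds (Icc_mem_nhds hx.1 hx.2)]
    exact hK x (Ioo_subset_Icc_self hx)
  · exact ⟨0, fun x hx => absurd (hx.1.trans hx.2) (not_lt.2 h)⟩

/-- `(x - 1) a'` is bounded. -/
theorem IsWeight.exists_abs_mul_deriv_le (ha : IsWeight c d a) :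
    ∃ C, ∀ x ∈ Ioo c d, x ≠ 1 → |(x - 1) * deriv a x| ≤ C := by
  obtain ⟨M, hM, haM⟩ := ha.exists_le
  obtain ⟨x₁, hx₁, μ₁, hμ₁, -, hl₁, -⟩ := ha.left
  obtain ⟨x₂, hx₂, μ₂, hμ₂, -, hl₂, -⟩ := ha.right
  obtain ⟨K₁, hK₁⟩ := ContDiffOn.exists_abs_deriv_le (f := a) (p := c) (q := x₁)
    (ha.contDiffOn.mono fun x hx => ⟨⟨hx.1, by linarith [hx.2, hx₁.2, hx₂.1, hx₂.2]⟩,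
      (lt_of_le_of_lt hx.2 hx₁.2).ne⟩)
  obtain ⟨K₂, hK₂⟩ := ContDiffOn.exists_abs_deriv_le (f := a) (p := x₂) (q := d)
    (ha.contDiffOn.mono fun x hx => ⟨⟨by linarith [hx.1, hx₁.1, hx₁.2, hx₂.1], hx.2⟩,
      (lt_of_lt_of_le hx₂.1 hx.1).ne'⟩)
  -- On [x₁, 1) and (1, x₂] property (i) gives |x - 1||a'| ≤ μa ≤ μM; on the remaining two pieces a'
  -- is bounded by K₁ or K₂. The sum covers the four cases at once.
  refine ⟨μ₁ * M + μ₂ * M + (d - c) * |K₁| + (d - c) * |K₂|, fun x hx h1 => ?_⟩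
  have hcd : 0 ≤ d - c := by linarith [hx.1, hx.2]
  have e1 : 0 ≤ μ₁ * M := by positivity
  have e2 : 0 ≤ μ₂ * M := by positivity
  have e3 : 0 ≤ (d - c) * |K₁| := by positivity
  have e4 : 0 ≤ (d - c) * |K₂| := by positivity
  have hx' := Ioo_subset_Icc_self hx
  have hpos := ha.pos x hx' h1
  have hxd : |x - 1| ≤ d - c :=
    abs_le.2 ⟨by linarith [hx.1, hx₂.1, hx₂.2], by linarith [hx.2, hx₁.1, hx₁.2]⟩
  have hw : derivWithin a (Icc c d) x = deriv a x :=
    derivWithin_of_mem_nhds (Icc_mem_nhds hx.1 hx.2)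
  rw [abs_mul]
  rcases lt_or_gt_of_ne h1 with h | h
  · rcases lt_or_ge x x₁ with h2 | h2
    · have h3 : |x - 1| * |deriv a x| ≤ (d - c) * |K₁| :=
        mul_le_mul hxd ((hK₁ x ⟨hx.1, h2⟩).trans (le_abs_self _)) (abs_nonneg _) hcd
      linarith
    · have h3 := hl₁.1 ⟨x, ⟨h2, h⟩, rfl⟩
      simp only at h3
      rw [hw, div_le_iff₀ hpos] at h3
      rw [abs_of_neg (by linarith : x - 1 < 0), neg_sub]
      have := mul_le_mul_of_nonneg_left (haM x hx') hμ₁.le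
      linarith
  · rcases lt_or_ge x₂ x with h2 | h2
    · have h3 : |x - 1| * |deriv a x| ≤ (d - c) * |K₂| :=
        mul_le_mul hxd ((hK₂ x ⟨h2, hx.2⟩).trans (le_abs_self _)) (abs_nonneg _) hcd
      linarith
    · have h3 := hl₂.1 ⟨x, ⟨h, h2⟩, rfl⟩
      simp only at h3
      rw [hw, div_le_iff₀ hpos] at h3
      rw [abs_of_pos (by linarith : 0 < x - 1)]
      have := mul_le_mul_of_nonneg_left (haM x hx') hμ₂.le
      linarith

end Weight

/-! ### Hardy and pointwise inequalities on H¹_{a,0} -/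

section TestFunctions

variable {c d : ℝ} {a : ℝ → ℝ} {φ : ℝ → ℝ}

theorem setIntegral_Ioo_eq_intervalIntegral {p q : ℝ} (h : p ≤ q) (f : ℝ → ℝ) :
    ∫ x in Ioo p q, f x = ∫ x in p..q, f x := by
  rw [intervalIntegral.integral_of_le h, integral_Ioc_eq_integral_Ioo]

/-- Hardy's inequality for test functions. -/
theorem integral_sq_le_of_tsupport_subset (hcd : c ≤ d) (hφ : ContDiff ℝ 1 φ)
    (hs : tsupport φ ⊆ Ioo c d) :
    ∫ x in Ioo c d, φ x ^ 2 ≤ 4 * ∫ x in Ioo c d, ((x - 1) * deriv φ x) ^ 2 := by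
  have hcd' : Continuous (deriv φ) := hφ.continuous_deriv le_rfl
  have hcφ := hφ.continuous
  rw [setIntegral_Ioo_eq_intervalIntegral hcd, setIntegral_Ioo_eq_intervalIntegral hcd]
  have hd : ∀ x, HasDerivAt (fun x => (x - 1) * φ x ^ 2)
      (φ x ^ 2 + 2 * (x - 1) * φ x * deriv φ x) x := by
    intro x
    have h1 := (hφ.differentiable one_ne_zero x).hasDerivAt
    refine (((hasDerivAt_id x).sub_const 1).mul (h1.pow 2)).congr_deriv ?_
    simp; ring
  have h1 := intervalIntegral.integral_eq_sub_of_hasDerivAt (a := c) (b := d) (fun x _ => hd x)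
    (Continuous.intervalIntegrable (by fun_prop) _ _)
  rw [eq_zero_of_tsupport_subset hs right_notMem_Ioo,
      eq_zero_of_tsupport_subset hs left_notMem_Ioo] at h1
  -- The integral of ((x - 1)φ²)' = φ² + 2(x - 1)φφ' is zero, so expanding this square leaves -∫φ² +
  -- 4∫((x - 1)φ')².
  have h2 : 0 ≤ ∫ x in c..d, (φ x + 2 * (x - 1) * deriv φ x) ^ 2 :=
    intervalIntegral.integral_nonneg hcd fun x _ => sq_nonneg _
  have h3 : ∫ x in c..d, (φ x + 2 * (x - 1) * deriv φ x) ^ 2 =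
      2 * (∫ x in c..d, φ x ^ 2 + 2 * (x - 1) * φ x * deriv φ x) - (∫ x in c..d, φ x ^ 2) +
        4 * ∫ x in c..d, ((x - 1) * deriv φ x) ^ 2 := by
    rw [← intervalIntegral.integral_const_mul, ← intervalIntegral.integral_const_mul,
      ← intervalIntegral.integral_sub, ← intervalIntegral.integral_add]
    · refine intervalIntegral.integral_congr fun x _ => ?_
      ring
    all_goals exact Continuous.intervalIntegrable (by fun_prop) _ _
  rw [h3, h1] at h2
  linarith

/-- The derivative of (x - 1)φ² is at least -((x - 1)φ')². It is integrated between x and the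
endpoint of Ω on the same side of 1, where φ vanishes. -/
theorem abs_sub_mul_sq_le_of_tsupport_subset (hφ : ContDiff ℝ 1 φ)
    (hs : tsupport φ ⊆ Ioo c d) {x : ℝ} (hx : x ∈ Ioo c d) :
    |x - 1| * φ x ^ 2 ≤ ∫ x in Ioo c d, ((x - 1) * deriv φ x) ^ 2 := by
  have hcd : c ≤ d := hx.1.le.trans hx.2.le
  have hcd' : Continuous (deriv φ) := hφ.continuous_deriv le_rfl
  have hcφ := hφ.continuous
  rw [setIntegral_Ioo_eq_intervalIntegral hcd]
  have hd : ∀ x, HasDerivAt (fun x => (x - 1) * φ x ^ 2)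
      (φ x ^ 2 + 2 * (x - 1) * φ x * deriv φ x) x := by
    intro x
    have h1 := (hφ.differentiable one_ne_zero x).hasDerivAt
    refine (((hasDerivAt_id x).sub_const 1).mul (h1.pow 2)).congr_deriv ?_
    simp; ring
  have hI : ∀ p q, IntervalIntegrable (fun x => φ x ^ 2 + 2 * (x - 1) * φ x * deriv φ x)
      volume p q := fun p q => Continuous.intervalIntegrable (by fun_prop) _ _
  have hJ : ∀ p q, IntervalIntegrable (fun x => ((x - 1) * deriv φ x) ^ 2) volume p q :=
    fun p q => Continuous.intervalIntegrable (by fun_prop) _ _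
  have hle : ∀ y, -((y - 1) * deriv φ y) ^ 2 ≤ φ y ^ 2 + 2 * (y - 1) * φ y * deriv φ y :=
    fun y => by nlinarith [sq_nonneg (φ y + (y - 1) * deriv φ y)]
  have hsplit := intervalIntegral.integral_add_adjacent_intervals (hJ c x) (hJ x d)
  have hn1 : 0 ≤ ∫ y in c..x, ((y - 1) * deriv φ y) ^ 2 :=
    intervalIntegral.integral_nonneg hx.1.le fun _ _ => sq_nonneg _
  have hn2 : 0 ≤ ∫ y in x..d, ((y - 1) * deriv φ y) ^ 2 :=
    intervalIntegral.integral_nonneg hx.2.le fun _ _ => sq_nonneg _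
  rcases le_total x 1 with h | h
  · rw [abs_of_nonpos (by linarith)]
    have h1 := intervalIntegral.integral_eq_sub_of_hasDerivAt (fun x _ => hd x) (hI c x)
    rw [eq_zero_of_tsupport_subset hs left_notMem_Ioo] at h1
    have h2 := intervalIntegral.integral_mono_on hx.1.le (hJ c x).neg (hI c x)
      (fun y _ => hle y)
    simp only [Pi.neg_apply, intervalIntegral.integral_neg] at h2
    linarith
  · rw [abs_of_nonneg (by linarith)]
    have h1 := intervalIntegral.integral_eq_sub_of_hasDerivAt (fun x _ => hd x) (hI x d)
    rw [eq_zero_of_tsupport_subset hs right_notMem_Ioo] at h1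
    have h2 := intervalIntegral.integral_mono_on hx.2.le (hJ x d).neg (hI x d)
      (fun y _ => hle y)
    simp only [Pi.neg_apply, intervalIntegral.integral_neg] at h2
    linarith

theorem IsWeight.memLp_sqrt_mul (ha : IsWeight c d a) {g : ℝ → ℝ}
    (hg : MemLp g 2 (volume.restrict (Ioo c d))) :
    MemLp (fun x => √(a x) * g x) 2 (volume.restrict (Ioo c d)) := by
  obtain ⟨M, hM, haM⟩ := ha.exists_le
  refine hg.of_le_mul (c := √M) (ha.aestronglyMeasurable_sqrt.mul hg.1) ?_
  filter_upwards [ae_restrict_mem measurableSet_Ioo] with x hx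
  rw [norm_mul, Real.norm_of_nonneg (Real.sqrt_nonneg _)]
  exact mul_le_mul_of_nonneg_right (Real.sqrt_le_sqrt (haM x (Ioo_subset_Icc_self hx)))
    (norm_nonneg _)

theorem memLp_of_continuous_hasCompactSupport (hφ : Continuous φ) (hc : HasCompactSupport φ) :
    MemLp φ 2 (volume.restrict (Ioo c d)) :=
  (hφ.memLp_of_hasCompactSupport hc).restrict _

theorem norm_sq_eq_integral (f : L2 c d) : ‖f‖ ^ 2 = ∫ x in Ioo c d, f x ^ 2 := by
  rw [← real_inner_self_eq_norm_sq, L2.inner_def]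
  refine integral_congr_ae (Eventually.of_forall fun x => ?_)
  simp [sq]

theorem inner_eq_integral (f g : L2 c d) : inner ℝ f g = ∫ x in Ioo c d, f x * g x := by
  rw [L2.inner_def]
  refine integral_congr_ae (Eventually.of_forall fun x => ?_)
  simp [mul_comm]

theorem IsWeight.exists_mem_testPairs (ha : IsWeight c d a) (hφ : ContDiff ℝ ∞ φ)
    (hc : HasCompactSupport φ) (hs : tsupport φ ⊆ Ioo c d) :
    ∃ e ∈ testPairs c d a, e.1 =ᵐ[volume.restrict (Ioo c d)] φ ∧
      e.2 =ᵐ[volume.restrict (Ioo c d)] fun x => √(a x) * deriv φ x := by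
  have h1 : MemLp φ 2 (volume.restrict (Ioo c d)) :=
    memLp_of_continuous_hasCompactSupport hφ.continuous hc
  have hφ1 : ContDiff ℝ 1 φ := hφ.of_le (by norm_num)
  have h2 : MemLp (fun x => √(a x) * deriv φ x) 2 (volume.restrict (Ioo c d)) :=
    ha.memLp_sqrt_mul
      (memLp_of_continuous_hasCompactSupport (hφ1.continuous_deriv le_rfl) hc.deriv)
  exact ⟨(h1.toLp φ, h2.toLp _), ⟨φ, hφ, hc, hs, h1.coeFn_toLp, h2.coeFn_toLp⟩, h1.coeFn_toLp,
    h2.coeFn_toLp⟩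

theorem integral_weighted_le {k : ℝ} (hk : 0 < k)
    (hak : ∀ x ∈ Icc c d, k * |x - 1| ≤ √(a x)) (hφ : ContDiff ℝ 1 φ) {p : L2 c d}
    (hp : p =ᵐ[volume.restrict (Ioo c d)] fun x => √(a x) * deriv φ x) :
    ∫ x in Ioo c d, ((x - 1) * deriv φ x) ^ 2 ≤ (1 / k) ^ 2 * ‖p‖ ^ 2 := by
  have hcd' : Continuous (deriv φ) := hφ.continuous_deriv le_rfl
  rw [norm_sq_eq_integral, ← integral_const_mul]
  refine integral_mono_ae ?_ ((Lp.memLp p).integrable_sq.const_mul _) ?_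
  · exact (Continuous.integrableOn_Icc (by fun_prop)).mono_set Ioo_subset_Icc_self
  · filter_upwards [hp, ae_restrict_mem measurableSet_Ioo] with x hx hxm
    have h1 := hak x (Ioo_subset_Icc_self hxm)
    have h2 : (k * |x - 1|) ^ 2 ≤ √(a x) ^ 2 := pow_le_pow_left₀ (by positivity) h1 2
    rw [hx, mul_pow, mul_pow, one_div, inv_pow, ← mul_assoc]
    refine mul_le_mul_of_nonneg_right ?_ (sq_nonneg _)
    rw [mul_pow, sq_abs] at h2
    rw [← div_eq_inv_mul, le_div_iff₀ (by positivity)]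
    linarith

theorem norm_fst_le_of_mem_testPairs (hcd : c ≤ d) {k : ℝ} (hk : 0 < k)
    (hak : ∀ x ∈ Icc c d, k * |x - 1| ≤ √(a x)) {e : Pairs c d} (he : e ∈ testPairs c d a) :
    ‖e.1‖ ≤ 2 / k * ‖e.2‖ := by
  obtain ⟨φ, hφ, hc, hs, h1, h2⟩ := he
  have hφ1 : ContDiff ℝ 1 φ := hφ.of_le (by norm_num)
  have h3 := integral_sq_le_of_tsupport_subset hcd hφ1 hs
  have h4 := integral_weighted_le hk hak hφ1 h2
  have h5 : ‖e.1‖ ^ 2 ≤ (2 / k * ‖e.2‖) ^ 2 := by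
    have h6 : ‖e.1‖ ^ 2 = ∫ x in Ioo c d, φ x ^ 2 := by
      rw [norm_sq_eq_integral]
      refine integral_congr_ae ?_
      filter_upwards [h1] with x hx
      rw [hx]
    rw [h6]
    calc _ ≤ 4 * ((1 / k) ^ 2 * ‖e.2‖ ^ 2) := h3.trans (by linarith)
      _ = _ := by ring
  exact (sq_le_sq₀ (norm_nonneg _) (by positivity)).1 h5

theorem norm_fst_le_of_mem_H10 (hcd : c ≤ d) {k : ℝ} (hk : 0 < k)
    (hak : ∀ x ∈ Icc c d, k * |x - 1| ≤ √(a x)) {e : Pairs c d} (he : e ∈ H10 c d a) :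
    ‖e.1‖ ≤ 2 / k * ‖e.2‖ := by
  have hcl : IsClosed {e : Pairs c d | ‖e.1‖ ≤ 2 / k * ‖e.2‖} :=
    isClosed_le (by fun_prop) (by fun_prop)
  exact closure_minimal (fun e he => norm_fst_le_of_mem_testPairs hcd hk hak he) hcl he

/-- L² convergence yields an almost everywhere convergent subsequence, along which the bound for
test functions persists. Elements of H¹_{a,0} thus grow at 1 at most like |x - 1|^(-1/2), which is
what the transmission conditions need. -/
theorem ae_abs_sub_mul_sq_le_of_mem_H10 {k : ℝ} (hk : 0 < k)
    (hak : ∀ x ∈ Icc c d, k * |x - 1| ≤ √(a x)) {e : Pairs c d} (he : e ∈ H10 c d a) :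
    ∀ᵐ x ∂(volume.restrict (Ioo c d)), |x - 1| * e.1 x ^ 2 ≤ (1 / k) ^ 2 * ‖e.2‖ ^ 2 := by
  obtain ⟨s, hs, hlim⟩ := mem_closure_iff_seq_limit.1 he
  have h1 : Tendsto (fun n => (s n).1) atTop (𝓝 e.1) := (continuous_fst.tendsto e).comp hlim
  have h2 : Tendsto (fun n => (s n).2) atTop (𝓝 e.2) := (continuous_snd.tendsto e).comp hlim
  obtain ⟨ns, hns, hae⟩ := (tendstoInMeasure_of_tendsto_Lp h1).exists_seq_tendsto_ae
  have h3 : ∀ᵐ x ∂(volume.restrict (Ioo c d)), ∀ n,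
      |x - 1| * (s n).1 x ^ 2 ≤ (1 / k) ^ 2 * ‖(s n).2‖ ^ 2 := by
    rw [ae_all_iff]
    intro n
    obtain ⟨φ, hφ, hc, hsφ, hφ1, hφ2⟩ := hs n
    have hφ' : ContDiff ℝ 1 φ := hφ.of_le (by norm_num)
    filter_upwards [hφ1, ae_restrict_mem measurableSet_Ioo] with x hx hxm
    rw [hx]
    exact (abs_sub_mul_sq_le_of_tsupport_subset hφ' hsφ hxm).trans
      (integral_weighted_le hk hak hφ' hφ2)
  filter_upwards [hae, h3] with x hx hx3
  exact le_of_tendsto_of_tendsto ((hx.pow 2).const_mul _)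
    (((h2.norm.pow 2).const_mul _).comp hns.tendsto_atTop) (Eventually.of_forall fun n => hx3 _)

end TestFunctions

/-! ### One-sided limits up to null sets -/

section EssLimits

variable {c d : ℝ} {a : ℝ → ℝ}

theorem tendsto_essFilter_of_ae_eq {l : Filter ℝ} {f F : ℝ → ℝ} {y : ℝ}
    (h : f =ᵐ[volume.restrict (Ioo c d)] F) (hF : Tendsto F l (𝓝 y)) :
    Tendsto f (essFilter c d l) (𝓝 y) := by
  have h1 : Tendsto F (essFilter c d l) (𝓝 y) := hF.mono_left inf_le_left
  refine h1.congr' ?_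
  have h2 : F =ᶠ[ae (volume.restrict (Ioo c d))] f := h.symm
  exact h2.filter_mono inf_le_right

theorem essFilter_neBot_right {x : ℝ} (hx : x ∈ Ico c d) : (essFilter c d (𝓝[>] x)).NeBot := by
  rw [essFilter, inf_neBot_iff]
  intro s hs t ht
  obtain ⟨y, hy, hys⟩ := (mem_nhdsGT_iff_exists_Ioo_subset' hx.2).1 hs
  by_contra h
  rw [not_nonempty_iff_eq_empty] at h
  have h1 : Ioo x (min y d) ⊆ tᶜ := fun z hz hzt => by
    have : z ∈ s ∩ t := ⟨hys ⟨hz.1, lt_of_lt_of_le hz.2 (min_le_left _ _)⟩, hzt⟩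
    rw [h] at this
    exact this
  have h2 := measure_mono_null h1 (mem_ae_iff.1 ht)
  rw [Measure.restrict_apply measurableSet_Ioo, inter_eq_left.2 (fun z hz => show z ∈ Ioo c d from
    ⟨lt_of_le_of_lt hx.1 hz.1, lt_of_lt_of_le hz.2 (min_le_right _ _)⟩), Real.volume_Ioo,
    ENNReal.ofReal_eq_zero] at h2
  have := lt_min (show x < y from hy) hx.2
  linarith

theorem essFilter_neBot_left {x : ℝ} (hx : x ∈ Ioc c d) : (essFilter c d (𝓝[<] x)).NeBot := by
  rw [essFilter, inf_neBot_iff]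
  intro s hs t ht
  obtain ⟨y, hy, hys⟩ := (mem_nhdsLT_iff_exists_Ioo_subset' hx.1).1 hs
  by_contra h
  rw [not_nonempty_iff_eq_empty] at h
  have h1 : Ioo (max y c) x ⊆ tᶜ := fun z hz hzt => by
    have : z ∈ s ∩ t := ⟨hys ⟨lt_of_le_of_lt (le_max_left _ _) hz.1, hz.2⟩, hzt⟩
    rw [h] at this
    exact this
  have h2 := measure_mono_null h1 (mem_ae_iff.1 ht)
  rw [Measure.restrict_apply measurableSet_Ioo, inter_eq_left.2 (fun z hz => show z ∈ Ioo c d from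
    ⟨lt_of_le_of_lt (le_max_right _ _) hz.1, lt_of_lt_of_le hz.2 hx.2⟩), Real.volume_Ioo,
    ENNReal.ofReal_eq_zero] at h2
  have := max_lt (show y < x from hy) hx.1
  linarith

theorem ContinuousOn.tendsto_nhdsGT {F : ℝ → ℝ} (hF : ContinuousOn F (Icc c d)) {x : ℝ}
    (hx : x ∈ Ico c d) : Tendsto F (𝓝[>] x) (𝓝 (F x)) := by
  refine (hF x (Ico_subset_Icc_self hx)).mono_left ?_
  rw [nhdsWithin, nhdsWithin]
  refine le_inf inf_le_left (le_principal_iff.2 ?_)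
  refine mem_of_superset (Ioo_mem_nhdsGT hx.2) fun y hy => ?_
  exact ⟨hx.1.trans hy.1.le, hy.2.le⟩

theorem ContinuousOn.tendsto_nhdsLT {F : ℝ → ℝ} (hF : ContinuousOn F (Icc c d)) {x : ℝ}
    (hx : x ∈ Ioc c d) : Tendsto F (𝓝[<] x) (𝓝 (F x)) := by
  refine (hF x (Ioc_subset_Icc_self hx)).mono_left ?_
  rw [nhdsWithin, nhdsWithin]
  refine le_inf inf_le_left (le_principal_iff.2 ?_)
  refine mem_of_superset (Ioo_mem_nhdsLT hx.1) fun y hy => ?_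
  exact ⟨hy.1.le, hy.2.le.trans hx.2⟩

theorem eq_of_ae_eq_of_tendsto_right {f F : ℝ → ℝ} {x y : ℝ}
    (h : f =ᵐ[volume.restrict (Ioo c d)] F) (hF : ContinuousOn F (Icc c d)) (hx : x ∈ Ico c d)
    (hf : Tendsto f (essFilter c d (𝓝[>] x)) (𝓝 y)) : F x = y := by
  have := essFilter_neBot_right hx
  exact tendsto_nhds_unique (tendsto_essFilter_of_ae_eq h (ContinuousOn.tendsto_nhdsGT hF hx)) hf

theorem eq_of_ae_eq_of_tendsto_left {f F : ℝ → ℝ} {x y : ℝ}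
    (h : f =ᵐ[volume.restrict (Ioo c d)] F) (hF : ContinuousOn F (Icc c d)) (hx : x ∈ Ioc c d)
    (hf : Tendsto f (essFilter c d (𝓝[<] x)) (𝓝 y)) : F x = y := by
  have := essFilter_neBot_left hx
  exact tendsto_nhds_unique (tendsto_essFilter_of_ae_eq h (ContinuousOn.tendsto_nhdsLT hF hx)) hf

theorem essFilter_le_of_Ioo_subset {p q : ℝ} (h : Ioo p q ⊆ Ioo c d) (l : Filter ℝ) :
    essFilter p q l ≤ essFilter c d l :=
  inf_le_inf_left _ (ae_mono (Measure.restrict_mono h le_rfl))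

end EssLimits

/-! ### All intermediate spaces coincide -/

section Spaces

variable {c d : ℝ} {a : ℝ → ℝ}

/-- The pairs `(φ, √a φ_x)` with `φ ∈ C_c^∞(Ω)` as a linear space. -/
def testSubmodule (c d : ℝ) (a : ℝ → ℝ) : Submodule ℝ (Pairs c d) where
  carrier := testPairs c d a
  zero_mem' := by
    refine ⟨0, contDiff_const, HasCompactSupport.zero, by simp [tsupport_zero], ?_, ?_⟩
    · exact Lp.coeFn_zero _ _ _
    · filter_upwards [Lp.coeFn_zero ℝ 2 (volume.restrict (Ioo c d))] with x hx
      simpa using hx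
  add_mem' := by
    rintro e f ⟨φ, hφ, hφc, hφs, h1, h2⟩ ⟨ψ, hψ, hψc, hψs, h3, h4⟩
    refine ⟨φ + ψ, hφ.add hψ, hφc.add hψc, (tsupport_add _ _).trans (union_subset hφs hψs),
      ?_, ?_⟩
    · filter_upwards [Lp.coeFn_add e.1 f.1, h1, h3] with x hx hx1 hx2
      change (e.1 + f.1 : L2 c d) x = _
      rw [hx, Pi.add_apply, hx1, hx2, Pi.add_apply]
    · filter_upwards [Lp.coeFn_add e.2 f.2, h2, h4] with x hx hx1 hx2
      change (e.2 + f.2 : L2 c d) x = _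
      rw [hx, Pi.add_apply, hx1, hx2, deriv_add (hφ.differentiable (by simp) x)
        (hψ.differentiable (by simp) x)]
      ring
  smul_mem' := by
    rintro r e ⟨φ, hφ, hφc, hφs, h1, h2⟩
    refine ⟨fun x => r * φ x, contDiff_const.mul hφ, hφc.mul_left,
      (closure_mono (fun x hx => ?_)).trans hφs, ?_, ?_⟩
    · exact fun h => hx (by simp [h])
    · filter_upwards [Lp.coeFn_smul r e.1, h1] with x hx hx1
      change (r • e.1 : L2 c d) x = _
      rw [hx, Pi.smul_apply, hx1, smul_eq_mul]
    · filter_upwards [Lp.coeFn_smul r e.2, h2] with x hx hx1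
      change (r • e.2 : L2 c d) x = _
      rw [hx, Pi.smul_apply, hx1, smul_eq_mul, deriv_const_mul _ (hφ.differentiable (by simp) x)]
      ring

/-- The Poincaré inequality makes the projection to the slope bounded below on the complete space
H¹_{a,0}, so its range is closed. -/
theorem isClosed_image_snd_H10 {K : ℝ} (hK : ∀ e ∈ H10 c d a, ‖e.1‖ ≤ K * ‖e.2‖) :
    IsClosed ((fun e : Pairs c d => e.2) '' H10 c d a) := by
  let W := (testSubmodule c d a).topologicalClosure
  have hW : IsClosed (W : Set (Pairs c d)) := Submodule.isClosed_topologicalClosure _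
  have : CompleteSpace W := hW.completeSpace_coe
  let g : W →L[ℝ] L2 c d := (ContinuousLinearMap.snd ℝ (L2 c d) (L2 c d)) ∘L W.subtypeL
  have hg : AntilipschitzWith (max K 1).toNNReal g := by
    refine g.antilipschitz_of_bound fun e => ?_
    rw [Real.coe_toNNReal _ (by positivity)]
    have h1 : ‖e.1.1‖ ≤ K * ‖e.1.2‖ := hK e.1 e.2
    have h2 : ‖e‖ = max ‖e.1.1‖ ‖e.1.2‖ := rfl
    have h3 : ‖g e‖ = ‖e.1.2‖ := rfl
    rw [h2, h3]
    refine max_le (h1.trans ?_) ?_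
    · exact mul_le_mul_of_nonneg_right (le_max_left _ _) (norm_nonneg _)
    · exact le_mul_of_one_le_left (norm_nonneg _) (le_max_right _ _)
  have h4 := hg.isClosed_range g.uniformContinuous
  convert h4 using 1
  ext p
  constructor
  · rintro ⟨e, he, rfl⟩
    exact ⟨⟨e, he⟩, rfl⟩
  · rintro ⟨e, rfl⟩
    exact ⟨e.1, e.2, rfl⟩

theorem W1.integral_slope_eq_zero (hcd : c < d) (hw : WeakDegeneration c d a) {e : Pairs c d}
    (he : e ∈ W10 c d a) : ∫ x in Ioo c d, slope a e x = 0 := by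
  obtain ⟨h1, h2⟩ := he.1.1 hw
  obtain ⟨K, hK⟩ := h1.exists_primitive hcd h2
  have hc := continuousOn_primitive_Icc hcd.le h2 K
  have h3 := eq_of_ae_eq_of_tendsto_right hK hc ⟨le_rfl, hcd⟩ he.2.1
  have h4 := eq_of_ae_eq_of_tendsto_left hK hc ⟨hcd, le_rfl⟩ he.2.2
  rw [setIntegral_Ioo_eq_intervalIntegral hcd.le]
  simp only [intervalIntegral.integral_same, add_zero] at h3
  rw [h3, zero_add] at h4
  exact h4

/-- An element of `W¹_{a,0}(Ω)` with vanishing derivative is zero. -/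
theorem W10.fst_eq_zero (hc : c < 1) (hd : 1 < d) {e : Pairs c d}
    (he : e ∈ W10 c d a) (h2 : e.2 = 0) : e.1 = 0 := by
  have hs : slope a e =ᵐ[volume.restrict (Ioo c d)] 0 := by
    filter_upwards [Lp.coeFn_zero ℝ 2 (volume.restrict (Ioo c d))] with x hx
    simp only [slope]
    rw [h2, hx]
    simp
  have hweak : HasWeakDerivOn (Ioo c d \ {1}) e.1 (slope a e) := by
    by_cases hw : WeakDegeneration c d a
    · exact (he.1.1 hw).1.mono sdiff_subset
    · exact he.1.2 hw
  have hsub1 : Ioo c 1 ⊆ Ioo c d := Ioo_subset_Ioo_right hd.le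
  have hsub2 : Ioo 1 d ⊆ Ioo c d := Ioo_subset_Ioo_left hc.le
  have hz : ∀ {p q : ℝ}, Ioo p q ⊆ Ioo c d →
      slope a e =ᵐ[volume.restrict (Ioo p q)] 0 := fun h =>
    ae_mono (Measure.restrict_mono h le_rfl) hs
  -- A jump at 1 is not excluded, so the two sides are treated separately; each constant is then
  -- killed by the boundary condition at its own endpoint c or d.
  have hconst : ∀ {p q : ℝ}, p < q → Ioo p q ⊆ Ioo c d → 1 ∉ Ioo p q →
      ∃ K : ℝ, e.1 =ᵐ[volume.restrict (Ioo p q)] fun _ => K := by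
    intro p q hpq hsub h1
    have hw : HasWeakDerivOn (Ioo p q) e.1 (slope a e) :=
      hweak.mono fun x hx => ⟨hsub hx, fun h => h1 (h ▸ hx)⟩
    obtain ⟨K, hK⟩ := hw.exists_primitive hpq ((integrable_congr (hz hsub)).2 (integrable_zero _ _ _))
    refine ⟨K, ?_⟩
    filter_upwards [hK, ae_restrict_mem measurableSet_Ioo] with x hx hxm
    rw [hx, ← setIntegral_Ioo_eq_intervalIntegral hxm.1.le,
      integral_congr_ae (hz ((Ioo_subset_Ioo_right hxm.2.le).trans hsub))]
    simp
  obtain ⟨K₁, hK₁⟩ := hconst hc hsub1 right_notMem_Ioo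
  obtain ⟨K₂, hK₂⟩ := hconst hd hsub2 left_notMem_Ioo
  have e1 : K₁ = 0 := eq_of_ae_eq_of_tendsto_right hK₁ continuousOn_const ⟨le_rfl, hc⟩
    (he.2.1.mono_left (essFilter_le_of_Ioo_subset hsub1 _))
  have e2 : K₂ = 0 := eq_of_ae_eq_of_tendsto_left hK₂ continuousOn_const ⟨hd, le_rfl⟩
    (he.2.2.mono_left (essFilter_le_of_Ioo_subset hsub2 _))
  subst e1 e2
  rw [Lp.eq_zero_iff_ae_eq_zero]
  rw [EventuallyEq, ae_restrict_iff' measurableSet_Ioo] at hK₁ hK₂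
  rw [EventuallyEq, ae_restrict_iff' measurableSet_Ioo]
  filter_upwards [hK₁, hK₂, Measure.ae_ne volume (1 : ℝ)] with x hx1 hx2 hx hxm
  rcases lt_or_gt_of_ne hx with h | h
  · exact hx1 ⟨hxm.1, h⟩
  · exact hx2 ⟨h, hxm.2⟩

/-- Orthogonality to the test slopes means that √a r is a constant K. In the weak case ⟨r, √a u_x⟩ =
K ∫ u_x, which vanishes by the boundary conditions. In the strong case K = 0, as otherwise 1/a =
r²/K² would be integrable. -/
theorem IsWeight.inner_eq_zero_of_mem_W10 (ha : IsWeight c d a) (hcd : c < d) {r : L2 c d}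
    (hr : ∀ e ∈ testPairs c d a, inner ℝ r e.2 = 0) {e : Pairs c d} (he : e ∈ W10 c d a) :
    inner ℝ r e.2 = 0 := by
  have hL2 : MemLp (fun x => √(a x) * r x) 2 (volume.restrict (Ioo c d)) :=
    ha.memLp_sqrt_mul (Lp.memLp r)
  have hint : IntegrableOn (fun x => √(a x) * r x) (Ioo c d) := hL2.integrable (by norm_num)
  obtain ⟨K, hK⟩ := ae_eq_const_of_integral_mul_deriv_eq_zero hcd hint.locallyIntegrableOn
    (fun φ hφ hc hs => by
      obtain ⟨e, he, -, he2⟩ := ha.exists_mem_testPairs hφ hc hs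
      rw [← hr e he, inner_eq_integral]
      refine integral_congr_ae ?_
      filter_upwards [he2] with x hx
      rw [hx]; ring)
  by_cases hw : WeakDegeneration c d a
  · have h1 : inner ℝ r e.2 = K * ∫ x in Ioo c d, slope a e x := by
      rw [inner_eq_integral, ← integral_const_mul]
      refine integral_congr_ae ?_
      filter_upwards [hK, ha.ae_pos] with x hx hpos
      have := Real.sqrt_pos.2 hpos
      rw [← hx, slope]
      field_simp
    rw [h1, W1.integral_slope_eq_zero hcd hw he, mul_zero]
  · have hK0 : K = 0 := by
      by_contra hK0
      apply hw
      have h2 : Integrable (fun x => 1 / K ^ 2 * r x ^ 2) (volume.restrict (Ioo c d)) :=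
        (Lp.memLp r).integrable_sq.const_mul _
      refine h2.congr ?_
      filter_upwards [hK, ha.ae_pos] with x hx hpos
      rw [← hx, mul_pow, Real.sq_sqrt hpos.le]
      have hr0 : r x ≠ 0 := fun h => hK0 (by rw [← hx, h, mul_zero])
      field_simp
    have hr0 : r = 0 := by
      rw [Lp.eq_zero_iff_ae_eq_zero]
      filter_upwards [hK, ha.ae_pos] with x hx hpos
      rw [hK0] at hx
      exact (mul_eq_zero.1 hx).resolve_left (Real.sqrt_pos.2 hpos).ne'
    rw [hr0, inner_zero_left]

/-- All spaces between `H¹_{a,0}(Ω)` and `W¹_{a,0}(Ω)` are equal to `H¹_{a,0}(Ω)`. -/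
theorem IsIntermediate.coe_eq_H10 (hc : c < 1) (hd : 1 < d) (ha : IsWeight c d a)
    {V : Submodule ℝ (Pairs c d)} (hV : IsIntermediate c d a V) :
    (V : Set (Pairs c d)) = H10 c d a := by
  obtain ⟨k, hk, hak⟩ := ha.exists_le_sqrt hc hd
  have hcd : c < d := hc.trans hd
  refine Subset.antisymm (fun e he => ?_) hV.1
  have hcl := isClosed_image_snd_H10 (a := a)
    (fun e he => norm_fst_le_of_mem_H10 hcd.le hk hak he)
  let S : Submodule ℝ (L2 c d) :=
    (testSubmodule c d a).map (LinearMap.snd ℝ (L2 c d) (L2 c d))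
  have h1 : e.2 ∈ S.topologicalClosure := by
    rw [← Submodule.orthogonal_orthogonal_eq_closure, Submodule.mem_orthogonal]
    intro r hr
    refine ha.inner_eq_zero_of_mem_W10 hcd (fun f hf => ?_) (hV.2 he)
    rw [real_inner_comm]
    exact (Submodule.mem_orthogonal _ _).1 hr f.2 ⟨f, hf, rfl⟩
  have h2 : (S.topologicalClosure : Set (L2 c d)) ⊆ (fun e : Pairs c d => e.2) '' H10 c d a := by
    refine closure_minimal ?_ hcl
    rintro _ ⟨f, hf, rfl⟩
    exact ⟨f, subset_closure hf, rfl⟩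
  obtain ⟨f, hf, hfe⟩ := h2 h1
  have hfV : f ∈ V := hV.1 hf
  -- The element f of H¹_{a,0} has the same slope as e, and an element of W¹_{a,0} is determined by
  -- its slope.
  have h3 : (e - f).1 = 0 := W10.fst_eq_zero hc hd (hV.2 (V.sub_mem he hfV))
    (by rw [Prod.snd_sub, sub_eq_zero]; exact hfe.symm)
  have h4 : e = f := Prod.ext (sub_eq_zero.1 h3) hfe.symm
  rw [h4]; exact hf

end Spaces

/-! ### The flux a u_x: transmission conditions, boundary values, multiplier identity -/

section Flux

variable {c d : ℝ} {a : ℝ → ℝ}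

theorem L2.integrableOn (f : L2 c d) : IntegrableOn f (Ioo c d) :=
  (Lp.memLp f).integrable (by norm_num)

theorem exists_flux_primitive (hcd : c < d) {e : Pairs c d} {f : L2 c d}
    (h : HasWeakDerivOn (Ioo c d) (flux a e) f) :
    ∃ K : ℝ, flux a e =ᵐ[volume.restrict (Ioo c d)] fun x => K + ∫ t in c..x, f t :=
  h.exists_primitive hcd (L2.integrableOn f)

/-- Under strong degeneration a continuous flux vanishes at `1`. -/
theorem IsWeight.flux_eq_zero (ha : IsWeight c d a) (hc : c < 1) (hd : 1 < d)
    (hw : ¬ WeakDegeneration c d a) {e : Pairs c d} {F : ℝ → ℝ} (hF : ContinuousOn F (Icc c d))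
    (h : flux a e =ᵐ[volume.restrict (Ioo c d)] F) : F 1 = 0 := by
  by_contra h0
  apply hw
  obtain ⟨k, hk, hak⟩ := ha.exists_le_sqrt hc hd
  have hpos : 0 < |F 1| := abs_pos.2 h0
  obtain ⟨δ, hδ, hFδ⟩ := Metric.continuousOn_iff.1 hF 1 ⟨hc.le, hd.le⟩ (|F 1| / 2) (by positivity)
  -- A majorant of 1/a. Within δ of 1 one has |F| ≥ |F(1)|/2, and F² = ap² gives 1/a ≤ 4p²/F(1)²;
  -- elsewhere √a ≥ kδ.
  have hint : Integrable (fun x => 4 / |F 1| ^ 2 * e.2 x ^ 2 + 1 / (k * δ) ^ 2)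
      (volume.restrict (Ioo c d)) :=
    ((Lp.memLp e.2).integrable_sq.const_mul _).add (integrable_const _)
  have hmeas : AEStronglyMeasurable (fun x => 1 / a x) (volume.restrict (Ioo c d)) :=
    (ha.aestronglyMeasurable.aemeasurable.const_div 1).aestronglyMeasurable
  refine hint.mono' hmeas ?_
  filter_upwards [h, ha.ae_pos, ae_restrict_mem measurableSet_Ioo] with x hx hax hxm
  have hxm' := Ioo_subset_Icc_self hxm
  rw [Real.norm_of_nonneg (by positivity)]
  rcases lt_or_ge (dist x 1) δ with h1 | h1
  · have h2 := hFδ x hxm' h1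
    rw [Real.dist_eq] at h2
    have h3 : |F 1| / 2 ≤ |F x| := by
      have := abs_sub_abs_le_abs_sub (F 1) (F x)
      rw [abs_sub_comm] at this
      linarith
    have h4 : (|F 1| / 2) ^ 2 ≤ a x * e.2 x ^ 2 := by
      have := pow_le_pow_left₀ (by positivity) h3 2
      rwa [sq_abs, ← hx, flux, mul_pow, Real.sq_sqrt hax.le] at this
    have h5 : 1 / a x ≤ 4 / |F 1| ^ 2 * e.2 x ^ 2 := by
      rw [div_mul_eq_mul_div, div_le_div_iff₀ hax (by positivity)]
      nlinarith
    have h6 : 0 ≤ 1 / (k * δ) ^ 2 := by positivity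
    linarith
  · rw [Real.dist_eq] at h1
    have h2 : k * δ ≤ √(a x) := (mul_le_mul_of_nonneg_left h1 hk.le).trans (hak x hxm')
    have h3 : (k * δ) ^ 2 ≤ a x := by
      have := pow_le_pow_left₀ (by positivity) h2 2
      rwa [Real.sq_sqrt hax.le] at this
    have h4 : 1 / a x ≤ 1 / (k * δ) ^ 2 := one_div_le_one_div_of_le (by positivity) h3
    have h5 : 0 ≤ 4 / |F 1| ^ 2 * e.2 x ^ 2 := by positivity
    linarith

theorem sq_integral_le {p q : ℝ} (hpq : p ≤ q) {f : ℝ → ℝ} (hf : IntervalIntegrable f volume p q)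
    (hf2 : IntervalIntegrable (fun x => f x ^ 2) volume p q) :
    (∫ x in p..q, f x) ^ 2 ≤ (q - p) * ∫ x in p..q, f x ^ 2 := by
  rcases hpq.eq_or_lt with rfl | h
  · simp
  set I := ∫ x in p..q, f x
  -- Cauchy-Schwarz, from the nonnegative integral of the squared deviation of f from its mean m.
  set m := I / (q - p) with hm
  have h1 : 0 ≤ ∫ x in p..q, (f x - m) ^ 2 :=
    intervalIntegral.integral_nonneg hpq fun _ _ => sq_nonneg _
  have h2 : ∫ x in p..q, (f x - m) ^ 2 = (∫ x in p..q, f x ^ 2) - 2 * m * I + (q - p) * m ^ 2 := by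
    have : ∀ x, (f x - m) ^ 2 = f x ^ 2 - 2 * m * f x + m ^ 2 := fun x => by ring
    simp only [this]
    rw [intervalIntegral.integral_add (hf2.sub (hf.const_mul _)) intervalIntegrable_const,
      intervalIntegral.integral_sub hf2 (hf.const_mul _), intervalIntegral.integral_const_mul,
      intervalIntegral.integral_const, smul_eq_mul]
  have hqp : 0 < q - p := sub_pos.2 h
  have h3 : (q - p) * m = I := by rw [hm]; field_simp
  rw [h2] at h1
  have h4 := mul_nonneg hqp.le h1
  nlinarith

theorem sq_primitive_le {f : L2 c d} (hc : c < 1) (hd : 1 < d) {x : ℝ} (hx : x ∈ Icc c d) :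
    (∫ t in (1 : ℝ)..x, f t) ^ 2 ≤ |x - 1| * |∫ t in (1 : ℝ)..x, f t ^ 2| := by
  have h1 : IntervalIntegrable f volume c d :=
    intervalIntegrable_of_integrableOn_Ioo (hc.trans hd).le (L2.integrableOn f)
  have h2 : IntervalIntegrable (fun x => f x ^ 2) volume c d :=
    intervalIntegrable_of_integrableOn_Ioo (hc.trans hd).le (Lp.memLp f).integrable_sq
  have hsub : uIcc 1 x ⊆ uIcc c d := by
    rw [uIcc_of_le (hc.trans hd).le]
    exact uIcc_subset_Icc ⟨hc.le, hd.le⟩ hx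
  have h3 := h1.mono_set hsub
  have h4 := h2.mono_set hsub
  rcases le_total 1 x with h | h
  · rw [abs_of_nonneg (by linarith : 0 ≤ x - 1), abs_of_nonneg
      (intervalIntegral.integral_nonneg h fun _ _ => sq_nonneg _)]
    exact sq_integral_le h h3 h4
  · rw [intervalIntegral.integral_symm, neg_sq, intervalIntegral.integral_symm x 1, abs_neg,
      abs_of_nonpos (by linarith : x - 1 ≤ 0), neg_sub, abs_of_nonneg
      (intervalIntegral.integral_nonneg h fun _ _ => sq_nonneg _)]
    exact sq_integral_le h h3.symm h4.symm

theorem primitive_eq_add (hcd : c ≤ d) {f : ℝ → ℝ} (hf : IntegrableOn f (Ioo c d)) {p : ℝ}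
    (hp : p ∈ Icc c d) (K : ℝ) {x : ℝ} (hx : x ∈ Icc c d) :
    K + ∫ t in c..x, f t = (K + ∫ t in c..p, f t) + ∫ t in p..x, f t := by
  have h1 := intervalIntegrable_of_integrableOn_Ioo hcd hf
  have hsub : ∀ {p q : ℝ}, p ∈ Icc c d → q ∈ Icc c d → IntervalIntegrable f volume p q :=
    fun hp hq => h1.mono_set (by rw [uIcc_of_le hcd]; exact uIcc_subset_Icc hp hq)
  rw [add_assoc, intervalIntegral.integral_add_adjacent_intervals
    (hsub (left_mem_Icc.2 hcd) hp) (hsub hp hx)]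

/-- A flux with square integrable derivative is continuous, and under weak degeneration so is u.
Under strong degeneration fluxes vanish at 1. Hence aφ_x is bounded by |x - 1|^(1/2) times a factor
that tends to 0, while |x - 1|^(1/2)|u| is bounded, so their product tends to 0. -/
theorem IsIntermediate.transmission (hc : c < 1) (hd : 1 < d) (ha : IsWeight c d a)
    {V : Submodule ℝ (Pairs c d)} (hV : IsIntermediate c d a V) {e : Pairs c d} (he : e ∈ V)
    {f : L2 c d} (h : HasWeakDerivOn (Ioo c d) (flux a e) f) : Transmission c d a e := by
  have hcd : c < d := hc.trans hd
  have hl : (1 : ℝ) ∈ Ioc c d := ⟨hc, hd.le⟩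
  have hr : (1 : ℝ) ∈ Ico c d := ⟨hc.le, hd⟩
  obtain ⟨K, hK⟩ := exists_flux_primitive hcd h
  have hF := continuousOn_primitive_Icc hcd.le (L2.integrableOn f) K
  have hFl := tendsto_essFilter_of_ae_eq hK (ContinuousOn.tendsto_nhdsLT hF hl)
  have hFr := tendsto_essFilter_of_ae_eq hK (ContinuousOn.tendsto_nhdsGT hF hr)
  refine ⟨fun hw => ⟨?_, ⟨_, hFl, hFr⟩⟩, fun hw => ⟨fun φ hφ => ?_, ?_⟩⟩
  · obtain ⟨h1, h2⟩ := (hV.2 he).1.1 hw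
    obtain ⟨L, hL⟩ := h1.exists_primitive hcd h2
    have hu := continuousOn_primitive_Icc hcd.le h2 L
    exact ⟨_, tendsto_essFilter_of_ae_eq hL (ContinuousOn.tendsto_nhdsLT hu hl),
      tendsto_essFilter_of_ae_eq hL (ContinuousOn.tendsto_nhdsGT hu hr)⟩
  · obtain ⟨k, hk, hak⟩ := ha.exists_le_sqrt hc hd
    obtain ⟨g, hg⟩ := hφ.2
    obtain ⟨L, hL⟩ := exists_flux_primitive hcd hg
    have hG := continuousOn_primitive_Icc hcd.le (L2.integrableOn g) L
    have hG1 := ha.flux_eq_zero hc hd hw hG hL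
    have heH : e ∈ H10 c d a := hV.coe_eq_H10 hc hd ha ▸ he
    have hu := ae_abs_sub_mul_sq_le_of_mem_H10 hk hak heH
    set C := (1 / k) ^ 2 * ‖e.2‖ ^ 2 with hC
    have hC0 : 0 ≤ C := by positivity
    have hint2 : IntegrableOn (fun x => g x ^ 2) (Ioo c d) := (Lp.memLp g).integrable_sq
    -- A continuous majorant of |aφ_x u| with Q(1) = 0: the factor |x - 1| from Cauchy-Schwarz is
    -- absorbed by |x - 1|u² ≤ C.
    let Q : ℝ → ℝ := fun x => √(C * |∫ t in (1 : ℝ)..x, g t ^ 2|)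
    have hQ : ContinuousOn Q (Icc c d) := by
      have h1 := continuousOn_primitive_Icc hcd.le hint2 (-∫ t in c..1, g t ^ 2)
      have h2 : ContinuousOn (fun x => ∫ t in (1 : ℝ)..x, g t ^ 2) (Icc c d) := by
        refine h1.congr fun x hx => ?_
        beta_reduce
        rw [primitive_eq_add hcd.le hint2 ⟨hc.le, hd.le⟩ _ hx]
        ring
      exact (h2.abs.const_smul C).sqrt
    have hQ1 : Q 1 = 0 := by simp [Q]
    have hbound : ∀ᵐ x ∂(volume.restrict (Ioo c d)), ‖flux a φ x * e.1 x‖ ≤ Q x := by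
      filter_upwards [hu, hL, ha.ae_pos, ae_ne_one, ae_restrict_mem measurableSet_Ioo]
        with x hx hLx hax hx1 hxm
      refine Real.le_sqrt_of_sq_le ?_
      rw [Real.norm_eq_abs, sq_abs, hLx,
        primitive_eq_add hcd.le (L2.integrableOn g) ⟨hc.le, hd.le⟩ L (Ioo_subset_Icc_self hxm),
        hG1, zero_add, mul_pow]
      have h1 := sq_primitive_le (f := g) hc hd (Ioo_subset_Icc_self hxm)
      calc _ ≤ (|x - 1| * |∫ t in (1 : ℝ)..x, g t ^ 2|) * e.1 x ^ 2 :=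
            mul_le_mul_of_nonneg_right h1 (sq_nonneg _)
        _ = (|x - 1| * e.1 x ^ 2) * |∫ t in (1 : ℝ)..x, g t ^ 2| := by ring
        _ ≤ C * |∫ t in (1 : ℝ)..x, g t ^ 2| := mul_le_mul_of_nonneg_right hx (abs_nonneg _)
    have hev : ∀ l : Filter ℝ, ∀ᶠ x in essFilter c d l, ‖flux a φ x * e.1 x‖ ≤ Q x := fun l =>
      hbound.filter_mono inf_le_right
    have hQl := (ContinuousOn.tendsto_nhdsLT hQ hl).mono_left
      (inf_le_left : essFilter c d (𝓝[<] 1) ≤ _)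
    have hQr := (ContinuousOn.tendsto_nhdsGT hQ hr).mono_left
      (inf_le_left : essFilter c d (𝓝[>] 1) ≤ _)
    rw [hQ1] at hQl hQr
    exact ⟨squeeze_zero_norm' (hev _) hQl, squeeze_zero_norm' (hev _) hQr⟩
  · have h1 := ha.flux_eq_zero hc hd hw hF hK
    rw [h1] at hFl hFr
    exact ⟨hFl, hFr⟩

/-- Multiplication by a bounded function on `L²(Ω)`. -/
theorem exists_mul_clm {m : ℝ → ℝ} (hm : AEStronglyMeasurable m (volume.restrict (Ioo c d)))
    {K : ℝ} (hK : ∀ x ∈ Ioo c d, |m x| ≤ K) :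
    ∃ A : L2 c d →L[ℝ] L2 c d, ∀ p, A p =ᵐ[volume.restrict (Ioo c d)] fun x => m x * p x := by
  have hb : ∀ p : L2 c d, ∀ᵐ x ∂(volume.restrict (Ioo c d)), ‖m x * p x‖ ≤ K * ‖p x‖ := by
    intro p
    filter_upwards [ae_restrict_mem measurableSet_Ioo] with x hx
    rw [norm_mul]
    exact mul_le_mul_of_nonneg_right (hK x hx) (norm_nonneg _)
  have hp : ∀ p : L2 c d, MemLp (fun x => m x * p x) 2 (volume.restrict (Ioo c d)) := fun p =>
    (Lp.memLp p).of_le_mul (hm.mul (Lp.memLp p).1) (hb p)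
  let A₀ : L2 c d →ₗ[ℝ] L2 c d :=
    { toFun := fun p => MemLp.toLp _ (hp p)
      map_add' := fun p q => by
        rw [← MemLp.toLp_add]
        refine MemLp.toLp_congr _ _ ?_
        filter_upwards [Lp.coeFn_add p q] with x hx
        rw [hx, Pi.add_apply, Pi.add_apply, mul_add]
      map_smul' := fun r p => by
        rw [RingHom.id_apply, ← MemLp.toLp_const_smul]
        refine MemLp.toLp_congr _ _ ?_
        filter_upwards [Lp.coeFn_smul r p] with x hx
        rw [hx, Pi.smul_apply, Pi.smul_apply, smul_eq_mul, smul_eq_mul]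
        ring }
  refine ⟨A₀.mkContinuous K fun p => ?_, fun p => MemLp.coeFn_toLp (hp p)⟩
  refine Lp.norm_le_mul_norm_of_ae_le_mul ?_
  filter_upwards [MemLp.coeFn_toLp (hp p), hb p] with x hx hx2
  change ‖MemLp.toLp _ (hp p) x‖ ≤ _
  rw [hx]
  exact hx2

/-- Applied to p = √a u_x this is the multiplier (x - 1) a u_x, which vanishes at the degenerate
point and points outwards at both ends of Ω. -/
theorem IsWeight.exists_multiplier (ha : IsWeight c d a) :
    ∃ A : L2 c d →L[ℝ] L2 c d,
      ∀ p, A p =ᵐ[volume.restrict (Ioo c d)] fun x => (x - 1) * √(a x) * p x := by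
  have hcont : ContinuousOn (fun x => (x - 1) * √(a x)) (Icc c d) :=
    (by fun_prop : ContinuousOn (fun x : ℝ => x - 1) (Icc c d)).mul ha.continuousOn_sqrt
  obtain ⟨K, hK⟩ := isCompact_Icc.exists_bound_of_continuousOn hcont
  exact exists_mul_clm
    ((hcont.mono Ioo_subset_Icc_self).aestronglyMeasurable measurableSet_Ioo)
    fun x hx => (hK x (Ioo_subset_Icc_self hx)).trans (le_abs_self K)

/-- `|∫ (x - 1) a u u_x| ≤ C ∫ u²`. -/
theorem IsWeight.exists_abs_inner_multiplier_le (ha : IsWeight c d a) (hc : c < 1) (hd : 1 < d)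
    {A : L2 c d →L[ℝ] L2 c d}
    (hA : ∀ p, A p =ᵐ[volume.restrict (Ioo c d)] fun x => (x - 1) * √(a x) * p x) :
    ∃ C, ∀ e ∈ H10 c d a, |inner ℝ e.1 (A e.2)| ≤ C * ‖e.1‖ ^ 2 := by
  have hcd : c < d := hc.trans hd
  obtain ⟨M, hM, haM⟩ := ha.exists_le
  obtain ⟨C, hC⟩ := ha.exists_abs_mul_deriv_le
  refine ⟨(M + C) / 2, fun e he => ?_⟩
  have hcl : IsClosed {e : Pairs c d | |inner ℝ e.1 (A e.2)| ≤ (M + C) / 2 * ‖e.1‖ ^ 2} :=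
    isClosed_le (by fun_prop) (by fun_prop)
  refine closure_minimal (fun e he => ?_) hcl he
  obtain ⟨φ, hφ, hcφ, hs, h1, h2⟩ := he
  have hφ1 : ContDiff ℝ 1 φ := hφ.of_le (by norm_num)
  have hφd : Continuous (deriv φ) := hφ1.continuous_deriv le_rfl
  have hφc := hφ.continuous
  have hm : ∀ x ∈ Ioo c d, x ≠ 1 → |a x + (x - 1) * deriv a x| ≤ M + C := fun x hx hx1 =>
    (abs_add_le _ _).trans (add_le_add
      ((abs_of_nonneg (ha.nonneg (Ioo_subset_Icc_self hx))).trans_le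
        (haM x (Ioo_subset_Icc_self hx))) (hC x hx hx1))
  have hmφ : IntegrableOn (fun x => (a x + (x - 1) * deriv a x) * φ x ^ 2) (Ioo c d) := by
    have h3 : IntegrableOn (fun x => φ x ^ 2) (Ioo c d) :=
      (Continuous.integrableOn_Icc (by fun_prop)).mono_set Ioo_subset_Icc_self
    refine Integrable.bdd_mul (c := M + C) h3 ?_ ?_
    · exact ha.aestronglyMeasurable.add
        ((by fun_prop : AEStronglyMeasurable (fun x : ℝ => x - 1) _).mul
          (measurable_deriv a).aestronglyMeasurable)
    · filter_upwards [ae_ne_one, ae_restrict_mem measurableSet_Ioo] with x hx1 hx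
      exact hm x hx hx1
  have hφφ : IntegrableOn (fun x => 2 * ((x - 1) * a x * (φ x * deriv φ x))) (Ioo c d) := by
    have : ContinuousOn (fun x => 2 * ((x - 1) * a x * (φ x * deriv φ x))) (Icc c d) :=
      continuousOn_const.mul (((by fun_prop : ContinuousOn (fun x : ℝ => x - 1) (Icc c d)).mul
        ha.continuousOn).mul (by fun_prop))
    exact this.integrableOn_Icc.mono_set Ioo_subset_Icc_self
  -- Integration of ((x - 1)aφ²)'. The weight need not be differentiable at 1, hence the exceptional
  -- set; the boundary terms vanish because φ is compactly supported in Ω.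
  have hftc := integral_eq_of_hasDerivAt_off_countable_of_le
    (fun x => (x - 1) * a x * φ x ^ 2)
    (fun x => (a x + (x - 1) * deriv a x) * φ x ^ 2 + 2 * ((x - 1) * a x * (φ x * deriv φ x)))
    hcd.le (countable_singleton (1 : ℝ))
    (((by fun_prop : ContinuousOn (fun x : ℝ => x - 1) (Icc c d)).mul
        ha.continuousOn).mul (by fun_prop))
    (fun x hx => by
      have h3 := ((ha.contDiffAt hx.1 hx.2).differentiableAt one_ne_zero).hasDerivAt
      have h4 := (hφ1.differentiable one_ne_zero x).hasDerivAt
      refine ((((hasDerivAt_id x).sub_const 1).mul h3).mul (h4.pow 2)).congr_deriv ?_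
      simp; ring)
    (intervalIntegrable_of_integrableOn_Ioo hcd.le (hmφ.add hφφ))
  rw [← setIntegral_Ioo_eq_intervalIntegral hcd.le, integral_add hmφ hφφ, integral_const_mul,
    eq_zero_of_tsupport_subset hs right_notMem_Ioo,
    eq_zero_of_tsupport_subset hs left_notMem_Ioo] at hftc
  have h5 : inner ℝ e.1 (A e.2) = ∫ x in Ioo c d, (x - 1) * a x * (φ x * deriv φ x) := by
    rw [inner_eq_integral]
    refine integral_congr_ae ?_
    filter_upwards [hA e.2, h1, h2, ha.ae_pos] with x hx hx1 hx2 hax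
    rw [hx, hx1, hx2]
    have := Real.mul_self_sqrt hax.le
    calc _ = (x - 1) * (√(a x) * √(a x)) * (φ x * deriv φ x) := by ring
      _ = _ := by rw [this]
  have h6 : |∫ x in Ioo c d, (a x + (x - 1) * deriv a x) * φ x ^ 2| ≤ (M + C) * ‖e.1‖ ^ 2 := by
    rw [norm_sq_eq_integral, ← integral_const_mul, ← Real.norm_eq_abs]
    refine norm_integral_le_of_norm_le ((Lp.memLp e.1).integrable_sq.const_mul _) ?_
    filter_upwards [h1, ae_ne_one, ae_restrict_mem measurableSet_Ioo] with x hx hx1 hxm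
    rw [hx, norm_mul, Real.norm_of_nonneg (sq_nonneg (φ x))]
    exact mul_le_mul_of_nonneg_right (hm x hxm hx1) (sq_nonneg _)
  change |inner ℝ e.1 (A e.2)| ≤ (M + C) / 2 * ‖e.1‖ ^ 2
  rw [h5]
  have h7 : ∫ x in Ioo c d, (x - 1) * a x * (φ x * deriv φ x) =
      -(1 / 2) * ∫ x in Ioo c d, (a x + (x - 1) * deriv a x) * φ x ^ 2 := by
    simp only [ne_eq, OfNat.ofNat_ne_zero, not_false_eq_true, zero_pow, mul_zero, sub_zero] at hftc
    linarith
  rw [h7, abs_mul, abs_neg, abs_of_pos (by norm_num : (0 : ℝ) < 1 / 2)]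
  linarith

theorem memLp_of_continuousOn_Icc {g : ℝ → ℝ} (hg : ContinuousOn g (Icc c d)) :
    MemLp g 2 (volume.restrict (Ioo c d)) := by
  obtain ⟨K, hK⟩ := isCompact_Icc.exists_bound_of_continuousOn hg
  refine MemLp.of_bound ((hg.mono Ioo_subset_Icc_self).aestronglyMeasurable measurableSet_Ioo) K ?_
  filter_upwards [ae_restrict_mem measurableSet_Ioo] with x hx
  exact hK x (Ioo_subset_Icc_self hx)

/-- The boundary values of the flux `F = √a p` with `F_x = f` are bounded functionals of
`(p, f)`. -/
theorem IsWeight.exists_boundary_flux (ha : IsWeight c d a) (hcd : c < d) :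
    ∃ bc bd : L2 c d × L2 c d →L[ℝ] ℝ, ∀ (e : Pairs c d) (f : L2 c d) (K : ℝ),
      flux a e =ᵐ[volume.restrict (Ioo c d)] (fun x => K + ∫ t in c..x, f t) →
      bc (e.2, f) = K ∧ bd (e.2, f) = K + ∫ t in c..d, f t := by
  have hs : MemLp (fun x => √(a x)) 2 (volume.restrict (Ioo c d)) :=
    memLp_of_continuousOn_Icc ha.continuousOn_sqrt
  have hl : ∀ q : ℝ, MemLp (fun x => x - q) 2 (volume.restrict (Ioo c d)) := fun q =>
    memLp_of_continuousOn_Icc (by fun_prop)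
  -- Integration of the flux F against (x - q)' = 1 gives ∫F + ∫f(x - q) = F(d)(d - q) - F(c)(c -
  -- q). The choice q = d isolates F(c) = K and q = c isolates F(d).
  let b : ℝ → (L2 c d × L2 c d →L[ℝ] ℝ) := fun q => (d - c)⁻¹ •
    ((innerSL ℝ (hs.toLp _)) ∘L ContinuousLinearMap.fst ℝ (L2 c d) (L2 c d) +
      (innerSL ℝ ((hl q).toLp _)) ∘L ContinuousLinearMap.snd ℝ (L2 c d) (L2 c d))
  have hb : ∀ (q : ℝ) (e : Pairs c d) (f : L2 c d) (K : ℝ),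
      flux a e =ᵐ[volume.restrict (Ioo c d)] (fun x => K + ∫ t in c..x, f t) →
      (d - c) * b q (e.2, f) = (K + ∫ t in c..d, f t) * (d - q) - K * (c - q) := by
    intro q e f K h
    have h1 : b q (e.2, f) = (d - c)⁻¹ * (inner ℝ (hs.toLp _) e.2 + inner ℝ ((hl q).toLp _) f) :=
      rfl
    have hq : AbsolutelyContinuousOnInterval (fun x => x - q) c d :=
      (ContDiff.contDiffOn (by fun_prop)).absolutelyContinuousOnInterval
    have h2 := integral_primitive_mul_deriv hcd.le (L2.integrableOn f) K hq
    have h3 : inner ℝ (hs.toLp _) e.2 =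
        ∫ x in Ioo c d, (K + ∫ t in c..x, f t) * deriv (fun x => x - q) x := by
      rw [inner_eq_integral]
      refine integral_congr_ae ?_
      filter_upwards [h, hs.coeFn_toLp] with x hx hx2
      rw [hx2, ← hx, flux]
      simp
    have h4 : inner ℝ ((hl q).toLp _) f = ∫ x in Ioo c d, f x * (x - q) := by
      rw [inner_eq_integral]
      refine integral_congr_ae ?_
      filter_upwards [(hl q).coeFn_toLp] with x hx
      rw [hx, mul_comm]
    rw [h1, h3, h4, h2]
    field_simp [(sub_pos.2 hcd).ne']
    ring
  have hcd' := (sub_pos.2 hcd).ne'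
  refine ⟨b d, b c, fun e f K h => ⟨?_, ?_⟩⟩
  · have := hb d e f K h
    refine mul_left_cancel₀ hcd' (this.trans ?_)
    ring
  · have := hb c e f K h
    refine mul_left_cancel₀ hcd' (this.trans ?_)
    ring

/-- The multiplier identity for the boundary values of the flux. -/
theorem boundary_flux_sq_eq (hcd : c < d) {A : L2 c d →L[ℝ] L2 c d}
    (hA : ∀ p, A p =ᵐ[volume.restrict (Ioo c d)] fun x => (x - 1) * √(a x) * p x)
    {e : Pairs c d} {f : L2 c d} {K : ℝ}
    (h : flux a e =ᵐ[volume.restrict (Ioo c d)] fun x => K + ∫ t in c..x, f t) :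
    (d - 1) * (K + ∫ t in c..d, f t) ^ 2 + (1 - c) * K ^ 2 =
      2 * inner ℝ f (A e.2) + ∫ x in Ioo c d, flux a e x ^ 2 := by
  have hf := L2.integrableOn f
  have h1 : AbsolutelyContinuousOnInterval (fun x => x - 1) c d :=
    (ContDiff.contDiffOn (by fun_prop)).absolutelyContinuousOnInterval
  have hF := absolutelyContinuous_primitive hcd.le hf K
  -- F is integrated by parts against (x - 1)F. Since ((x - 1)F)' = F + (x - 1)f, the term ∫(x -
  -- 1)fF occurs on both sides, which produces the factor 2.
  have h2 := integral_primitive_mul_deriv hcd.le hf K (h1.fun_mul hF)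
  have hFc := continuousOn_primitive_Icc hcd.le hf K
  have h3 : inner ℝ f (A e.2) =
      ∫ x in Ioo c d, f x * ((x - 1) * (K + ∫ t in c..x, f t)) := by
    rw [inner_eq_integral]
    refine integral_congr_ae ?_
    filter_upwards [h, hA e.2] with x hx hx2
    rw [hx2, ← hx, flux]
    ring
  have h4 : ∫ x in Ioo c d, (K + ∫ t in c..x, f t) *
      deriv (fun x => (x - 1) * (K + ∫ t in c..x, f t)) x =
      (∫ x in Ioo c d, flux a e x ^ 2) + inner ℝ f (A e.2) := by
    rw [h3, ← integral_add]
    · refine integral_congr_ae ?_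
      filter_upwards [h, ae_restrict_of_ae (ae_deriv_primitive hcd.le hf K),
        ae_restrict_mem measurableSet_Ioo] with x hx hx2 hxm
      have h5 := hx2 (by rw [uIcc_of_le hcd.le]; exact Ioo_subset_Icc_self hxm)
      have h6 := (((hasDerivAt_id x).sub_const 1).mul h5).deriv
      have h7 : deriv (fun x => (x - 1) * (K + ∫ t in c..x, f t)) x =
          1 * (K + ∫ t in c..x, f t) + (x - 1) * f x := h6
      rw [h7, hx]
      ring
    · have h8 : IntegrableOn (fun x => (K + ∫ t in c..x, f t) ^ 2) (Ioo c d) :=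
        (hFc.pow 2).integrableOn_Icc.mono_set Ioo_subset_Icc_self
      refine h8.congr ?_
      filter_upwards [h] with x hx
      rw [hx]
    · have h9 : ContinuousOn (fun x => (x - 1) * (K + ∫ t in c..x, f t)) (Icc c d) :=
        (by fun_prop : ContinuousOn (fun x : ℝ => x - 1) (Icc c d)).mul hFc
      have h10 := (hf.congr_set_ae Ioo_ae_eq_Icc.symm).mul_continuousOn h9 isCompact_Icc
      exact h10.mono_set Ioo_subset_Icc_self
  rw [h4, ← h3] at h2
  simp only [intervalIntegral.integral_same, add_zero] at h2
  linarith

theorem IsWeight.integral_flux_sq_le (ha : IsWeight c d a) {M : ℝ} (hM : ∀ x ∈ Icc c d, a x ≤ M)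
    (e : Pairs c d) : ∫ x in Ioo c d, flux a e x ^ 2 ≤ M * ‖e.2‖ ^ 2 := by
  rw [norm_sq_eq_integral, ← integral_const_mul]
  refine integral_mono_ae (ha.memLp_sqrt_mul (Lp.memLp e.2)).integrable_sq
    ((Lp.memLp e.2).integrable_sq.const_mul _) ?_
  filter_upwards [ha.ae_pos, ae_restrict_mem measurableSet_Ioo] with x hx hxm
  rw [flux, mul_pow, Real.sq_sqrt hx.le]
  exact mul_le_mul_of_nonneg_right (hM x (Ioo_subset_Icc_self hxm)) (sq_nonneg _)

theorem IsWeight.tendsto_slope (ha : IsWeight c d a) (hc : c < 1) (hd : 1 < d) {e : Pairs c d}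
    {f : L2 c d} {K : ℝ}
    (h : flux a e =ᵐ[volume.restrict (Ioo c d)] fun x => K + ∫ t in c..x, f t) :
    Tendsto (slope a e) (essFilter c d (𝓝[>] c)) (𝓝 (K / a c)) ∧
    Tendsto (slope a e) (essFilter c d (𝓝[<] d)) (𝓝 ((K + ∫ t in c..d, f t) / a d)) := by
  have hcd : c < d := hc.trans hd
  have hF := continuousOn_primitive_Icc hcd.le (L2.integrableOn f) K
  have h1 : slope a e =ᵐ[volume.restrict (Ioo c d)] fun x => (K + ∫ t in c..x, f t) / a x := by
    filter_upwards [h, ha.ae_pos] with x hx hpos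
    rw [← hx, slope, flux]
    have h2 := Real.sqrt_pos.2 hpos
    have h3 := Real.mul_self_sqrt hpos.le
    rw [div_eq_div_iff h2.ne' hpos.ne', ← h3, Real.sqrt_mul_self h2.le]
    ring
  have hcl : c ∈ Icc c d := left_mem_Icc.2 hcd.le
  have hdr : d ∈ Icc c d := right_mem_Icc.2 hcd.le
  constructor
  · have h2 := (ContinuousOn.tendsto_nhdsGT hF ⟨le_rfl, hcd⟩).div
      (ContinuousOn.tendsto_nhdsGT ha.continuousOn ⟨le_rfl, hcd⟩) (ha.pos c hcl hc.ne).ne'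
    rw [intervalIntegral.integral_same, add_zero] at h2
    exact tendsto_essFilter_of_ae_eq h1 h2
  · exact tendsto_essFilter_of_ae_eq h1 ((ContinuousOn.tendsto_nhdsLT hF ⟨hcd, le_rfl⟩).div
      (ContinuousOn.tendsto_nhdsLT ha.continuousOn ⟨hcd, le_rfl⟩) (ha.pos d hdr hd.ne').ne')

end Flux

/-! ### The inverse of the abstract wave generator -/

section WaveOperator

open scoped InnerProductSpace

variable {P H : Type*} [NormedAddCommGroup P] [InnerProductSpace ℝ P] [CompleteSpace P]
  [NormedAddCommGroup H] [InnerProductSpace ℝ H] [CompleteSpace H]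

/-- The inverse `(u', v') ↦ (-j* v', j u')` of the generator of the abstract wave equation on
`P × H`, for an embedding `j` of the energy space `P` into `H`. -/
noncomputable def waveInverse (j : P →L[ℝ] H) : WithLp 2 (P × H) →L[ℝ] WithLp 2 (P × H) :=
  (WithLp.prodContinuousLinearEquiv 2 ℝ P H).symm.toContinuousLinearMap ∘L
    ((-(ContinuousLinearMap.adjoint j ∘L WithLp.sndL 2 ℝ P H)).prod (j ∘L WithLp.fstL 2 ℝ P H))

theorem waveInverse_apply (j : P →L[ℝ] H) (x : WithLp 2 (P × H)) :
    waveInverse j x = WithLp.toLp 2 (-(ContinuousLinearMap.adjoint j x.snd), j x.fst) := rfl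

theorem isSkew_waveInverse (j : P →L[ℝ] H) : IsSkew (waveInverse j) := by
  intro x y
  rw [waveInverse_apply, waveInverse_apply, WithLp.prod_inner_apply, WithLp.prod_inner_apply]
  simp only [inner_neg_left, inner_neg_right, ContinuousLinearMap.adjoint_inner_left,
    ContinuousLinearMap.adjoint_inner_right]
  change -⟪x.snd, j y.fst⟫_ℝ + ⟪j x.fst, y.snd⟫_ℝ = -(-⟪j x.fst, y.snd⟫_ℝ + ⟪x.snd, j y.fst⟫_ℝ)
  ring

theorem injective_waveInverse {j : P →L[ℝ] H} (hj : Function.Injective j)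
    (hj' : Function.Injective (ContinuousLinearMap.adjoint j)) :
    Function.Injective (waveInverse j) := by
  intro x y h
  rw [waveInverse_apply, waveInverse_apply] at h
  have h1 := congrArg WithLp.fst h
  have h2 := congrArg WithLp.snd h
  simp only [WithLp.toLp_fst, WithLp.toLp_snd, neg_inj] at h1 h2
  refine WithLp.ofLp_injective 2 (Prod.ext (hj h2) (hj' h1))

end WaveOperator

/-! ### Classical trajectories of the group -/

section Classical

open scoped InnerProductSpace

variable {X : Type*} [NormedAddCommGroup X] [InnerProductSpace ℝ X] [CompleteSpace X]
  {B : X →L[ℝ] X} {U : ℝ → X →L[ℝ] X}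

theorem IsOrthogonalGroup.hasDerivAt (hU : IsOrthogonalGroup B U) (y : X) (t : ℝ) :
    HasDerivAt (fun t => U t (B y)) (U t y) t := by
  have h1 : (fun t => U t (B y)) = fun t => B y + ∫ s in (0 : ℝ)..t, U s y := by
    funext t
    rw [← hU.integral]; abel
  rw [h1]
  exact (intervalIntegral.integral_hasDerivAt_right ((hU.continuous y).intervalIntegrable _ _)
    ((hU.continuous y).stronglyMeasurableAtFilter _ _) (hU.continuous y).continuousAt).const_add _

/-- A classical solution is mild, hence a trajectory of U. Since x = Bx' and B is injective and
commutes with U, the derivative x' is a trajectory as well; boundary fluxes are observed through x'.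
-/
theorem IsOrthogonalGroup.eq_of_classical (hU : IsOrthogonalGroup B U) (hB : IsSkew B)
    (hi : Function.Injective B) {τ : ℝ} {x x' : ℝ → X} (hx' : ContinuousOn x' (Icc 0 τ))
    (hd : ∀ t ∈ Icc 0 τ, HasDerivWithinAt x (x' t) (Icc 0 τ) t)
    (h : ∀ t ∈ Icc 0 τ, x t = B (x' t)) {t : ℝ} (ht : t ∈ Icc 0 τ) :
    x t = U (t - τ) (x τ) ∧ x' t = U (t - τ) (x' τ) := by
  have hτ : τ ∈ Icc 0 τ := right_mem_Icc.2 (ht.1.trans ht.2)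
  have h1 : ∀ s ∈ Icc 0 τ, x s = U (s - τ) (x τ) := by
    refine hU.eq_of_mild hB hi (fun s hs => (hd s hs).continuousWithinAt) fun s hs => ?_
    have hsub : Icc s τ ⊆ Icc 0 τ := Icc_subset_Icc_left hs.1
    have hint : IntervalIntegrable x' volume s τ := by
      refine (hx'.mono ?_).intervalIntegrable
      rwa [uIcc_of_le hs.2]
    have h2 : ∫ r in s..τ, x' r = x τ - x s :=
      intervalIntegral.integral_eq_sub_of_hasDeriv_right_of_le hs.2
        (fun r hr => ((hd r (hsub hr)).continuousWithinAt).mono hsub)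
        (fun r hr => (((hd r (hsub (Ioo_subset_Icc_self hr))).hasDerivAt
          (Icc_mem_nhds (lt_of_le_of_lt hs.1 hr.1) hr.2)).hasDerivWithinAt)) hint
    rw [← h2, ← B.intervalIntegral_comp_comm hint]
    refine intervalIntegral.integral_congr fun r hr => ?_
    rw [uIcc_of_le hs.2] at hr
    exact (h r (hsub hr)).symm
  refine ⟨h1 t ht, hi ?_⟩
  rw [← h t ht, h1 t ht, h τ hτ, hU.comm]

end Classical

/-! ### The energy space as a Hilbert space of slopes, and the generator -/

section EnergySpace

variable {c d : ℝ} {a : ℝ → ℝ} {V : Submodule ℝ (Pairs c d)}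

/-- The space of the weighted slopes `√a u_x` of the elements `u` of `V`. -/
noncomputable def slopeSpace (V : Submodule ℝ (Pairs c d)) : Submodule ℝ (L2 c d) :=
  V.map (LinearMap.snd ℝ (L2 c d) (L2 c d))

/-- A Poincaré inequality on `V`. -/
def HasPoincare (V : Submodule ℝ (Pairs c d)) : Prop := ∃ K : ℝ, ∀ e ∈ V, ‖e.1‖ ≤ K * ‖e.2‖

theorem Energy.pair_mem (u : Energy V) : u.pair ∈ V := Subtype.property (p := fun e => e ∈ V) u

theorem Energy.pair_injective : Function.Injective (Energy.pair (V := V)) :=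
  Subtype.val_injective

theorem Energy.exists_pair_eq {e : Pairs c d} (he : e ∈ V) : ∃ u : Energy V, u.pair = e :=
  ⟨(⟨e, he⟩ : V), rfl⟩

/-- `V¹_{a,0}(Ω)` is isometric to its space of weighted slopes. -/
noncomputable def energyEquiv (hK : HasPoincare V) : Energy V ≃ₗᵢ[ℝ] slopeSpace V where
  toLinearEquiv := LinearEquiv.ofBijective
    ((Energy.weightedSlope (V := V)).codRestrict (slopeSpace V)
      fun u => ⟨u.pair, u.pair_mem, rfl⟩) (by
    obtain ⟨K, hK⟩ := hK
    constructor
    · rw [← LinearMap.ker_eq_bot, LinearMap.ker_eq_bot']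
      intro u hu
      have h2 : u.pair.2 = 0 := congrArg Subtype.val hu
      have h1 := hK u.pair u.pair_mem
      rw [h2, norm_zero, mul_zero, norm_le_zero_iff] at h1
      exact Energy.pair_injective (Prod.ext h1 h2)
    · rintro ⟨_, e, he, rfl⟩
      obtain ⟨u, hu⟩ := Energy.exists_pair_eq he
      refine ⟨u, Subtype.ext ?_⟩
      change u.pair.2 = e.2
      rw [hu])
  norm_map' _ := rfl

theorem coe_energyEquiv (hK : HasPoincare V) (u : Energy V) :
    (energyEquiv hK u : L2 c d) = u.pair.2 := rfl

theorem pair_energyEquiv_symm_snd (hK : HasPoincare V) (p : slopeSpace V) :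
    ((energyEquiv hK).symm p).pair.2 = p := by
  rw [← coe_energyEquiv hK, LinearIsometryEquiv.apply_symm_apply]

/-- The embedding `√a u_x ↦ u`. -/
noncomputable def embedding (hK : HasPoincare V) : slopeSpace V →L[ℝ] L2 c d :=
  ((LinearMap.fst ℝ (L2 c d) (L2 c d)) ∘ₗ Energy.pair ∘ₗ
    ((energyEquiv hK).symm.toLinearEquiv : slopeSpace V →ₗ[ℝ] Energy V)).mkContinuousOfExistsBound
    (by
      obtain ⟨K, hK'⟩ := id hK
      refine ⟨K, fun p => ?_⟩
      have := hK' _ ((energyEquiv hK).symm p).pair_mem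
      rwa [pair_energyEquiv_symm_snd] at this)

theorem embedding_apply (hK : HasPoincare V) (p : slopeSpace V) :
    embedding hK p = ((energyEquiv hK).symm p).pair.1 := rfl

theorem embedding_energyEquiv (hK : HasPoincare V) (u : Energy V) :
    embedding hK (energyEquiv hK u) = u.pair.1 := by
  rw [embedding_apply, LinearIsometryEquiv.symm_apply_apply]

theorem injective_embedding (hK : HasPoincare V) (h0 : ∀ e ∈ V, e.1 = 0 → e.2 = 0) :
    Function.Injective (embedding hK) := by
  rw [injective_iff_map_eq_zero]
  intro p hp
  have h := h0 _ ((energyEquiv hK).symm p).pair_mem hp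
  rw [pair_energyEquiv_symm_snd] at h
  exact Subtype.ext h

/-- The map `√a u_x ↦ (u, √a u_x)`. -/
noncomputable def pairCLM (hK : HasPoincare V) : slopeSpace V →L[ℝ] Pairs c d :=
  (embedding hK).prod (slopeSpace V).subtypeL

theorem pairCLM_energyEquiv (hK : HasPoincare V) (u : Energy V) :
    pairCLM hK (energyEquiv hK u) = u.pair :=
  Prod.ext (embedding_energyEquiv hK u) (coe_energyEquiv hK u)

theorem pair_energyEquiv_symm (hK : HasPoincare V) (p : slopeSpace V) :
    ((energyEquiv hK).symm p).pair = pairCLM hK p := by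
  rw [← pairCLM_energyEquiv hK, LinearIsometryEquiv.apply_symm_apply]

theorem IsIntermediate.hasPoincare (hc : c < 1) (hd : 1 < d) (ha : IsWeight c d a)
    (hV : IsIntermediate c d a V) : HasPoincare V := by
  obtain ⟨k, hk, hak⟩ := ha.exists_le_sqrt hc hd
  refine ⟨2 / k, fun e he => norm_fst_le_of_mem_H10 (hc.trans hd).le hk hak ?_⟩
  rw [← hV.coe_eq_H10 hc hd ha]
  exact he

theorem IsIntermediate.completeSpace_slopeSpace (hc : c < 1) (hd : 1 < d) (ha : IsWeight c d a)
    (hV : IsIntermediate c d a V) : CompleteSpace (slopeSpace V) := by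
  obtain ⟨K, hK⟩ := hV.hasPoincare hc hd ha
  have h := isClosed_image_snd_H10 (a := a) (K := K)
    (fun e he => hK e (by rw [← hV.coe_eq_H10 hc hd ha] at he; exact he))
  rw [← hV.coe_eq_H10 hc hd ha] at h
  have h2 : IsClosed (slopeSpace V : Set (L2 c d)) := h
  exact h2.completeSpace_coe

/-- The weak form of the equation `(a u_x)_x = f`. -/
theorem IsIntermediate.inner_eq_of_hasWeakDerivOn (hc : c < 1) (hd : 1 < d) (ha : IsWeight c d a)
    (hV : IsIntermediate c d a V) {e : Pairs c d} {f : L2 c d}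
    (h : HasWeakDerivOn (Ioo c d) (flux a e) f) {q : Pairs c d} (hq : q ∈ V) :
    inner ℝ e.2 q.2 = -inner ℝ f q.1 := by
  have hqH : q ∈ H10 c d a := hV.coe_eq_H10 hc hd ha ▸ hq
  have hcl : IsClosed {q : Pairs c d | inner ℝ e.2 q.2 = -inner ℝ f q.1} :=
    isClosed_eq (by fun_prop) (by fun_prop)
  refine closure_minimal ?_ hcl hqH
  rintro q ⟨φ, hφ, hcφ, hs, h1, h2⟩
  have h3 := h.2.2 φ hφ hcφ hs
  have h4 : inner ℝ e.2 q.2 = ∫ x in Ioo c d, flux a e x * deriv φ x := by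
    rw [inner_eq_integral]
    refine integral_congr_ae ?_
    filter_upwards [h2] with x hx
    rw [hx, flux]; ring
  have h5 : inner ℝ f q.1 = ∫ x in Ioo c d, f x * φ x := by
    rw [inner_eq_integral]
    refine integral_congr_ae ?_
    filter_upwards [h1] with x hx
    rw [hx]
  change inner ℝ e.2 q.2 = -inner ℝ f q.1
  rw [h4, h5, h3]

theorem IsIntermediate.hasWeakDerivOn_of_inner_eq (ha : IsWeight c d a)
    (hV : IsIntermediate c d a V) {e : Pairs c d} {f : L2 c d}
    (h : ∀ q ∈ V, inner ℝ e.2 q.2 = -inner ℝ f q.1) :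
    HasWeakDerivOn (Ioo c d) (flux a e) f := by
  have h0 : IntegrableOn (flux a e) (Ioo c d) :=
    (ha.memLp_sqrt_mul (Lp.memLp e.2)).integrable (by norm_num)
  refine ⟨h0.locallyIntegrableOn, (L2.integrableOn f).locallyIntegrableOn, fun φ hφ hcφ hs => ?_⟩
  obtain ⟨q, hq, h1, h2⟩ := ha.exists_mem_testPairs hφ hcφ hs
  have h3 := h q (hV.1 (subset_closure hq))
  have h4 : inner ℝ e.2 q.2 = ∫ x in Ioo c d, flux a e x * deriv φ x := by
    rw [inner_eq_integral]
    refine integral_congr_ae ?_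
    filter_upwards [h2] with x hx
    rw [hx, flux]; ring
  have h5 : inner ℝ f q.1 = ∫ x in Ioo c d, f x * φ x := by
    rw [inner_eq_integral]
    refine integral_congr_ae ?_
    filter_upwards [h1] with x hx
    rw [hx]
  rw [← h4, ← h5, h3]

/-- V contains the test functions, hence is dense in L²(Ω). This is the injectivity of the adjoint
of the embedding. -/
theorem IsIntermediate.eq_zero_of_inner_eq_zero (ha : IsWeight c d a)
    (hV : IsIntermediate c d a V) {f : L2 c d} (h : ∀ q ∈ V, inner ℝ f q.1 = 0) : f = 0 := by
  rw [Lp.eq_zero_iff_ae_eq_zero, EventuallyEq, ae_restrict_iff' measurableSet_Ioo]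
  refine isOpen_Ioo.ae_eq_zero_of_integral_contDiff_smul_eq_zero
    (L2.integrableOn f).locallyIntegrableOn fun φ hφ hcφ hs => ?_
  obtain ⟨q, hq, h1, -⟩ := ha.exists_mem_testPairs hφ hcφ hs
  have h3 := h q (hV.1 (subset_closure hq))
  rw [inner_eq_integral] at h3
  have h4 : ∫ x in Ioo c d, f x * q.1 x = ∫ x in Ioo c d, f x * φ x := by
    refine integral_congr_ae ?_
    filter_upwards [h1] with x hx
    rw [hx]
  rw [h4, setIntegral_mul_eq_integral hs] at h3
  simpa only [smul_eq_mul, mul_comm] using h3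

/-- An element of `W¹_a(Ω)` that vanishes has vanishing derivative. -/
theorem IsWeight.snd_eq_zero_of_mem_W10 (ha : IsWeight c d a) {e : Pairs c d}
    (he : e ∈ W10 c d a) (h1 : e.1 = 0) : e.2 = 0 := by
  have hO : IsOpen (Ioo c d \ {1}) := isOpen_Ioo.sdiff isClosed_singleton
  have hweak : HasWeakDerivOn (Ioo c d \ {1}) e.1 (slope a e) := by
    by_cases hw : WeakDegeneration c d a
    · exact (he.1.1 hw).1.mono sdiff_subset
    · exact he.1.2 hw
  have h0 : (e.1 : ℝ → ℝ) =ᵐ[volume.restrict (Ioo c d)] 0 := by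
    rw [h1]; exact Lp.coeFn_zero _ _ _
  have h2 := hO.ae_eq_zero_of_integral_contDiff_smul_eq_zero hweak.2.1 (fun φ hφ hcφ hs => by
    have h3 := hweak.2.2 φ hφ hcφ hs
    have h4 : ∫ x in Ioo c d \ {1}, e.1 x * deriv φ x = 0 := by
      refine integral_eq_zero_of_ae ?_
      filter_upwards [ae_mono (Measure.restrict_mono sdiff_subset le_rfl) h0] with x hx
      rw [hx]; simp
    rw [h4, setIntegral_mul_eq_integral hs] at h3
    simp only [smul_eq_mul, mul_comm (φ _)]
    linarith)
  rw [Lp.eq_zero_iff_ae_eq_zero]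
  filter_upwards [ae_restrict_of_ae h2, ha.ae_pos, ae_ne_one, ae_restrict_mem measurableSet_Ioo]
    with x hx hpos hx1 hxm
  have h5 := hx ⟨hxm, hx1⟩
  rw [slope, div_eq_zero_iff] at h5
  exact h5.resolve_right (Real.sqrt_pos.2 hpos).ne'

/-- The equation p = -j* v' is the weak form of (a u_x)_x = v', tested with all of V; density of
test functions makes it equivalent to the distributional equation. The transmission conditions come
for free from `IsIntermediate.transmission`. -/
theorem IsIntermediate.gen_iff (hc : c < 1) (hd : 1 < d) (ha : IsWeight c d a)
    (hV : IsIntermediate c d a V) (hK : HasPoincare V) [CompleteSpace (slopeSpace V)]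
    {u u' : Energy V} {v v' : L2 c d} :
    Gen a V u v u' v' ↔ WithLp.toLp 2 (energyEquiv hK u, v) =
      waveInverse (embedding hK) (WithLp.toLp 2 (energyEquiv hK u', v')) := by
  rw [waveInverse_apply, (WithLp.toLp_injective 2).eq_iff, Prod.ext_iff]
  simp only [WithLp.toLp_fst, WithLp.toLp_snd, embedding_energyEquiv]
  have key : energyEquiv hK u = -(ContinuousLinearMap.adjoint (embedding hK) v') ↔
      ∀ q ∈ V, inner ℝ u.pair.2 q.2 = -inner ℝ v' q.1 := by
    constructor
    · intro h q hq
      obtain ⟨w, rfl⟩ := Energy.exists_pair_eq hq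
      have h2 : inner ℝ (energyEquiv hK u) (energyEquiv hK w) = -inner ℝ v' w.pair.1 := by
        rw [h, inner_neg_left, ContinuousLinearMap.adjoint_inner_left, embedding_energyEquiv]
      exact h2
    · intro h
      refine ext_inner_right ℝ fun p => ?_
      rw [inner_neg_left, ContinuousLinearMap.adjoint_inner_left]
      have h2 := h _ ((energyEquiv hK).symm p).pair_mem
      rw [pair_energyEquiv_symm_snd] at h2
      exact h2
  constructor
  · intro h
    exact ⟨key.2 fun q hq => hV.inner_eq_of_hasWeakDerivOn hc hd ha h.snd hq, h.fst.symm⟩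
  · rintro ⟨h1, h2⟩
    have h3 := hV.hasWeakDerivOn_of_inner_eq ha (key.1 h1)
    exact ⟨h2.symm, h3, hV.transmission hc hd ha u.pair_mem h3⟩

end EnergySpace

/-! ### States, mild and classical solutions as trajectories -/

section State

variable {c d : ℝ} {a : ℝ → ℝ} {V : Submodule ℝ (Pairs c d)}

/-- The state space `V¹_{a,0}(Ω) × L²(Ω)` as a Hilbert space. -/
abbrev StateSpace (V : Submodule ℝ (Pairs c d)) : Type := WithLp 2 (slopeSpace V × L2 c d)

/-- The state `(u, v)`. -/
noncomputable def state (hK : HasPoincare V) (u : Energy V) (v : L2 c d) : StateSpace V :=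
  WithLp.toLp 2 (energyEquiv hK u, v)

/-- The first component of a state. -/
noncomputable def position (hK : HasPoincare V) (x : StateSpace V) : Energy V :=
  (energyEquiv hK).symm x.fst

theorem state_position (hK : HasPoincare V) (x : StateSpace V) :
    state hK (position hK x) x.snd = x := by
  rw [state, position, LinearIsometryEquiv.apply_symm_apply]
  rfl

theorem position_state (hK : HasPoincare V) (u : Energy V) (v : L2 c d) :
    position hK (state hK u v) = u :=
  (energyEquiv hK).symm_apply_apply u

theorem pair_position (hK : HasPoincare V) (x : StateSpace V) :
    (position hK x).pair = pairCLM hK x.fst := pair_energyEquiv_symm hK x.fst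

theorem state_sub (hK : HasPoincare V) (u u' : Energy V) (v v' : L2 c d) :
    state hK (u - u') (v - v') = state hK u v - state hK u' v' := by
  rw [state, map_sub]; rfl

variable [CompleteSpace (slopeSpace V)]

/-- The state as a bounded linear function of the pair `(u, √a u_x)` and of `v`. -/
noncomputable def stateCLM (V : Submodule ℝ (Pairs c d)) [CompleteSpace (slopeSpace V)] :
    Pairs c d × L2 c d →L[ℝ] StateSpace V :=
  (WithLp.prodContinuousLinearEquiv 2 ℝ (slopeSpace V) (L2 c d)).symm.toContinuousLinearMap ∘L
    (((slopeSpace V).orthogonalProjectionOnto ∘L ContinuousLinearMap.snd ℝ (L2 c d) (L2 c d) ∘L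
      ContinuousLinearMap.fst ℝ (Pairs c d) (L2 c d)).prod
      (ContinuousLinearMap.snd ℝ (Pairs c d) (L2 c d)))

/-- The orthogonal projection fixes slopes of V; it only serves to define the map on all pairs, so
that continuity, derivatives and limits pass from pairs to states. -/
theorem stateCLM_pair (hK : HasPoincare V) (u : Energy V) (v : L2 c d) :
    stateCLM V (u.pair, v) = state hK u v := by
  change WithLp.toLp 2 ((slopeSpace V).orthogonalProjectionOnto u.pair.2, v) = _
  rw [← coe_energyEquiv hK, Submodule.orthogonalProjectionOnto_mem_subspace_eq_self]
  rfl

/-- The integral of the pairs is the pair of the integrated state, because the map from slopes to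
pairs is bounded. The domain condition then turns into an equation for the bounded inverse. -/
theorem isMild_iff (hc : c < 1) (hd : 1 < d) (ha : IsWeight c d a)
    (hV : IsIntermediate c d a V) (hK : HasPoincare V) {τ : ℝ} {w : ℝ → Energy V}
    {z : ℝ → L2 c d} :
    IsMild a V τ w z ↔ ContinuousOn (fun t => state hK (w t) (z t)) (Icc 0 τ) ∧
      ∀ t ∈ Icc 0 τ, waveInverse (embedding hK)
        (state hK (w τ) (z τ) - state hK (w t) (z t)) =
          ∫ s in t..τ, state hK (w s) (z s) := by
  have hcont : ContinuousOn (fun t => state hK (w t) (z t)) (Icc 0 τ) ↔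
      ContinuousOn (fun t => (w t).pair) (Icc 0 τ) ∧ ContinuousOn z (Icc 0 τ) := by
    constructor
    · intro h
      refine ⟨?_, (WithLp.sndL 2 ℝ (slopeSpace V) (L2 c d)).continuous.comp_continuousOn h⟩
      refine (((pairCLM hK) ∘L (WithLp.fstL 2 ℝ (slopeSpace V)
        (L2 c d))).continuous.comp_continuousOn h).congr fun t _ => ?_
      exact (pairCLM_energyEquiv hK (w t)).symm
    · rintro ⟨h1, h2⟩
      refine ((stateCLM V).continuous.comp_continuousOn (h1.prodMk h2)).congr fun t _ => ?_
      exact (stateCLM_pair hK (w t) (z t)).symm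
  have heqn : ContinuousOn (fun t => state hK (w t) (z t)) (Icc 0 τ) → ∀ t ∈ Icc 0 τ,
      ((∃ J : Energy V, J.pair = (∫ s in t..τ, (w s).pair) ∧
        Gen a V J (∫ s in t..τ, z s) (w τ - w t) (z τ - z t)) ↔
        waveInverse (embedding hK) (state hK (w τ) (z τ) - state hK (w t) (z t)) =
          ∫ s in t..τ, state hK (w s) (z s)) := by
    intro h t ht
    have hint : IntervalIntegrable (fun s => state hK (w s) (z s)) volume t τ := by
      refine (h.mono ?_).intervalIntegrable
      rw [uIcc_of_le ht.2]
      exact Icc_subset_Icc_left ht.1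
    set I := ∫ s in t..τ, state hK (w s) (z s) with hI
    have h1 : ∫ s in t..τ, (w s).pair = (position hK I).pair := by
      rw [pair_position]
      have := ((pairCLM hK) ∘L (WithLp.fstL 2 ℝ (slopeSpace V)
        (L2 c d))).intervalIntegral_comp_comm hint
      rw [ContinuousLinearMap.comp_apply] at this
      refine Eq.trans (intervalIntegral.integral_congr fun s _ => ?_) this
      exact (pairCLM_energyEquiv hK (w s)).symm
    have h2 : ∫ s in t..τ, z s = I.snd :=
      (WithLp.sndL 2 ℝ (slopeSpace V) (L2 c d)).intervalIntegral_comp_comm hint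
    rw [h1, h2]
    have h3 : Gen a V (position hK I) I.snd (w τ - w t) (z τ - z t) ↔
        waveInverse (embedding hK) (state hK (w τ) (z τ) - state hK (w t) (z t)) = I := by
      rw [hV.gen_iff hc hd ha hK, ← state_sub, eq_comm]
      have := state_position hK I
      rw [state] at this
      rw [this]
      rfl
    rw [← h3]
    constructor
    · rintro ⟨J, hJ, hG⟩
      rwa [Energy.pair_injective hJ] at hG
    · intro hG
      exact ⟨_, rfl, hG⟩
  constructor
  · intro h
    have hc' := hcont.2 ⟨h.continuousOn_fst, h.continuousOn_snd⟩
    exact ⟨hc', fun t ht => (heqn hc' t ht).1 (h.eqn t ht)⟩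
  · rintro ⟨h1, h2⟩
    exact ⟨(hcont.1 h1).1, (hcont.1 h1).2, fun t ht => (heqn h1 t ht).2 (h2 t ht)⟩

theorem IsIntermediate.injective_waveInverse (ha : IsWeight c d a)
    (hV : IsIntermediate c d a V) (hK : HasPoincare V) :
    Function.Injective (waveInverse (embedding hK)) := by
  refine DegWave.injective_waveInverse
    (injective_embedding hK fun e he h => ha.snd_eq_zero_of_mem_W10 (hV.2 he) h) ?_
  rw [injective_iff_map_eq_zero]
  intro f hf
  refine hV.eq_zero_of_inner_eq_zero ha fun q hq => ?_
  obtain ⟨u, rfl⟩ := Energy.exists_pair_eq hq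
  rw [← embedding_energyEquiv hK, ← ContinuousLinearMap.adjoint_inner_left, hf, inner_zero_left]

/-- The observation `(u', v') ↦ b (√a u_x, (a u_x)_x)` of the state `(u, v)` with
`𝒜 (u, v) = (u', v')`. -/
noncomputable def observation (hK : HasPoincare V) (b : L2 c d × L2 c d →L[ℝ] ℝ) :
    StateSpace V →L[ℝ] ℝ :=
  b ∘L (((slopeSpace V).subtypeL ∘L WithLp.fstL 2 ℝ (slopeSpace V) (L2 c d) ∘L
    waveInverse (embedding hK)).prod (WithLp.sndL 2 ℝ (slopeSpace V) (L2 c d)))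

theorem observation_apply (hK : HasPoincare V) (b : L2 c d × L2 c d →L[ℝ] ℝ)
    {u : Energy V} {v : L2 c d} {y : StateSpace V}
    (h : state hK u v = waveInverse (embedding hK) y) :
    observation hK b y = b (u.pair.2, y.snd) := by
  change b (((waveInverse (embedding hK) y).fst : L2 c d), y.snd) = _
  rw [← h]
  rfl

/-- The inverse generator maps (p, 0) to (0, jp), whose position is zero, so there is no boundary
flux. Tested with such states, the controlled equation shows no boundary term. -/
theorem observation_toLp_zero (hK : HasPoincare V) (b : L2 c d × L2 c d →L[ℝ] ℝ)
    (p : slopeSpace V) : observation hK b (WithLp.toLp 2 (p, 0)) = 0 := by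
  change b (((waveInverse (embedding hK) (WithLp.toLp 2 (p, 0))).fst : L2 c d), 0) = 0
  rw [waveInverse_apply]
  simp only [WithLp.toLp_fst, WithLp.toLp_snd, map_zero, neg_zero, ZeroMemClass.coe_zero]
  exact map_zero b

theorem IsIntermediate.gen_position (hc : c < 1) (hd : 1 < d) (ha : IsWeight c d a)
    (hV : IsIntermediate c d a V) (hK : HasPoincare V) (y : StateSpace V) :
    Gen a V (position hK (waveInverse (embedding hK) y)) (waveInverse (embedding hK) y).snd
      (position hK y) y.snd := by
  rw [hV.gen_iff hc hd ha hK]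
  exact (state_position hK _).trans (congrArg _ (state_position hK y).symm)

/-- The functionals `bc` and `bd` give the boundary values of the flux. -/
def IsBoundaryFlux (a : ℝ → ℝ) (bc bd : L2 c d × L2 c d →L[ℝ] ℝ) : Prop :=
  ∀ (e : Pairs c d) (f : L2 c d) (K : ℝ),
    flux a e =ᵐ[volume.restrict (Ioo c d)] (fun x => K + ∫ t in c..x, f t) →
    bc (e.2, f) = K ∧ bd (e.2, f) = K + ∫ t in c..d, f t

variable {U : ℝ → StateSpace V →L[ℝ] StateSpace V} {bc bd : L2 c d × L2 c d →L[ℝ] ℝ}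

theorem IsBoundaryFlux.tendsto_slope (hc : c < 1) (hd : 1 < d) (ha : IsWeight c d a)
    (hV : IsIntermediate c d a V) (hK : HasPoincare V) (hb : IsBoundaryFlux a bc bd)
    {u u' : Energy V} {v v' : L2 c d} (h : Gen a V u v u' v') :
    Tendsto (slope a u.pair) (essFilter c d (𝓝[>] c))
      (𝓝 (observation hK bc (state hK u' v') / a c)) ∧
    Tendsto (slope a u.pair) (essFilter c d (𝓝[<] d))
      (𝓝 (observation hK bd (state hK u' v') / a d)) := by
  obtain ⟨K, hKf⟩ := exists_flux_primitive (hc.trans hd) h.snd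
  have h1 := hb _ _ _ hKf
  have h2 : state hK u v = waveInverse (embedding hK) (state hK u' v') :=
    (hV.gen_iff hc hd ha hK).1 h
  have h3 := ha.tendsto_slope hc hd hKf
  rw [observation_apply hK bc h2, observation_apply hK bd h2]
  have h4 : (state hK u' v').snd = v' := rfl
  rw [h4, h1.1, h1.2]
  exact h3

/-- The witness y is the time derivative of the state at τ. Its trajectory is the derivative at all
times, and the boundary slopes are functionals of that derivative. -/
theorem IsClassical.exists_eq (hc : c < 1) (hd : 1 < d) (ha : IsWeight c d a)
    (hV : IsIntermediate c d a V) (hK : HasPoincare V)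
    (hU : IsOrthogonalGroup (waveInverse (embedding hK)) U) (hb : IsBoundaryFlux a bc bd)
    {τ : ℝ} (hτ : 0 ≤ τ) {w : ℝ → Energy V} {z : ℝ → L2 c d} (h : IsClassical a V τ w z) :
    ∃ y : StateSpace V, state hK (w τ) (z τ) = waveInverse (embedding hK) y ∧
      ∀ t ∈ Icc 0 τ,
        Tendsto (slope a (w t).pair) (essFilter c d (𝓝[>] c))
          (𝓝 (observation hK bc (U (t - τ) y) / a c)) ∧
        Tendsto (slope a (w t).pair) (essFilter c d (𝓝[<] d))
          (𝓝 (observation hK bd (U (t - τ) y) / a d)) := by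
  obtain ⟨w', z', hw', hz', h⟩ := h
  have hx' : ContinuousOn (fun t => state hK (w' t) (z' t)) (Icc 0 τ) := by
    refine ((stateCLM V).continuous.comp_continuousOn (hw'.prodMk hz')).congr fun t _ => ?_
    exact (stateCLM_pair hK (w' t) (z' t)).symm
  have hd' : ∀ t ∈ Icc 0 τ, HasDerivWithinAt (fun t => state hK (w t) (z t))
      (state hK (w' t) (z' t)) (Icc 0 τ) t := by
    intro t ht
    have h1 := (stateCLM V).hasFDerivAt.comp_hasDerivWithinAt t
      ((h t ht).1.prodMk (h t ht).2.1)
    rw [stateCLM_pair hK] at h1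
    refine h1.congr_of_mem (fun s _ => ?_) ht
    exact (stateCLM_pair hK (w s) (z s)).symm
  have hB : ∀ t ∈ Icc 0 τ, state hK (w t) (z t) =
      waveInverse (embedding hK) (state hK (w' t) (z' t)) := fun t ht =>
    (hV.gen_iff hc hd ha hK).1 (h t ht).2.2
  refine ⟨state hK (w' τ) (z' τ), hB τ (right_mem_Icc.2 hτ), fun t ht => ?_⟩
  rw [← (hU.eq_of_classical (isSkew_waveInverse _) (hV.injective_waveInverse ha hK)
    hx' hd' hB ht).2]
  exact hb.tendsto_slope hc hd ha hV hK (h t ht).2.2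

theorem isClassical_group (hc : c < 1) (hd : 1 < d) (ha : IsWeight c d a)
    (hV : IsIntermediate c d a V) (hK : HasPoincare V)
    (hU : IsOrthogonalGroup (waveInverse (embedding hK)) U) (τ : ℝ) (y : StateSpace V) :
    IsClassical a V τ
      (fun t => position hK (U (t - τ) (waveInverse (embedding hK) y)))
      (fun t => (U (t - τ) (waveInverse (embedding hK) y)).snd) := by
  have hcy := hU.continuous_sub τ y
  let ι : StateSpace V →L[ℝ] Pairs c d := pairCLM hK ∘L WithLp.fstL 2 ℝ (slopeSpace V) (L2 c d)
  have hι : ∀ x, (position hK x).pair = ι x := fun x => pair_position hK x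
  have hdx : ∀ t, HasDerivAt (fun t => U (t - τ) (waveInverse (embedding hK) y))
      (U (t - τ) y) t := fun t =>
    (hU.hasDerivAt y (t - τ)).comp_sub_const t τ
  refine ⟨fun t => position hK (U (t - τ) y), fun t => (U (t - τ) y).snd, ?_, ?_,
    fun t _ => ⟨?_, ?_, ?_⟩⟩
  · simp only [hι]
    exact (ι.continuous.comp hcy).continuousOn
  · exact ((WithLp.sndL 2 ℝ (slopeSpace V) (L2 c d)).continuous.comp hcy).continuousOn
  · simp only [hι]
    exact (ι.hasFDerivAt.comp_hasDerivAt t (hdx t)).hasDerivWithinAt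
  · exact ((WithLp.sndL 2 ℝ (slopeSpace V) (L2 c d)).hasFDerivAt.comp_hasDerivAt t
      (hdx t)).hasDerivWithinAt
  · simp only [hU.comm]
    exact hV.gen_position hc hd ha hK _

end State

/-! ### Limits of boundary observations in L²(0, τ) -/

section Traces

variable {X : Type*} [NormedAddCommGroup X] [InnerProductSpace ℝ X]
  {B : X →L[ℝ] X} {U : ℝ → X →L[ℝ] X}

theorem memLp_reflect {T τ : ℝ} (hτ : τ ∈ Icc 0 T) (g : Lp ℝ 2 (volume.restrict (Ioo 0 T)))
    (α : ℝ) : MemLp (fun t => g (τ - t) / α) 2 (volume.restrict (Ioo 0 τ)) := by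
  have h1 : MemLp g 2 (volume.restrict (Ioo 0 τ)) :=
    (Lp.memLp g).mono_measure (Measure.restrict_mono (Ioo_subset_Ioo_right hτ.2) le_rfl)
  have h2 := (h1.comp_measurePreserving (measurePreserving_reflect τ)).const_mul α⁻¹
  refine h2.ae_eq (Eventually.of_forall fun t => ?_)
  simp only [Function.comp, div_eq_inv_mul]

theorem eLpNorm_reflect_sub_le {T τ : ℝ} (hτ : τ ∈ Icc 0 T)
    (g h : Lp ℝ 2 (volume.restrict (Ioo 0 T))) (α : ℝ) :
    eLpNorm ((fun t => g (τ - t) / α) - fun t => h (τ - t) / α) 2 (volume.restrict (Ioo 0 τ)) ≤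
      ‖α⁻¹‖ₑ * edist g h := by
  have hle : (volume : Measure ℝ).restrict (Ioo 0 τ) ≤ volume.restrict (Ioo 0 T) :=
    Measure.restrict_mono (Ioo_subset_Ioo_right hτ.2) le_rfl
  have hm : AEStronglyMeasurable ((g : ℝ → ℝ) - (h : ℝ → ℝ)) (volume.restrict (Ioo 0 τ)) :=
    ((Lp.aestronglyMeasurable g).sub (Lp.aestronglyMeasurable h)).mono_measure hle
  have h1 : ((fun t => g (τ - t) / α) - fun t => h (τ - t) / α) =
      α⁻¹ • (((g : ℝ → ℝ) - (h : ℝ → ℝ)) ∘ fun t => τ - t) := by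
    funext t
    simp only [Pi.sub_apply, Pi.smul_apply, Function.comp, smul_eq_mul]
    ring
  rw [h1, eLpNorm_const_smul, eLpNorm_comp_measurePreserving hm (measurePreserving_reflect τ),
    Lp.edist_def]
  gcongr

theorem tendsto_eLpNorm_reflect_sub {T τ : ℝ} (hτ : τ ∈ Icc 0 T)
    {g : ℕ → Lp ℝ 2 (volume.restrict (Ioo 0 T))} {h : Lp ℝ 2 (volume.restrict (Ioo 0 T))}
    (hg : Tendsto g atTop (𝓝 h)) (α : ℝ) :
    Tendsto (fun n => eLpNorm ((fun t => g n (τ - t) / α) - fun t => h (τ - t) / α) 2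
      (volume.restrict (Ioo 0 τ))) atTop (𝓝 0) := by
  have h1 : Tendsto (fun n => ‖α⁻¹‖ₑ * edist (g n) h) atTop (𝓝 (‖α⁻¹‖ₑ * 0)) :=
    ENNReal.Tendsto.const_mul (tendsto_iff_edist_tendsto_0.1 hg) (Or.inr enorm_ne_top)
  rw [mul_zero] at h1
  exact tendsto_of_tendsto_of_tendsto_of_le_of_le tendsto_const_nhds h1 (fun _ => zero_le)
    fun n => eLpNorm_reflect_sub_le hτ (g n) h α

theorem ae_eq_of_tendsto_eLpNorm {μ : Measure ℝ} {G : ℕ → ℝ → ℝ} {g h : ℝ → ℝ}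
    (hG : ∀ n, AEStronglyMeasurable (G n) μ) (hgm : AEStronglyMeasurable g μ)
    (hhm : AEStronglyMeasurable h μ)
    (hg : Tendsto (fun n => eLpNorm (G n - g) 2 μ) atTop (𝓝 0))
    (hh : Tendsto (fun n => eLpNorm (G n - h) 2 μ) atTop (𝓝 0)) : g =ᵐ[μ] h := by
  have h1 : eLpNorm (g - h) 2 μ ≤ 0 := by
    have h2 := hh.add hg
    rw [add_zero] at h2
    refine ge_of_tendsto h2 (Eventually.of_forall fun n => ?_)
    have h3 : g - h = (G n - h) - (G n - g) := by abel
    rw [h3]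
    exact eLpNorm_sub_le ((hG n).sub hhm) ((hG n).sub hgm) (by norm_num)
  have h4 := (eLpNorm_eq_zero_iff (hgm.sub hhm) (by norm_num)).1 (le_antisymm h1 zero_le)
  filter_upwards [h4] with x hx
  exact sub_eq_zero.1 hx

/-- Limits of the observations of smooth states are given by `Ψ`. -/
theorem ae_eq_reflect_of_tendsto {b : X →L[ℝ] ℝ} {T τ : ℝ} (hτ : τ ∈ Icc 0 T)
    {Ψ : X →L[ℝ] Lp ℝ 2 (volume.restrict (Ioo 0 T))}
    (hΨ : ∀ y, Ψ (B y) =ᵐ[volume.restrict (Ioo 0 T)] fun s => b (U (-s) y))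
    {y : ℕ → X} {ξ : X} (hy : Tendsto (fun n => B (y n)) atTop (𝓝 ξ)) {α : ℝ} {G : ℕ → ℝ → ℝ}
    {g : ℝ → ℝ} (hG : ∀ n, ∀ t ∈ Icc 0 τ, G n t = b (U (t - τ) (y n)) / α)
    (hgm : AEStronglyMeasurable g (volume.restrict (Ioo 0 τ)))
    (hg : Tendsto (fun n => eLpNorm (G n - g) 2 (volume.restrict (Ioo 0 τ))) atTop (𝓝 0)) :
    g =ᵐ[volume.restrict (Ioo 0 τ)] fun t => Ψ ξ (τ - t) / α := by
  have h1 : ∀ n, G n =ᵐ[volume.restrict (Ioo 0 τ)] fun t => Ψ (B (y n)) (τ - t) / α := by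
    intro n
    filter_upwards [ae_comp_reflect hτ (hΨ (y n)), ae_restrict_mem measurableSet_Ioo] with t ht htm
    rw [hG n t (Ioo_subset_Icc_self htm), ht, neg_sub]
  refine ae_eq_of_tendsto_eLpNorm (fun n => (memLp_reflect hτ (Ψ (B (y n))) α).1) hgm
    (memLp_reflect hτ (Ψ ξ) α).1 (hg.congr fun n => ?_)
    (tendsto_eLpNorm_reflect_sub hτ ((Ψ.continuous.tendsto ξ).comp hy) α)
  exact eLpNorm_congr_ae ((h1 n).sub (ae_eq_refl g))

theorem tendsto_eLpNorm_observation {b : X →L[ℝ] ℝ} {T τ : ℝ} (hτ : τ ∈ Icc 0 T)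
    {Ψ : X →L[ℝ] Lp ℝ 2 (volume.restrict (Ioo 0 T))}
    (hΨ : ∀ y, Ψ (B y) =ᵐ[volume.restrict (Ioo 0 T)] fun s => b (U (-s) y))
    {y : ℕ → X} {ξ : X} (hy : Tendsto (fun n => B (y n)) atTop (𝓝 ξ)) (α : ℝ) :
    Tendsto (fun n => eLpNorm ((fun t => b (U (t - τ) (y n)) / α) - fun t => Ψ ξ (τ - t) / α) 2
      (volume.restrict (Ioo 0 τ))) atTop (𝓝 0) := by
  refine (tendsto_eLpNorm_reflect_sub hτ ((Ψ.continuous.tendsto ξ).comp hy) α).congr fun n => ?_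
  refine eLpNorm_congr_ae (EventuallyEq.sub ?_ (ae_eq_refl _))
  filter_upwards [ae_comp_reflect hτ (hΨ (y n))] with t ht
  rw [Function.comp, ht, neg_sub]

end Traces

/-! ### Admissibility criterion and the controlled state -/

section ControlledState

open scoped InnerProductSpace

variable {X : Type*} [NormedAddCommGroup X] [InnerProductSpace ℝ X] [CompleteSpace X]
  {B : X →L[ℝ] X} {U : ℝ → X →L[ℝ] X}

/-- An observation is admissible if its square is bounded by the derivative of a quadratic form
along the trajectories, up to the energy. -/
theorem IsOrthogonalGroup.isAdmissible (hU : IsOrthogonalGroup B U) {b : X →L[ℝ] ℝ}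
    {T K : ℝ} (hT : 0 ≤ T) (L : X →L[ℝ] X)
    (h : ∀ y, b y ^ 2 ≤ (⟪y, L (B y)⟫_ℝ + ⟪B y, L y⟫_ℝ) + K * ‖B y‖ ^ 2) :
    IsAdmissible B U b T := by
  -- The two endpoint values of the quadratic form cost ‖L‖‖By‖² each; the energy term is constant
  -- in time and contributes TK‖By‖².
  refine ⟨2 * ‖L‖ + T * K, fun y => ?_⟩
  have hy := hU.continuous_neg y
  have hx := hU.continuous_neg (B y)
  have hd : ∀ s, HasDerivAt (fun s => U (-s) (B y)) (-(U (-s) y)) s := fun s => by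
    have h1 := (hU.hasDerivAt y (-s)).scomp s (hasDerivAt_neg s)
    rwa [neg_one_smul] at h1
  -- Backwards in time U(-s)By has derivative -U(-s)y; the minus sign in the form compensates for
  -- this.
  have hdρ : ∀ s, HasDerivAt (fun s => -⟪U (-s) (B y), L (U (-s) (B y))⟫_ℝ)
      (⟪U (-s) y, L (U (-s) (B y))⟫_ℝ + ⟪U (-s) (B y), L (U (-s) y)⟫_ℝ) s := fun s => by
    refine ((hd s).inner ℝ (L.hasFDerivAt.comp_hasDerivAt s (hd s))).neg.congr_deriv ?_
    rw [map_neg, inner_neg_left, inner_neg_right, Function.comp]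
    ring
  have hcρ : Continuous fun s => ⟪U (-s) y, L (U (-s) (B y))⟫_ℝ +
      ⟪U (-s) (B y), L (U (-s) y)⟫_ℝ :=
    (hy.inner (L.continuous.comp hx)).add (hx.inner (L.continuous.comp hy))
  have h1 : ∫ s in (0 : ℝ)..T, (b (U (-s) y)) ^ 2 ≤
      ∫ s in (0 : ℝ)..T, ((⟪U (-s) y, L (U (-s) (B y))⟫_ℝ + ⟪U (-s) (B y), L (U (-s) y)⟫_ℝ) +
        K * ‖B y‖ ^ 2) := by
    refine intervalIntegral.integral_mono_on hT
      ((b.continuous.comp hy).pow 2).continuousOn.intervalIntegrable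
      (hcρ.add continuous_const).continuousOn.intervalIntegrable fun s _ => ?_
    have h2 := h (U (-s) y)
    rw [← hU.comm, hU.norm_map] at h2
    exact h2
  rw [intervalIntegral.integral_add hcρ.continuousOn.intervalIntegrable
    continuous_const.continuousOn.intervalIntegrable,
    intervalIntegral.integral_eq_sub_of_hasDerivAt (fun s _ => hdρ s)
      hcρ.continuousOn.intervalIntegrable, intervalIntegral.integral_const] at h1
  have h3 : ∀ s, |⟪U (-s) (B y), L (U (-s) (B y))⟫_ℝ| ≤ ‖L‖ * ‖B y‖ ^ 2 := fun s => by
    refine (abs_real_inner_le_norm _ _).trans ?_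
    have h4 := L.le_opNorm (U (-s) (B y))
    rw [hU.norm_map] at h4 ⊢
    nlinarith [norm_nonneg (B y)]
  have h5 := abs_le.1 (h3 T)
  have h6 := abs_le.1 (h3 0)
  rw [← integral_Ioc_eq_integral_Ioo, ← intervalIntegral.integral_of_le hT]
  simp only [smul_eq_mul, sub_zero] at h1
  linarith [h5.2, h6.1]

/-- The state at time `τ` of the controlled equation, as an element of the dual space. -/
noncomputable def controlledState (U : ℝ → X →L[ℝ] X) {T : ℝ}
    (Ψc Ψd : X →L[ℝ] Lp ℝ 2 (volume.restrict (Ioo 0 T))) (τ : ℝ) :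
    X × Lp ℝ 2 (volume.restrict (Ioo 0 T)) × Lp ℝ 2 (volume.restrict (Ioo 0 T)) →ₗ[ℝ] X where
  toFun D := U τ D.1 - controlled Ψd τ D.2.2 + controlled Ψc τ D.2.1
  map_add' D D' := by
    simp only [Prod.fst_add, Prod.snd_add, map_add]
    abel
  map_smul' r D := by
    simp only [Prod.smul_fst, Prod.smul_snd, map_smul, RingHom.id_apply, smul_add, smul_sub]

variable {T : ℝ} {Ψc Ψd : X →L[ℝ] Lp ℝ 2 (volume.restrict (Ioo 0 T))}

theorem controlledState_apply (τ : ℝ) (ξ : X) (fc fd : Lp ℝ 2 (volume.restrict (Ioo 0 T))) :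
    controlledState U Ψc Ψd τ (ξ, fc, fd) =
      U τ ξ - controlled Ψd τ fd + controlled Ψc τ fc := rfl

theorem IsOrthogonalGroup.continuous_controlledState (hU : IsOrthogonalGroup B U)
    (D : X × Lp ℝ 2 (volume.restrict (Ioo 0 T)) × Lp ℝ 2 (volume.restrict (Ioo 0 T))) :
    Continuous fun τ => controlledState U Ψc Ψd τ D :=
  ((hU.continuous D.1).sub (continuous_controlled Ψd D.2.2)).add
    (continuous_controlled Ψc D.2.1)

theorem IsOrthogonalGroup.norm_controlledState_le (hU : IsOrthogonalGroup B U) (τ : ℝ) (ξ : X)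
    (fc fd : Lp ℝ 2 (volume.restrict (Ioo 0 T))) :
    ‖controlledState U Ψc Ψd τ (ξ, fc, fd)‖ ≤ ‖ξ‖ + ‖Ψd‖ * ‖fd‖ + ‖Ψc‖ * ‖fc‖ := by
  rw [controlledState_apply]
  refine (norm_add_le _ _).trans (add_le_add ((norm_sub_le _ _).trans ?_)
    (norm_controlled_le Ψc τ fc))
  rw [hU.norm_map]
  gcongr
  exact norm_controlled_le Ψd τ fd

theorem IsOrthogonalGroup.inner_controlledState (hU : IsOrthogonalGroup B U) {τ : ℝ}
    (hτ : τ ∈ Icc 0 T) (ξ : X) (fc fd : Lp ℝ 2 (volume.restrict (Ioo 0 T))) (x : X) :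
    ⟪controlledState U Ψc Ψd τ (ξ, fc, fd), x⟫_ℝ = ⟪ξ, U (0 - τ) x⟫_ℝ -
      (∫ t in Ioo 0 τ, fd t * Ψd x (τ - t)) + ∫ t in Ioo 0 τ, fc t * Ψc x (τ - t) := by
  rw [controlledState_apply, inner_add_left, inner_sub_left, hU.inner_left, inner_controlled hτ,
    inner_controlled hτ, zero_sub]

/-- The equation in integrated form, tested with elements that are not observed. -/
theorem IsOrthogonalGroup.inner_apply_controlledState (hU : IsOrthogonalGroup B U)
    (hB : IsSkew B) (hd : DenseRange B) {bc bd : X →L[ℝ] ℝ}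
    (hΨc : ∀ y, Ψc (B y) =ᵐ[volume.restrict (Ioo 0 T)] fun s => bc (U (-s) y))
    (hΨd : ∀ y, Ψd (B y) =ᵐ[volume.restrict (Ioo 0 T)] fun s => bd (U (-s) y)) {τ : ℝ}
    (hτ : τ ∈ Icc 0 T)
    (D : X × Lp ℝ 2 (volume.restrict (Ioo 0 T)) × Lp ℝ 2 (volume.restrict (Ioo 0 T))) {q : X}
    (hc : bc q = 0) (hd' : bd q = 0) :
    ⟪B (controlledState U Ψc Ψd τ D), q⟫_ℝ =
      ⟪B D.1, q⟫_ℝ + ∫ s in (0 : ℝ)..τ, ⟪controlledState U Ψc Ψd s D, q⟫_ℝ := by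
  obtain ⟨ξ, fc, fd⟩ := D
  have h1 : ⟪U τ ξ, B q⟫_ℝ = -⟪B ξ, q⟫_ℝ - ∫ s in (0 : ℝ)..τ, ⟪U s ξ, q⟫_ℝ := by
    have h2 : U τ (B ξ) = B ξ + ∫ s in (0 : ℝ)..τ, U s ξ := by rw [← hU.integral]; abel
    have h3 : ∫ s in (0 : ℝ)..τ, ⟪U s ξ, q⟫_ℝ = ⟪∫ s in (0 : ℝ)..τ, U s ξ, q⟫_ℝ := by
      have := (innerSL ℝ q).intervalIntegral_comp_comm
        ((hU.continuous ξ).intervalIntegrable (μ := volume) 0 τ)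
      simp only [innerSL_apply_apply] at this
      rw [real_inner_comm, ← this]
      simp only [real_inner_comm]
    rw [h3, ← neg_eq_iff_eq_neg.2 (hB (U τ ξ) q), ← hU.comm, h2, inner_add_left]
    ring
  have hcU : IntervalIntegrable (fun s => ⟪U s ξ, q⟫_ℝ) volume 0 τ :=
    ((hU.continuous ξ).inner continuous_const).intervalIntegrable _ _
  have hcΦ : ∀ (Ψ : X →L[ℝ] Lp ℝ 2 (volume.restrict (Ioo 0 T)))
      (f : Lp ℝ 2 (volume.restrict (Ioo 0 T))),
      IntervalIntegrable (fun s => ⟪controlled Ψ s f, q⟫_ℝ) volume 0 τ := fun Ψ f =>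
    ((continuous_controlled Ψ f).inner continuous_const).intervalIntegrable _ _
  simp only [controlledState_apply]
  rw [hB, inner_add_left, inner_sub_left, h1, hU.inner_controlled_apply hd hΨc fc hτ q,
    hU.inner_controlled_apply hd hΨd fd hτ q, hc, hd']
  simp only [inner_add_left, inner_sub_left]
  rw [intervalIntegral.integral_add (hcU.sub (hcΦ Ψd fd)) (hcΦ Ψc fc),
    intervalIntegral.integral_sub hcU (hcΦ Ψd fd)]
  ring

end ControlledState

/-! ### Hidden regularity of the boundary fluxes -/

section Admissible

open scoped InnerProductSpace

variable {c d : ℝ} {a : ℝ → ℝ} {V : Submodule ℝ (Pairs c d)} [CompleteSpace (slopeSpace V)]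
  {U : ℝ → StateSpace V →L[ℝ] StateSpace V} {bc bd : L2 c d × L2 c d →L[ℝ] ℝ}

/-- The multiplier `(x - 1) a` bounds the boundary values of the flux. -/
theorem IsBoundaryFlux.exists_observation_sq_le (hc : c < 1) (hd : 1 < d) (ha : IsWeight c d a)
    (hV : IsIntermediate c d a V) (hK : HasPoincare V) (hb : IsBoundaryFlux a bc bd) :
    ∃ (L : StateSpace V →L[ℝ] StateSpace V) (K : ℝ), ∀ y : StateSpace V,
      (d - 1) * observation hK bd y ^ 2 + (1 - c) * observation hK bc y ^ 2 ≤
        (⟪y, L (waveInverse (embedding hK) y)⟫_ℝ + ⟪waveInverse (embedding hK) y, L y⟫_ℝ) +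
          K * ‖waveInverse (embedding hK) y‖ ^ 2 := by
  obtain ⟨A, hA⟩ := ha.exists_multiplier
  obtain ⟨C, hC⟩ := ha.exists_abs_inner_multiplier_le hc hd hA
  obtain ⟨M, hM0, hM⟩ := ha.exists_le
  -- L(p, v) = (0, 2Ap). With (u, v) = By and v' the second component of y, ⟪y, L(By)⟫ is the term
  -- 2⟨v', (x - 1)a u_x⟩ of the multiplier identity, and ⟪By, Ly⟫ = 2∫(x - 1)a v v_x completes the
  -- time derivative.
  let L : StateSpace V →L[ℝ] StateSpace V :=
    (WithLp.prodContinuousLinearEquiv 2 ℝ (slopeSpace V) (L2 c d)).symm.toContinuousLinearMap ∘L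
      ((0 : StateSpace V →L[ℝ] slopeSpace V).prod
        ((2 : ℝ) • (A ∘L (slopeSpace V).subtypeL ∘L WithLp.fstL 2 ℝ (slopeSpace V) (L2 c d))))
  have hL : ∀ x y : StateSpace V, ⟪x, L y⟫_ℝ = 2 * ⟪x.snd, A (y.fst : L2 c d)⟫_ℝ := by
    intro x y
    have h1 : L y = WithLp.toLp 2 (0, (2 : ℝ) • A (y.fst : L2 c d)) := rfl
    rw [h1, WithLp.prod_inner_apply]
    simp only [inner_zero_right, zero_add, inner_smul_right]
    rfl
  -- M comes from ∫(a u_x)² ≤ M‖p‖², and 2|C| from the bound 2|∫(x - 1)a v v_x| ≤ 2C‖v‖² for the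
  -- term that is added.
  refine ⟨L, 2 * |C| + M, fun y => ?_⟩
  set x := waveInverse (embedding hK) y with hx
  have hgen := hV.gen_position hc hd ha hK y
  rw [← hx] at hgen
  obtain ⟨K, hKf⟩ := exists_flux_primitive (hc.trans hd) hgen.snd
  have hst : state hK (position hK x) x.snd = waveInverse (embedding hK) y :=
    state_position hK x
  have h2 := hb _ _ _ hKf
  rw [observation_apply hK bc hst, observation_apply hK bd hst, h2.1, h2.2,
    boundary_flux_sq_eq (hc.trans hd) hA hKf, hL, hL]
  have h3 : (position hK x).pair.2 = (x.fst : L2 c d) := by rw [pair_position]; rfl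
  have h4 := ha.integral_flux_sq_le hM (position hK x).pair
  have h5 := hC (position hK y).pair (by
    rw [← hV.coe_eq_H10 hc hd ha]; exact (position hK y).pair_mem)
  have h6 : (position hK y).pair.1 = x.snd := hgen.fst
  have h7 : (position hK y).pair.2 = (y.fst : L2 c d) := by rw [pair_position]; rfl
  rw [h6, h7] at h5
  rw [h3] at h4 ⊢
  have h8 : ‖(x.fst : L2 c d)‖ ^ 2 ≤ ‖x‖ ^ 2 := by
    have : ‖(x.fst : L2 c d)‖ ≤ ‖x‖ := WithLp.norm_fst_le _ x
    gcongr
  have h9 : ‖x.snd‖ ^ 2 ≤ ‖x‖ ^ 2 := by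
    have : ‖x.snd‖ ≤ ‖x‖ := WithLp.norm_snd_le _ x
    gcongr
  have h10 : C * ‖x.snd‖ ^ 2 ≤ |C| * ‖x‖ ^ 2 :=
    mul_le_mul (le_abs_self C) h9 (by positivity) (abs_nonneg C)
  have h11 : M * ‖(x.fst : L2 c d)‖ ^ 2 ≤ M * ‖x‖ ^ 2 := mul_le_mul_of_nonneg_left h8 hM0.le
  have h12 := (abs_le.1 h5).1
  linarith

theorem IsBoundaryFlux.isAdmissible (hc : c < 1) (hd : 1 < d) (ha : IsWeight c d a)
    (hV : IsIntermediate c d a V) (hK : HasPoincare V)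
    (hU : IsOrthogonalGroup (waveInverse (embedding hK)) U) (hb : IsBoundaryFlux a bc bd)
    {T : ℝ} (hT : 0 ≤ T) :
    IsAdmissible (waveInverse (embedding hK)) U (observation hK bc) T ∧
      IsAdmissible (waveInverse (embedding hK)) U (observation hK bd) T := by
  obtain ⟨L, K, h⟩ := hb.exists_observation_sq_le hc hd ha hV hK
  have key : ∀ (r : ℝ) (b : StateSpace V →L[ℝ] ℝ), 0 < r → (∀ y, r * b y ^ 2 ≤
      (⟪y, L (waveInverse (embedding hK) y)⟫_ℝ + ⟪waveInverse (embedding hK) y, L y⟫_ℝ) +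
          K * ‖waveInverse (embedding hK) y‖ ^ 2) →
      IsAdmissible (waveInverse (embedding hK)) U b T := by
    intro r b hr hrb
    refine hU.isAdmissible (K := r⁻¹ * K) hT (r⁻¹ • L) fun y => ?_
    have h1 := mul_le_mul_of_nonneg_left (hrb y) (inv_nonneg.2 hr.le)
    rw [← mul_assoc, inv_mul_cancel₀ hr.ne', one_mul] at h1
    have h2 : ∀ x z : StateSpace V, ⟪x, (r⁻¹ • L) z⟫_ℝ = r⁻¹ * ⟪x, L z⟫_ℝ := fun x z =>
      real_inner_smul_right x (L z) r⁻¹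
    rw [h2, h2]
    linarith
  refine ⟨key (1 - c) _ (by linarith) fun y => ?_, key (d - 1) _ (by linarith) fun y => ?_⟩
  · have h1 : 0 ≤ (d - 1) * observation hK bd y ^ 2 :=
      mul_nonneg (by linarith) (sq_nonneg _)
    linarith [h y]
  · have h1 : 0 ≤ (1 - c) * observation hK bc y ^ 2 :=
      mul_nonneg (by linarith) (sq_nonneg _)
    linarith [h y]

end Admissible

/-! ### Normal traces and the transposition identity -/

section NormalTraces

open scoped InnerProductSpace

variable {c d : ℝ} {a : ℝ → ℝ} {V : Submodule ℝ (Pairs c d)} [CompleteSpace (slopeSpace V)]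
  {U : ℝ → StateSpace V →L[ℝ] StateSpace V} {bc bd : L2 c d × L2 c d →L[ℝ] ℝ}
  {T : ℝ} {Ψc Ψd : StateSpace V →L[ℝ] Lp ℝ 2 (volume.restrict (Ioo 0 T))}

theorem isMild_group (hc : c < 1) (hd : 1 < d) (ha : IsWeight c d a)
    (hV : IsIntermediate c d a V) (hK : HasPoincare V)
    (hU : IsOrthogonalGroup (waveInverse (embedding hK)) U) (τ : ℝ) (ξ : StateSpace V) :
    IsMild a V τ (fun t => position hK (U (t - τ) ξ)) (fun t => (U (t - τ) ξ).snd) := by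
  rw [isMild_iff hc hd ha hV hK]
  simp only [state_position, sub_self, hU.zero]
  exact ⟨(hU.continuous_sub τ ξ).continuousOn, fun t _ => hU.mild τ t ξ⟩

theorem IsMild.state_eq (hc : c < 1) (hd : 1 < d) (ha : IsWeight c d a)
    (hV : IsIntermediate c d a V) (hK : HasPoincare V)
    (hU : IsOrthogonalGroup (waveInverse (embedding hK)) U) {τ : ℝ} {w : ℝ → Energy V}
    {z : ℝ → L2 c d} (h : IsMild a V τ w z) {t : ℝ} (ht : t ∈ Icc 0 τ) :
    state hK (w t) (z t) = U (t - τ) (state hK (w τ) (z τ)) := by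
  obtain ⟨h1, h2⟩ := (isMild_iff hc hd ha hV hK).1 h
  exact hU.eq_of_mild (isSkew_waveInverse _) (hV.injective_waveInverse ha hK) h1 h2 t ht

/-- The final state is approximated by elements By of the dense range of B; their trajectories are
classical, and continuity of Ψ gives convergence of the boundary slopes. Division by a(c) and a(d)
turns fluxes into slopes. -/
theorem hasNormalTraces_group (hc : c < 1) (hd : 1 < d) (ha : IsWeight c d a)
    (hV : IsIntermediate c d a V) (hK : HasPoincare V)
    (hU : IsOrthogonalGroup (waveInverse (embedding hK)) U) (hb : IsBoundaryFlux a bc bd)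
    (hΨc : ∀ y, Ψc (waveInverse (embedding hK) y) =ᵐ[volume.restrict (Ioo 0 T)]
      fun s => observation hK bc (U (-s) y))
    (hΨd : ∀ y, Ψd (waveInverse (embedding hK) y) =ᵐ[volume.restrict (Ioo 0 T)]
      fun s => observation hK bd (U (-s) y)) {τ : ℝ} (hτ : τ ∈ Icc 0 T) (ξ : StateSpace V) :
    HasNormalTraces a V τ (fun t => position hK (U (t - τ) ξ)) (fun t => (U (t - τ) ξ).snd)
      (fun t => Ψc ξ (τ - t) / a c) (fun t => Ψd ξ (τ - t) / a d) := by
  have hdense := (isSkew_waveInverse (embedding hK)).denseRange (hV.injective_waveInverse ha hK)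
  obtain ⟨x, hx, hxξ⟩ := mem_closure_iff_seq_limit.1 (hdense ξ)
  choose y hy using hx
  have hyξ : Tendsto (fun n => waveInverse (embedding hK) (y n)) atTop (𝓝 ξ) := by
    simpa only [hy] using hxξ
  let ι : StateSpace V →L[ℝ] Pairs c d := pairCLM hK ∘L WithLp.fstL 2 ℝ (slopeSpace V) (L2 c d)
  let κ : StateSpace V →L[ℝ] L2 c d := WithLp.sndL 2 ℝ (slopeSpace V) (L2 c d)
  refine ⟨memLp_reflect hτ _ _, memLp_reflect hτ _ _,
    fun n t => position hK (U (t - τ) (waveInverse (embedding hK) (y n))),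
    fun n t => (U (t - τ) (waveInverse (embedding hK) (y n))).snd,
    fun n t => observation hK bc (U (t - τ) (y n)) / a c,
    fun n t => observation hK bd (U (t - τ) (y n)) / a d,
    fun n => isClassical_group hc hd ha hV hK hU τ (y n), fun n t _ => ?_, ?_, ?_,
    tendsto_eLpNorm_observation hτ hΨc hyξ _, tendsto_eLpNorm_observation hτ hΨd hyξ _⟩
  · have h1 := hb.tendsto_slope hc hd ha hV hK
      (hV.gen_position hc hd ha hK (U (t - τ) (y n)))
    rw [state_position, ← hU.comm] at h1
    exact h1
  · have h2 : ∀ x : StateSpace V, (position hK (U (τ - τ) x)).pair = ι x := fun x => by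
      rw [sub_self, hU.zero, pair_position]
      rfl
    simp only [h2]
    exact (ι.continuous.tendsto ξ).comp hyξ
  · have h2 : ∀ x : StateSpace V, (U (τ - τ) x).snd = κ x := fun x => by
      rw [sub_self, hU.zero]
      rfl
    simp only [h2]
    exact (κ.continuous.tendsto ξ).comp hyξ

/-- Traces do not depend on the approximating classical solutions, since each such sequence is
observed through the same continuous Ψ. Hence the witnesses in the transposition identity carry no
freedom that affects its value. -/
theorem HasNormalTraces.ae_eq (hc : c < 1) (hd : 1 < d) (ha : IsWeight c d a)
    (hV : IsIntermediate c d a V) (hK : HasPoincare V)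
    (hU : IsOrthogonalGroup (waveInverse (embedding hK)) U) (hb : IsBoundaryFlux a bc bd)
    (hΨc : ∀ y, Ψc (waveInverse (embedding hK) y) =ᵐ[volume.restrict (Ioo 0 T)]
      fun s => observation hK bc (U (-s) y))
    (hΨd : ∀ y, Ψd (waveInverse (embedding hK) y) =ᵐ[volume.restrict (Ioo 0 T)]
      fun s => observation hK bd (U (-s) y)) {τ : ℝ} (hτ : τ ∈ Icc 0 T)
    {w : ℝ → Energy V} {z : ℝ → L2 c d} {gc gd : ℝ → ℝ} (h : HasNormalTraces a V τ w z gc gd) :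
    (gc =ᵐ[volume.restrict (Ioo 0 τ)] fun t => Ψc (state hK (w τ) (z τ)) (τ - t) / a c) ∧
    (gd =ᵐ[volume.restrict (Ioo 0 τ)] fun t => Ψd (state hK (w τ) (z τ)) (τ - t) / a d) := by
  obtain ⟨hgc, hgd, W, Z, Gc, Gd, hcl, hG, hW, hZ, hGc, hGd⟩ := h
  choose y hy hyG using fun n => (hcl n).exists_eq hc hd ha hV hK hU hb hτ.1
  have hcd : c < d := hc.trans hd
  have := essFilter_neBot_right (left_mem_Ico.2 hcd)
  have := essFilter_neBot_left (right_mem_Ioc.2 hcd)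
  have hlim : Tendsto (fun n => waveInverse (embedding hK) (y n)) atTop
      (𝓝 (state hK (w τ) (z τ))) := by
    have h1 := ((stateCLM V).continuous.tendsto ((w τ).pair, z τ)).comp (hW.prodMk_nhds hZ)
    rw [stateCLM_pair hK] at h1
    refine h1.congr fun n => ?_
    rw [← hy, ← stateCLM_pair hK]
    rfl
  exact ⟨ae_eq_reflect_of_tendsto hτ hΨc hlim
      (fun n t ht => tendsto_nhds_unique (hG n t ht).1 (hyG n t ht).1) hgc.1 hGc,
    ae_eq_reflect_of_tendsto hτ hΨd hlim
      (fun n t ht => tendsto_nhds_unique (hG n t ht).2 (hyG n t ht).2) hgd.1 hGd⟩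

/-- The transposition identity for the controlled state. -/
theorem inner_controlledState_state (hc : c < 1) (hd : 1 < d) (ha : IsWeight c d a)
    (hV : IsIntermediate c d a V) (hK : HasPoincare V)
    (hU : IsOrthogonalGroup (waveInverse (embedding hK)) U) (hb : IsBoundaryFlux a bc bd)
    (hΨc : ∀ y, Ψc (waveInverse (embedding hK) y) =ᵐ[volume.restrict (Ioo 0 T)]
      fun s => observation hK bc (U (-s) y))
    (hΨd : ∀ y, Ψd (waveInverse (embedding hK) y) =ᵐ[volume.restrict (Ioo 0 T)]
      fun s => observation hK bd (U (-s) y)) {τ : ℝ} (hτ : τ ∈ Icc 0 T)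
    {w : ℝ → Energy V} {z : ℝ → L2 c d} {gc gd : ℝ → ℝ} (hwz : IsMild a V τ w z)
    (h : HasNormalTraces a V τ w z gc gd) (ξ : StateSpace V)
    (fc fd : Lp ℝ 2 (volume.restrict (Ioo 0 T))) :
    ⟪controlledState U Ψc Ψd τ (ξ, fc, fd), state hK (w τ) (z τ)⟫_ℝ =
      ⟪ξ, state hK (w 0) (z 0)⟫_ℝ - a d * (∫ t in Ioo 0 τ, fd t * gd t) +
        a c * (∫ t in Ioo 0 τ, fc t * gc t) := by
  obtain ⟨h1, h2⟩ := h.ae_eq hc hd ha hV hK hU hb hΨc hΨd hτ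
  have hac : a c ≠ 0 := (ha.pos c (left_mem_Icc.2 (hc.trans hd).le) hc.ne).ne'
  have had : a d ≠ 0 := (ha.pos d (right_mem_Icc.2 (hc.trans hd).le) hd.ne').ne'
  have key : ∀ (Ψ : StateSpace V →L[ℝ] Lp ℝ 2 (volume.restrict (Ioo 0 T)))
      (f : Lp ℝ 2 (volume.restrict (Ioo 0 T))) (g : ℝ → ℝ) (r : ℝ), r ≠ 0 →
      (g =ᵐ[volume.restrict (Ioo 0 τ)] fun t => Ψ (state hK (w τ) (z τ)) (τ - t) / r) →
      r * (∫ t in Ioo 0 τ, f t * g t) =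
        ∫ t in Ioo 0 τ, f t * Ψ (state hK (w τ) (z τ)) (τ - t) := by
    intro Ψ f g r hr hg
    rw [← integral_const_mul]
    refine integral_congr_ae ?_
    filter_upwards [hg] with t ht
    rw [ht]
    field_simp
  rw [hU.inner_controlledState hτ, key Ψc fc gc _ hac h1, key Ψd fd gd _ had h2,
    ← hwz.state_eq hc hd ha hV hK hU (left_mem_Icc.2 hτ.1)]

end NormalTraces

/-! ### Continuity at time zero, and derivatives in the dual space -/

theorem ContinuousMap.ext_of_pos {E : Type*} [TopologicalSpace E] [T2Space E] {T : ℝ} (hT : 0 < T)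
    {f g : C(Icc (0 : ℝ) T, E)} (h : ∀ t : Icc (0 : ℝ) T, 0 < (t : ℝ) → f t = g t) : f = g := by
  have hmem : ∀ n : ℕ, T / ((n : ℝ) + 1) ∈ Icc 0 T := fun n =>
    ⟨by positivity, div_le_self hT.le (by linarith [n.cast_nonneg (α := ℝ)])⟩
  let x : ℕ → Icc (0 : ℝ) T := fun n => ⟨T / ((n : ℝ) + 1), hmem n⟩
  have hx : Tendsto x atTop (𝓝 ⟨0, left_mem_Icc.2 hT.le⟩) :=
    tendsto_subtype_rng.2 (by
      simpa only [Function.comp_def, Nat.cast_add, Nat.cast_one] using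
        (tendsto_const_div_atTop_nhds_zero_nat T).comp (tendsto_add_atTop_nat 1))
  ext t
  rcases t.2.1.eq_or_lt with h0 | h0
  · have ht : t = ⟨0, left_mem_Icc.2 hT.le⟩ := Subtype.ext h0.symm
    rw [ht]
    refine tendsto_nhds_unique ((f.continuous.tendsto _).comp hx)
      (((g.continuous.tendsto _).comp hx).congr fun n => ?_)
    exact (h (x n) (by positivity : 0 < T / ((n : ℝ) + 1))).symm
  · exact h t h0

theorem hasDerivWithinAt_dual_comp {E G : Type*} [SeminormedAddCommGroup E]
    [NormedSpace ℝ E] [NormedAddCommGroup G] [NormedSpace ℝ G] (L : G →L[ℝ] StrongDual ℝ E)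
    {g : ℝ → G} {g' : G} {s : Set ℝ} {t : ℝ} (h : HasDerivWithinAt g g' s t) :
    HasDerivWithinAt (fun r => L (g r)) (L g') s t := by
  -- Even over a seminormed space a functional of norm zero vanishes, so the dual is a normed space
  -- and the chain rule applies.
  let : NormedAddCommGroup (StrongDual ℝ E) := NormedAddCommGroup.ofSeparation fun f hf => by
    ext x
    have h1 := f.le_opNorm x
    rw [hf, zero_mul] at h1
    exact norm_le_zero_iff.1 h1
  exact L.hasFDerivAt.comp_hasDerivWithinAt t h

/-! ### The solution by transposition: construction, estimate, uniqueness -/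

section Solution

open scoped InnerProductSpace

variable {c d : ℝ} {a : ℝ → ℝ} {V : Submodule ℝ (Pairs c d)}

/-- The functional on `V¹_{a,0}(Ω)` that is represented by a weighted slope. -/
noncomputable def dualElement (hK : HasPoincare V) : slopeSpace V →L[ℝ] EnergyDual V :=
  LinearMap.mkContinuous
    { toFun := fun p => (innerSL ℝ p) ∘L
        ((energyEquiv hK).toContinuousLinearEquiv : Energy V →L[ℝ] slopeSpace V)
      map_add' := fun p q => by
        ext u
        exact inner_add_left p q (energyEquiv hK u)
      map_smul' := fun r p => by
        ext u
        exact real_inner_smul_left p (energyEquiv hK u) r } 1 fun p => by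
    refine ContinuousLinearMap.opNorm_le_bound _ (by positivity) fun u => ?_
    rw [one_mul]
    exact (norm_inner_le_norm p (energyEquiv hK u)).trans_eq
      (by rw [LinearIsometryEquiv.norm_map])

theorem dualElement_apply (hK : HasPoincare V) (p : slopeSpace V) (u : Energy V) :
    dualElement hK p u = ⟪p, energyEquiv hK u⟫_ℝ := rfl

theorem norm_dualElement_le (hK : HasPoincare V) (p : slopeSpace V) :
    ‖dualElement hK p‖ ≤ ‖p‖ := by
  refine ContinuousLinearMap.opNorm_le_bound _ (norm_nonneg p) fun u => ?_
  rw [dualElement_apply]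
  exact (norm_inner_le_norm p (energyEquiv hK u)).trans_eq
      (by rw [LinearIsometryEquiv.norm_map])

theorem inner_state (hK : HasPoincare V) (x : StateSpace V) (u : Energy V) (v : L2 c d) :
    ⟪x, state hK u v⟫_ℝ = dualElement hK x.fst u + ⟪x.snd, v⟫_ℝ :=
  WithLp.prod_inner_apply _ _

variable [CompleteSpace (slopeSpace V)]

/-- The Riesz representative of a functional on `V¹_{a,0}(Ω)`. -/
noncomputable def riesz (hK : HasPoincare V) : EnergyDual V →ₗ[ℝ] slopeSpace V where
  toFun y := (InnerProductSpace.toDual ℝ (slopeSpace V)).symm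
    (y ∘L ((energyEquiv hK).symm.toContinuousLinearEquiv : slopeSpace V →L[ℝ] Energy V))
  map_add' y z := by
    rw [ContinuousLinearMap.add_comp, map_add]
  map_smul' r y := by
    rw [ContinuousLinearMap.smul_comp, LinearIsometryEquiv.map_smulₛₗ]
    rfl

theorem inner_riesz (hK : HasPoincare V) (y : EnergyDual V) (u : Energy V) :
    ⟪riesz hK y, energyEquiv hK u⟫_ℝ = y u := by
  refine InnerProductSpace.toDual_symm_apply.trans ?_
  exact congrArg y ((energyEquiv hK).symm_apply_apply u)

theorem norm_riesz_le (hK : HasPoincare V) (y : EnergyDual V) : ‖riesz hK y‖ ≤ ‖y‖ := by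
  refine ((InnerProductSpace.toDual ℝ (slopeSpace V)).symm.norm_map _).trans_le ?_
  refine ContinuousLinearMap.opNorm_le_bound _ (norm_nonneg y) fun p => ?_
  exact (y.le_opNorm _).trans_eq (congrArg _ ((energyEquiv hK).symm.norm_map p))

/-- The data, with the initial state `(y₁, -y₀)` as an element of the dual of the state space. -/
noncomputable def initialData (hK : HasPoincare V) (T : ℝ) : Data V T →ₗ[ℝ]
    StateSpace V × Lp ℝ 2 (volume.restrict (Ioo 0 T)) × Lp ℝ 2 (volume.restrict (Ioo 0 T)) where
  toFun D := (WithLp.toLp 2 (riesz hK D.2.1, -D.1), D.2.2)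
  map_add' D D' := by
    refine Prod.ext ?_ rfl
    change WithLp.toLp 2 (riesz hK (D.2.1 + D'.2.1), -(D.1 + D'.1)) = _
    rw [map_add, neg_add]
    rfl
  map_smul' r D := by
    refine Prod.ext ?_ rfl
    change WithLp.toLp 2 (riesz hK (r • D.2.1), -(r • D.1)) = _
    rw [map_smul, ← smul_neg]
    rfl

theorem inner_initialData (hK : HasPoincare V) {T : ℝ} (D : Data V T) (u : Energy V)
    (v : L2 c d) : ⟪(initialData hK T D).1, state hK u v⟫_ℝ = D.2.1 u - ⟪D.1, v⟫_ℝ := by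
  refine (WithLp.prod_inner_apply _ _).trans ?_
  change ⟪riesz hK D.2.1, energyEquiv hK u⟫_ℝ + ⟪-D.1, v⟫_ℝ = _
  rw [inner_riesz, inner_neg_left, sub_eq_add_neg]

theorem norm_initialData_le (hK : HasPoincare V) {T : ℝ} (D : Data V T) :
    ‖(initialData hK T D).1‖ ≤ ‖D.1‖ + ‖D.2.1‖ := by
  have h1 : ‖(initialData hK T D).1‖ ^ 2 = ‖riesz hK D.2.1‖ ^ 2 + ‖-D.1‖ ^ 2 :=
    WithLp.prod_norm_sq_eq_of_L2 _
  rw [norm_neg] at h1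
  have h2 := norm_riesz_le hK D.2.1
  refine abs_le_of_sq_le_sq' ?_ (by positivity) |>.2
  rw [h1]
  nlinarith [norm_nonneg D.1, norm_nonneg D.2.1, norm_nonneg (riesz hK D.2.1)]

variable {U : ℝ → StateSpace V →L[ℝ] StateSpace V} {bc bd : L2 c d × L2 c d →L[ℝ] ℝ}
  {T : ℝ} {Ψc Ψd : StateSpace V →L[ℝ] Lp ℝ 2 (volume.restrict (Ioo 0 T))}

/-- The map that assigns the solution by transposition to the data. -/
noncomputable def solutionMap (hK : HasPoincare V)
    (hU : IsOrthogonalGroup (waveInverse (embedding hK)) U)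
    (Ψc Ψd : StateSpace V →L[ℝ] Lp ℝ 2 (volume.restrict (Ioo 0 T))) :
    Data V T →ₗ[ℝ] Trajectories V T where
  toFun D :=
    (⟨fun τ => -(controlledState U Ψc Ψd τ (initialData hK T D)).snd,
      ((WithLp.sndL 2 ℝ (slopeSpace V) (L2 c d)).continuous.comp
        ((hU.continuous_controlledState _).comp continuous_subtype_val)).neg⟩,
     ⟨fun τ => dualElement hK (controlledState U Ψc Ψd τ (initialData hK T D)).fst,
      ((dualElement hK) ∘L (WithLp.fstL 2 ℝ (slopeSpace V) (L2 c d))).continuous.comp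
        ((hU.continuous_controlledState _).comp continuous_subtype_val)⟩)
  map_add' D D' := by
    refine Prod.ext (ContinuousMap.ext fun τ => ?_) (ContinuousMap.ext fun τ => ?_)
    · change -(controlledState U Ψc Ψd τ (initialData hK T (D + D'))).snd =
        -(controlledState U Ψc Ψd τ (initialData hK T D)).snd +
          -(controlledState U Ψc Ψd τ (initialData hK T D')).snd
      rw [map_add, map_add, WithLp.add_snd, neg_add]
    · change dualElement hK (controlledState U Ψc Ψd τ (initialData hK T (D + D'))).fst =
        dualElement hK (controlledState U Ψc Ψd τ (initialData hK T D)).fst +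
          dualElement hK (controlledState U Ψc Ψd τ (initialData hK T D')).fst
      rw [map_add, map_add, WithLp.add_fst, map_add]
  map_smul' r D := by
    refine Prod.ext (ContinuousMap.ext fun τ => ?_) (ContinuousMap.ext fun τ => ?_)
    · change -(controlledState U Ψc Ψd τ (initialData hK T (r • D))).snd =
        r • -(controlledState U Ψc Ψd τ (initialData hK T D)).snd
      rw [map_smul, map_smul, WithLp.smul_snd, smul_neg]
    · change dualElement hK (controlledState U Ψc Ψd τ (initialData hK T (r • D))).fst =
        r • dualElement hK (controlledState U Ψc Ψd τ (initialData hK T D)).fst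
      rw [map_smul, map_smul, WithLp.smul_fst, map_smul]

theorem solutionMap_fst (hK : HasPoincare V)
    (hU : IsOrthogonalGroup (waveInverse (embedding hK)) U) (D : Data V T) (τ : Icc (0 : ℝ) T) :
    (solutionMap hK hU Ψc Ψd D).1 τ =
      -(controlledState U Ψc Ψd τ (initialData hK T D)).snd := rfl

theorem solutionMap_snd (hK : HasPoincare V)
    (hU : IsOrthogonalGroup (waveInverse (embedding hK)) U) (D : Data V T) (τ : Icc (0 : ℝ) T) :
    (solutionMap hK hU Ψc Ψd D).2 τ =
      dualElement hK (controlledState U Ψc Ψd τ (initialData hK T D)).fst := rfl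

theorem norm_solutionMap_le (hK : HasPoincare V)
    (hU : IsOrthogonalGroup (waveInverse (embedding hK)) U) (D : Data V T) :
    ‖(solutionMap hK hU Ψc Ψd D).1‖ + ‖(solutionMap hK hU Ψc Ψd D).2‖ ≤
      2 * (1 + ‖Ψc‖ + ‖Ψd‖) * (‖D.1‖ + ‖D.2.1‖ + ‖D.2.2.1‖ + ‖D.2.2.2‖) := by
  set R := (1 + ‖Ψc‖ + ‖Ψd‖) * (‖D.1‖ + ‖D.2.1‖ + ‖D.2.2.1‖ + ‖D.2.2.2‖) with hR
  have hR0 : 0 ≤ R := by positivity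
  have hZ : ∀ τ, ‖controlledState U Ψc Ψd τ (initialData hK T D)‖ ≤ R := by
    intro τ
    have h1 := hU.norm_controlledState_le (Ψc := Ψc) (Ψd := Ψd) τ (initialData hK T D).1
      D.2.2.1 D.2.2.2
    have h2 := norm_initialData_le hK D
    refine le_trans h1 ?_
    have h3 : 0 ≤ ‖Ψc‖ * (‖D.1‖ + ‖D.2.1‖ + ‖D.2.2.2‖) := by positivity
    have h4 : 0 ≤ ‖Ψd‖ * (‖D.1‖ + ‖D.2.1‖ + ‖D.2.2.1‖) := by positivity
    have h5 := norm_nonneg D.2.2.1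
    have h6 := norm_nonneg D.2.2.2
    rw [hR]
    linarith
  have h1 : ‖(solutionMap hK hU Ψc Ψd D).1‖ ≤ R := by
    rw [ContinuousMap.norm_le _ hR0]
    intro τ
    rw [solutionMap_fst, norm_neg]
    exact (WithLp.norm_snd_le _ _).trans (hZ τ)
  have h2 : ‖(solutionMap hK hU Ψc Ψd D).2‖ ≤ R := by
    rw [ContinuousMap.norm_le _ hR0]
    intro τ
    rw [solutionMap_snd]
    exact (norm_dualElement_le hK _).trans ((WithLp.norm_fst_le _ _).trans (hZ τ))
  linarith

/-- Through the pivot space, y is represented by the slope component of BZ, where Z is the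
controlled state. Tested with (p, 0), the integrated equation says that this component is a constant
plus the integral of the slope component of Z, which represents y_t. -/
theorem exists_hasDerivWithinAt_solutionMap (ha : IsWeight c d a)
    (hV : IsIntermediate c d a V) (hK : HasPoincare V)
    (hU : IsOrthogonalGroup (waveInverse (embedding hK)) U)
    (hΨc : ∀ y, Ψc (waveInverse (embedding hK) y) =ᵐ[volume.restrict (Ioo 0 T)]
      fun s => observation hK bc (U (-s) y))
    (hΨd : ∀ y, Ψd (waveInverse (embedding hK) y) =ᵐ[volume.restrict (Ioo 0 T)]
      fun s => observation hK bd (U (-s) y)) (D : Data V T) :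
    ∃ y : ℝ → EnergyDual V, ∀ t : Icc (0 : ℝ) T,
      (∀ v : Energy V, y t v = ⟪(solutionMap hK hU Ψc Ψd D).1 t, v.pair.1⟫_ℝ) ∧
      HasDerivWithinAt y ((solutionMap hK hU Ψc Ψd D).2 t) (Icc 0 T) t := by
  set B := waveInverse (embedding hK) with hB
  have hdense := (isSkew_waveInverse (embedding hK)).denseRange (hV.injective_waveInverse ha hK)
  let π : StateSpace V →L[ℝ] slopeSpace V := WithLp.fstL 2 ℝ (slopeSpace V) (L2 c d)
  set Z : ℝ → StateSpace V := fun t => controlledState U Ψc Ψd t (initialData hK T D) with hZ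
  have hcZ : Continuous fun t => π (Z t) :=
    π.continuous.comp (hU.continuous_controlledState (initialData hK T D))
  have hint : ∀ t ∈ Icc 0 T, π (B (Z t)) =
      π (B (initialData hK T D).1) + ∫ s in (0 : ℝ)..t, π (Z s) := by
    intro t ht
    refine ext_inner_right ℝ fun p => ?_
    have h1 := hU.inner_apply_controlledState (isSkew_waveInverse _) hdense hΨc hΨd ht
      (initialData hK T D) (observation_toLp_zero hK bc p) (observation_toLp_zero hK bd p)
    have h2 : ∀ x : StateSpace V, ⟪x, WithLp.toLp 2 (p, (0 : L2 c d))⟫_ℝ = ⟪π x, p⟫_ℝ := by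
      intro x
      refine (WithLp.prod_inner_apply _ _).trans ?_
      change ⟪x.fst, p⟫_ℝ + ⟪x.snd, (0 : L2 c d)⟫_ℝ = ⟪x.fst, p⟫_ℝ
      rw [inner_zero_right, add_zero]
    simp only [h2] at h1
    refine h1.trans ?_
    rw [inner_add_left]
    congr 1
    have h3 := (innerSL ℝ p).intervalIntegral_comp_comm
      (hcZ.intervalIntegrable (μ := volume) 0 t)
    simp only [innerSL_apply_apply] at h3
    rw [real_inner_comm, ← h3]
    simp only [real_inner_comm p]
    rfl
  refine ⟨fun t => dualElement hK (π (B (Z t))), fun t => ⟨fun v => ?_, ?_⟩⟩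
  · have h1 : π (B (Z t)) = -(ContinuousLinearMap.adjoint (embedding hK) (Z t).snd) := rfl
    beta_reduce
    rw [h1, dualElement_apply, inner_neg_left, ContinuousLinearMap.adjoint_inner_left,
      embedding_energyEquiv, solutionMap_fst, inner_neg_left]
  · have h1 : HasDerivAt (fun t => π (B (initialData hK T D).1) + ∫ s in (0 : ℝ)..t, π (Z s))
        (π (Z t)) t :=
      (intervalIntegral.integral_hasDerivAt_right (hcZ.intervalIntegrable _ _)
        (hcZ.stronglyMeasurableAtFilter _ _) hcZ.continuousAt).const_add _
    exact hasDerivWithinAt_dual_comp (dualElement hK)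
      (h1.hasDerivWithinAt.congr_of_mem hint t.2)

theorem isTranspositionSolution_solutionMap (hc : c < 1) (hd : 1 < d) (ha : IsWeight c d a)
    (hV : IsIntermediate c d a V) (hK : HasPoincare V)
    (hU : IsOrthogonalGroup (waveInverse (embedding hK)) U) (hb : IsBoundaryFlux a bc bd)
    (hΨc : ∀ y, Ψc (waveInverse (embedding hK) y) =ᵐ[volume.restrict (Ioo 0 T)]
      fun s => observation hK bc (U (-s) y))
    (hΨd : ∀ y, Ψd (waveInverse (embedding hK) y) =ᵐ[volume.restrict (Ioo 0 T)]
      fun s => observation hK bd (U (-s) y)) (D : Data V T) :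
    IsTranspositionSolution a V T D (solutionMap hK hU Ψc Ψd D) := by
  refine ⟨exists_hasDerivWithinAt_solutionMap ha hV hK hU hΨc hΨd D, fun τ _ w₀ w₁ => ?_⟩
  have hmild := isMild_group hc hd ha hV hK hU (τ : ℝ) (state hK w₀ w₁)
  have htr := hasNormalTraces_group hc hd ha hV hK hU hb hΨc hΨd τ.2 (state hK w₀ w₁)
  have hw : position hK (U ((τ : ℝ) - τ) (state hK w₀ w₁)) = w₀ := by
    rw [sub_self, hU.zero, position_state]
  have hz : (U ((τ : ℝ) - τ) (state hK w₀ w₁)).snd = w₁ := by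
    rw [sub_self, hU.zero]; rfl
  refine ⟨_, _, _, _, hmild, hw, hz, htr, ?_⟩
  have h1 := inner_controlledState_state hc hd ha hV hK hU hb hΨc hΨd τ.2 hmild htr
    (initialData hK T D).1 D.2.2.1 D.2.2.2
  rw [inner_initialData, hw, hz, inner_state] at h1
  rw [solutionMap_fst, solutionMap_snd, inner_neg_left, sub_neg_eq_add]
  exact h1

/-- For τ > 0 mild solution and traces are determined by (w₀, w₁), so the identity fixes the value
on all such pairs. The choices w₀ = 0 and w₁ = 0 separate y from y_t, and continuity covers τ = 0.
-/
theorem IsTranspositionSolution.eq_solutionMap (hc : c < 1) (hd : 1 < d) (ha : IsWeight c d a)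
    (hV : IsIntermediate c d a V) (hK : HasPoincare V)
    (hU : IsOrthogonalGroup (waveInverse (embedding hK)) U) (hb : IsBoundaryFlux a bc bd)
    (hΨc : ∀ y, Ψc (waveInverse (embedding hK) y) =ᵐ[volume.restrict (Ioo 0 T)]
      fun s => observation hK bc (U (-s) y))
    (hΨd : ∀ y, Ψd (waveInverse (embedding hK) y) =ᵐ[volume.restrict (Ioo 0 T)]
      fun s => observation hK bd (U (-s) y)) (hT : 0 < T) {D : Data V T} {Y : Trajectories V T}
    (h : IsTranspositionSolution a V T D Y) : Y = solutionMap hK hU Ψc Ψd D := by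
  have key : ∀ τ : Icc (0 : ℝ) T, 0 < (τ : ℝ) → ∀ (w₀ : Energy V) (w₁ : L2 c d),
      Y.2 τ w₀ - ⟪Y.1 τ, w₁⟫_ℝ =
        (solutionMap hK hU Ψc Ψd D).2 τ w₀ - ⟪(solutionMap hK hU Ψc Ψd D).1 τ, w₁⟫_ℝ := by
    intro τ hτ w₀ w₁
    obtain ⟨w, z, gc, gd, hmild, rfl, rfl, htr, h1⟩ := h.identity τ hτ w₀ w₁
    have h2 := inner_controlledState_state hc hd ha hV hK hU hb hΨc hΨd τ.2 hmild htr
      (initialData hK T D).1 D.2.2.1 D.2.2.2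
    rw [inner_initialData, inner_state] at h2
    rw [solutionMap_fst, solutionMap_snd, inner_neg_left, sub_neg_eq_add, h1]
    exact h2.symm
  refine Prod.ext (ContinuousMap.ext_of_pos hT fun τ hτ => ?_)
    (ContinuousMap.ext_of_pos hT fun τ hτ => ?_)
  · refine ext_inner_right ℝ fun v => ?_
    have h1 := key τ hτ 0 v
    rw [map_zero, map_zero] at h1
    linarith
  · ext v
    have h1 := key τ hτ v 0
    rwa [inner_zero_right, inner_zero_right, sub_zero, sub_zero] at h1

end Solution

end DegWave

theorem mainTheorem9 (c d : ℝ) (hc₀ : 0 ≤ c) (hc₁ : c < 1) (hd₁ : 1 < d) (hd₂ : d ≤ 2)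
    (a : ℝ → ℝ) (ha : DegWave.IsWeight c d a)
    (V : Submodule ℝ (DegWave.Pairs c d)) (hV : DegWave.IsIntermediate c d a V)
    (T : ℝ) (hT : 0 < T) :
    (∀ D : DegWave.Data V T,
      ∃! Y : DegWave.Trajectories V T, DegWave.IsTranspositionSolution a V T D Y) ∧
    ∃ S : DegWave.Data V T →ₗ[ℝ] DegWave.Trajectories V T,
      (∀ D : DegWave.Data V T, DegWave.IsTranspositionSolution a V T D (S D)) ∧
      ∃ C : ℝ, 0 < C ∧ ∀ (y₀ : DegWave.L2 c d) (y₁ : DegWave.EnergyDual V)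
        (fc fd : MeasureTheory.Lp ℝ 2 (MeasureTheory.volume.restrict (Set.Ioo 0 T))),
        ‖(S (y₀, y₁, fc, fd)).1‖ + ‖(S (y₀, y₁, fc, fd)).2‖ ≤
          C * (‖y₀‖ + ‖y₁‖ + ‖fc‖ + ‖fd‖) := by
  have hK := hV.hasPoincare hc₁ hd₁ ha
  have := hV.completeSpace_slopeSpace hc₁ hd₁ ha
  have hB := DegWave.isSkew_waveInverse (DegWave.embedding hK)
  have hi := hV.injective_waveInverse ha hK
  obtain ⟨U, hU⟩ := hB.exists_group hi
  obtain ⟨bc, bd, hb⟩ := ha.exists_boundary_flux (hc₁.trans hd₁)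
  obtain ⟨hadc, hadd⟩ := DegWave.IsBoundaryFlux.isAdmissible hc₁ hd₁ ha hV hK hU hb hT.le
  obtain ⟨Ψc, hΨc⟩ := hU.exists_observation (hB.denseRange hi) hadc
  obtain ⟨Ψd, hΨd⟩ := hU.exists_observation (hB.denseRange hi) hadd
  have hS := DegWave.isTranspositionSolution_solutionMap hc₁ hd₁ ha hV hK hU hb hΨc hΨd
  exact ⟨fun D => ⟨_, hS D, fun Y hY => hY.eq_solutionMap hc₁ hd₁ ha hV hK hU hb hΨc hΨd hT⟩,
    DegWave.solutionMap hK hU Ψc Ψd, hS, 2 * (1 + ‖Ψc‖ + ‖Ψd‖), by positivity,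
    fun y₀ y₁ fc fd => DegWave.norm_solutionMap_le hK hU (y₀, y₁, fc, fd)⟩
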